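/- **Setting.** Let $d=(d_i)_{i=1}^n$ be a sequence of nonnegative integers whose sum $N=\sum_i d_i$ is even. Vertex $v_i$ has $d_i$ half-edges; all half-edges are numbered from $1$ to $N$ in an arbitrary order, and $s\in v_i$ means that the half-edge $s$ belongs to $v_i$. Let $n_k=|\{i:d_i=k\}|$, let $a\vee b$ and $a\wedge b$ be the maximum and the minimum, and let $\mathfrak g$ be a uniformly random perfect matching (partition into pairs) of $\{1,\dots,N\}$. Consider the following sets, whose members $\alpha$ are sets of pairs of half-edges: - $\Gamma_{11}$ (possible isolated edges): $\alpha=\{\{s,t\}\}$ with $s\in v_i$, $t\in v_j$, $i\ne j$, $d_i=d_j=1$; - $\Gamma_{12}$ (possible isolated 2-stars): $\alpha=\{\{s,u\},\{t,v\}\}$ with $s\in v_i$, $t\in v_j$, $u\ne v\in v_k$, $i\neq j$, $d_i=d_j=1$, $d_k=2$; - $\Gamma_{21}$ (possible self-loops): $\alpha=\{\{s,t\}\}$ with $s\ne t\in v_i$; - $\Gamma_{22}$ (possible double edges): $\alpha=\{\{s,u\},\{t,v\}\}$ with $s\ne t\in v_i$, $u\neq v\in v_j$, $i\ne j$. Let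 $\Gamma$ be the union of these four sets, let $e=e(\alpha)\in\{1,2\}$ be the number of pairs of $\alpha$, and let $I_\alpha$ be the indicator that all pairs of $\alpha$ belong to $\mathfrak g$. **Coupling by switching.** For $\alpha\in\Gamma$ write its pairs as $\{a_\ell,b_\ell\}$ with $a_\ell<b_\ell$ and $a_1<\dots<a_e$. On the probability space of $\mathfrak g$ let $B_{\alpha,\ell}$ ($\alpha\in\Gamma$, $1\le\ell\le e(\alpha)$) be uniform on $\{1,\dots,N-2(e(\alpha)-\ell)-1\}$, such that all the $B_{\alpha,\ell}$ and $\mathfrak g$ are independent. If $I_\alpha=0$, put $\mathfrak g_\alpha=\mathfrak g$. If $I_\alpha=1$, put $g_0=\mathfrak g$ and, for $\ell=1,\dots,e$, let $t$ be the $B_{\alpha,\ell}$-th smallest element of $\{1,\dots,N\}\setminus(\{a_\ell\}\cup\bigcup_{m>\ell}\{a_m,b_m\})$, let $t'$ be its partner in $g_{\ell-1}$, and let $$g_\ell=\big(g_{\ell-1}\setminus\{\{a_\ell,b_\ell\},\{t,t'\}\}\big)\cup\{\{a_\ell,t\},\{b_\ell,t'\}\}$$ (so $g_\ell=g_{\ell-1}$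 if $t=b_\ell$); put $\mathfrak g_\alpha=g_e$. Let $J_{\beta\alpha}$ be the indicator that all pairs of $\beta$ belong to $\mathfrak g_\alpha$. Finally let $$W_1=\Big(\tfrac1{\sqrt n}\sum_{\alpha\in\Gamma_{1j}}(I_\alpha-\mathbb E I_\alpha)\Big)_{j=1,2},\qquad S_n=\sum_{\alpha\in\Gamma_{21}}I_\alpha,\qquad M_n=\sum_{\alpha\in\Gamma_{22}}I_\alpha .$$ **Proposition.** Suppose that $N>15$ and $n_1\ge1$, and let $c_*$ be any real number with $\dfrac{n_1\vee n_2}{N-15}\le c_*$. Then, both for $W_2=(S_n,M_n)$ and for $W_2=S_n+M_n$, $$\sum_{j,k=1}^2\sqrt{\operatorname{Var}\Big(\mathbb E\Big[\sum_{\alpha\in\Gamma_{1j}}I_\alpha\sum_{\beta\in\Gamma_{1k}}(I_\beta-J_{\beta\alpha})\,\Big|\,W_1,W_2\Big]\Big)}\;\le\; C_1(c_*)\,\frac{n_1\vee n_2}{\sqrt{N-1}},$$ where $$\begin{aligned}C_1(c)={}&\sqrt{3\left(\tfrac12+\tfrac32c^2+4c^3+\tfrac72c^4+2c^6\right)}+\sqrt{2\left(2c^3+5c^4+68c^5+72c^6+72c^8\right)}\\&+\sqrt{2\left(2c^3+8c^4+4c^5+56c^6+72c^8\right)}\\&+\sqrt{3\left(c+24c^4+64c^5+328c^6+256c^7+872c^8+2048c^{10}\right)}.\end{aligned}$$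 -/

import Mathlib

open MeasureTheory ProbabilityTheory

noncomputable section

namespace ConfigModel

/-- A perfect matching (configuration) of the half-edges `Fin N`, given by the map that sends every
half-edge to its partner: a fixed-point-free involution. -/
abbrev Matching (N : ℕ) : Type :=
  {g : Fin N → Fin N // ∀ s, g (g s) = s ∧ g s ≠ s}

/-- The set of pairs of a perfect matching. -/
def Matching.pairs {N : ℕ} (g : Matching N) : Finset (Sym2 (Fin N)) :=
  Finset.univ.image fun s => s(s, g.1 s)

theorem Matching.mem_pairs {N : ℕ} (g : Matching N) (x y : Fin N) :
    s(x, y) ∈ g.pairs ↔ g.1 x = y := by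
  have := (g.2 x).1
  have := (g.2 y).1
  simp only [Matching.pairs, Finset.mem_image, Finset.mem_univ, true_and, Sym2.eq_iff]
  grind

/-- `n_k`, the number of vertices of degree `k`. -/
def numDeg {n : ℕ} (d : Fin n → ℕ) (k : ℕ) : ℕ :=
  (Finset.univ.filter fun i => d i = k).card

section IndexSets

/- `d` is the degree sequence and `own s` is the vertex to which the half-edge `s` is incident.
A possible copy `α` of a small multigraph is the set of the pairs of half-edges that specify it. -/
variable {n N : ℕ} (d : Fin n → ℕ) (own : Fin N → Fin n)

open Classical in
/-- The possible isolated edges. -/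
def possibleEdges : Finset (Finset (Sym2 (Fin N))) :=
  Finset.univ.filter fun α => ∃ s t : Fin N,
    own s ≠ own t ∧ d (own s) = 1 ∧ d (own t) = 1 ∧ α = {s(s, t)}

open Classical in
/-- The possible isolated 2-stars. -/
def possibleTwoStars : Finset (Finset (Sym2 (Fin N))) :=
  Finset.univ.filter fun α => ∃ s t u v : Fin N,
    own s ≠ own t ∧ d (own s) = 1 ∧ d (own t) = 1 ∧
      u ≠ v ∧ own u = own v ∧ d (own u) = 2 ∧ α = {s(s, u), s(t, v)}

open Classical in
/-- The possible self-loops. -/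
def possibleLoops : Finset (Finset (Sym2 (Fin N))) :=
  Finset.univ.filter fun α => ∃ s t : Fin N, s ≠ t ∧ own s = own t ∧ α = {s(s, t)}

open Classical in
/-- The possible double edges. -/
def possibleDoubleEdges : Finset (Finset (Sym2 (Fin N))) :=
  Finset.univ.filter fun α => ∃ s t u v : Fin N,
    s ≠ t ∧ own s = own t ∧ u ≠ v ∧ own u = own v ∧ own s ≠ own u ∧ α = {s(s, u), s(t, v)}

/-- `Γ₁₁` (index `0`) and `Γ₁₂` (index `1`). -/
def Gam1 : Fin 2 → Finset (Finset (Sym2 (Fin N))) :=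
  ![possibleEdges d own, possibleTwoStars d own]

/-- `Γ₂₁` (index `0`) and `Γ₂₂` (index `1`). -/
def Gam2 : Fin 2 → Finset (Finset (Sym2 (Fin N))) :=
  ![possibleLoops own, possibleDoubleEdges own]

/-- `Γ`, the union of `Γ₁₁`, `Γ₁₂`, `Γ₂₁` and `Γ₂₂`. -/
def Gam : Finset (Finset (Sym2 (Fin N))) :=
  (Finset.univ.biUnion (Gam1 d own)) ∪ (Finset.univ.biUnion (Gam2 own))

theorem mem_Gam_of_mem_Gam1 {j : Fin 2} {α : Finset (Sym2 (Fin N))} (h : α ∈ Gam1 d own j) :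
    α ∈ Gam d own :=
  Finset.mem_union_left _ (Finset.mem_biUnion.2 ⟨j, Finset.mem_univ _, h⟩)

end IndexSets

section Switching

variable {N : ℕ}

/-- The pairs of `α`, each written as `(smaller half-edge, larger half-edge)`. The order is
lexicographic, so disjoint pairs are ordered by their smaller half-edges. -/
def edgeSet (α : Finset (Sym2 (Fin N))) : Finset (Fin N ×ₗ Fin N) :=
  α.image fun e => toLex (e.inf, e.sup)

/-- `e(H)`, the number of edges of `α`. -/
def numEdges (α : Finset (Sym2 (Fin N))) : ℕ := (edgeSet α).card

/-- The smaller half-edge `s_{ℓ,1} ∧ s_{ℓ,2}` of the `ℓ`-th edge of `α` in ascending order. -/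
def lo (α : Finset (Sym2 (Fin N))) (l : Fin (numEdges α)) : Fin N :=
  (ofLex ((edgeSet α).orderEmbOfFin rfl l)).1

/-- The larger half-edge `s_{ℓ,1} ∨ s_{ℓ,2}` of the `ℓ`-th edge of `α` in ascending order. -/
def hi (α : Finset (Sym2 (Fin N))) (l : Fin (numEdges α)) : Fin N :=
  (ofLex ((edgeSet α).orderEmbOfFin rfl l)).2

/-- The half-edges other than `s_{ℓ,1} ∧ s_{ℓ,2}` and the half-edges of the later edges of `α`. -/
def choiceSet (α : Finset (Sym2 (Fin N))) (l : Fin (numEdges α)) : Finset (Fin N) :=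
  Finset.univ.filter fun t => t ≠ lo α l ∧ ∀ m, l < m → t ≠ lo α m ∧ t ≠ hi α m

/-- The number of values of the index of the `ℓ`-th step. For a set `α` of `e` disjoint pairs, it is
`N - 2 (e - ℓ) - 1` if the steps are counted from `ℓ = 1`. -/
def numChoices (α : Finset (Sym2 (Fin N))) (l : Fin (numEdges α)) : ℕ := (choiceSet α l).card

/-- The switching of the pairs `{a, b}` and `{t, t'}` of `g`, where `t' = g t`: these two pairs are
replaced by `{a, t}` and `{b, t'}`, that is, the positions of `b` and `t` in the matching are
exchanged. Nothing changes if `t = b`. -/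
def switch (g : Matching N) (b t : Fin N) : Matching N :=
  ⟨fun x => Equiv.swap b t (g.1 (Equiv.swap b t x)), fun s => by
    refine ⟨by simp [(g.2 _).1], fun h => (g.2 (Equiv.swap b t s)).2 ?_⟩
    have := congrArg (Equiv.swap b t) h
    simpa using this⟩

/-- The switching removes `{a, b}` and `{t, g t}` and adds `{a, t}` and `{b, g t}`. -/
theorem pairs_switch (g : Matching N) {a b t : Fin N} (hab : g.1 a = b) (hta : t ≠ a) :
    (switch g b t).pairs = (g.pairs \ {s(a, b), s(t, g.1 t)}) ∪ {s(a, t), s(b, g.1 t)} := by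
  obtain ⟨g, hg⟩ := g
  ext e
  induction e using Sym2.ind with
  | _ x y =>
    simp only [Finset.mem_union, Finset.mem_sdiff, Matching.mem_pairs, Finset.mem_insert,
      Finset.mem_singleton, Sym2.eq_iff, switch, Equiv.swap_apply_def]
    have h1 := fun z => (hg z).1
    have h2 := fun z => (hg z).2
    grind

/-- The map `f_α`: for `ℓ = 1, …, e(H)` in turn, let `t` be the half-edge of rank `b ℓ` (the ranks
start at `0`) among those in `choiceSet α ℓ`, and switch the `ℓ`-th edge of `α` with the pair that
contains `t`. -/
def resample (α : Finset (Sym2 (Fin N))) (g : Matching N)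
    (b : ∀ l : Fin (numEdges α), Fin (numChoices α l)) : Matching N :=
  Fin.foldl (numEdges α)
    (fun g' l => switch g' (hi α l) ((choiceSet α l).orderEmbOfFin rfl (b l))) g

/-- The indicator that `α` is realized in the matching `g`. -/
def ind (g : Matching N) (α : Finset (Sym2 (Fin N))) : ℝ :=
  if α ⊆ g.pairs then 1 else 0

/-- The configuration `𝔤_α`, as a function of `𝔤 = g` and of the indices `B_α = b`. -/
def coupled (α : Finset (Sym2 (Fin N))) (g : Matching N)
    (b : ∀ l : Fin (numEdges α), Fin (numChoices α l)) : Matching N :=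
  if α ⊆ g.pairs then resample α g b else g

end Switching

section RandomVariables

variable {n N : ℕ} (d : Fin n → ℕ) (own : Fin N → Fin n)

/-- The index set of the random indices: pairs of a member `α` of `Γ` and a step `ℓ`. -/
abbrev StepIndex : Type := Σ α : {α // α ∈ Gam d own}, Fin (numEdges α.1)

variable {Ω : Type*} (𝔤 : Ω → Matching N)
  (B : ∀ p : StepIndex d own, Ω → Fin (numChoices p.1.1 p.2))

/-- `I_α`. -/
def I (α : Finset (Sym2 (Fin N))) (ω : Ω) : ℝ := ind (𝔤 ω) α

/-- `J_{βα}`, the indicator that `β` is realized in `𝔤_α`. -/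
def J (β : Finset (Sym2 (Fin N))) (α : {α // α ∈ Gam d own}) (ω : Ω) : ℝ :=
  ind (coupled α.1 (𝔤 ω) fun l => B ⟨α, l⟩ ω) β

/-- `∑_{α ∈ Γ₁ⱼ} I_α ∑_{β ∈ Γ₁ₖ} (I_β - J_{βα})`. -/
def steinSum (j k : Fin 2) (ω : Ω) : ℝ :=
  ∑ α : {α // α ∈ Gam1 d own j}, I 𝔤 α.1 ω *
    ∑ β ∈ Gam1 d own k, (I 𝔤 β ω - J d own 𝔤 B β ⟨α.1, mem_Gam_of_mem_Gam1 d own α.2⟩ ω)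

/-- `W₁ = (W_edge, W_2star)`, the centred numbers of isolated edges and isolated 2-stars, divided
by `√n`. -/
def W1 [MeasurableSpace Ω] (P : Measure Ω) (ω : Ω) : Fin 2 → ℝ := fun j =>
  (∑ α ∈ Gam1 d own j, (I 𝔤 α ω - ∫ ω', I 𝔤 α ω' ∂P)) / √(n : ℝ)

/-- `W₂ = (S_n, M_n)`, the numbers of self-loops and double edges. -/
def W2 (ω : Ω) : Fin 2 → ℝ := fun j => ∑ α ∈ Gam2 own j, I 𝔤 α ω

end RandomVariables

/-- The constant `C₁(c)`. -/
def C1 (c : ℝ) : ℝ :=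
  √(3 * (1 / 2 + 3 / 2 * c ^ 2 + 4 * c ^ 3 + 7 / 2 * c ^ 4 + 2 * c ^ 6)) +
  √(2 * (2 * c ^ 3 + 5 * c ^ 4 + 68 * c ^ 5 + 72 * c ^ 6 + 72 * c ^ 8)) +
  √(2 * (2 * c ^ 3 + 8 * c ^ 4 + 4 * c ^ 5 + 56 * c ^ 6 + 72 * c ^ 8)) +
  √(3 * (c + 24 * c ^ 4 + 64 * c ^ 5 + 328 * c ^ 6 + 256 * c ^ 7 + 872 * c ^ 8 + 2048 * c ^ 10))

end ConfigModel

end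

open MeasureTheory ProbabilityTheory

noncomputable section

namespace ConfigModel

/-! ### Algebra of a single switching -/

section SwitchBasics

variable {N : ℕ} (g : Matching N)

/-! Both versions of (W₁, W₂) are functions of the matching 𝔤, and conditioning on less than 𝔤 only
lowers the variance of a conditional expectation. So it suffices to bound the variance of the
conditional expectation given 𝔤, in which only the indices B, independent of 𝔤, are averaged
(`variance_condExp_le_of_indepFun`).

This conditional expectation is computed exactly. Let A and C be the numbers of half-edges at
vertices of degree one and two, E and S the numbers of isolated edges and isolated 2-stars, and Z
the number of half-stars (degree-two vertices with exactly one leaf neighbour, loops counted with a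
weight). A switching changes only two pairs, so the changes of E and S are explicit in the types of
four half-edges and their twins. Averaging over the choices of the switching gives E(N − 2A + 2E)/(N
− 1), −2EZ/(N − 1), S(4E − 2A + 3)/(N − 1), and a combination of S, S(S − 1) and SZ: these are
`edgeEdge`, `edgeStar`, `starEdge`, `starStar`.

Their variances are bounded by a Poincaré inequality for switchings of a uniform matching
(`poincare_cyl`), proved by induction on the number of free half-edges: condition on one pair, apply
the inequality to the rest, and control the conditional means by `sum_sq_condMean_le`. Since
switching preserves the uniform law, only decrements matter (`mvar_le_down`). A decrement means that
a switching destroys something it touches, so the sum of squared decrements is at most linear in the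
count itself: 4NE, 8NS and 8(N + A)Z. Everything thus reduces to means of products of counts, which
follow from the probability 1/((N − 1)(N − 3)⋯) of prescribed pairs.

With m = n₁ ∨ n₂ one has A ≤ m and C ≤ 2m, and m ≤ b(N − 15) trades surplus powers of m for powers
of b. Each variance becomes a constant or a polynomial in b times m²/(N − 1). That the resulting
square roots add up to at most C₁(b) is a numerical inequality, `variance_constants_le_C1`. -/

theorem switch_apply (i j x : Fin N) :
    (switch g i j).1 x = Equiv.swap i j (g.1 (Equiv.swap i j x)) := rfl

theorem Matching.apply_apply (x : Fin N) : g.1 (g.1 x) = x := (g.2 x).1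

theorem Matching.apply_ne (x : Fin N) : g.1 x ≠ x := (g.2 x).2

theorem Matching.injective : Function.Injective g.1 :=
  Function.LeftInverse.injective (g := g.1) fun x => g.apply_apply x

theorem Matching.apply_eq_iff {x y : Fin N} : g.1 x = y ↔ x = g.1 y := by
  constructor
  · rintro rfl; exact (g.apply_apply x).symm
  · rintro rfl; exact g.apply_apply y

theorem switch_switch (i j : Fin N) : switch (switch g i j) i j = g := by
  apply Subtype.ext
  funext x
  simp [switch_apply]

theorem switch_comm (i j : Fin N) : switch g i j = switch g j i := by
  apply Subtype.ext
  funext x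
  simp [switch_apply, Equiv.swap_comm i j]

theorem switch_self (i : Fin N) : switch g i i = g := by
  apply Subtype.ext
  funext x
  simp [switch_apply]

/-- The new pairs are {i, g j} and {j, g i}. The two excluded values of `j` are exactly those that
leave `g` unchanged. -/
theorem switch_apply_eq {i j : Fin N} (h1 : j ≠ i) (h2 : j ≠ g.1 i) (x : Fin N) :
    (switch g i j).1 x = if x = i then g.1 j else if x = j then g.1 i else
      if x = g.1 i then j else if x = g.1 j then i else g.1 x := by
  have e1 := g.apply_apply
  have e2 := g.apply_ne
  simp only [switch_apply, Equiv.swap_apply_def]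
  grind

theorem switch_partner (i : Fin N) : switch g i (g.1 i) = g := by
  apply Subtype.ext
  funext x
  have e1 := g.apply_apply
  have e2 := g.apply_ne
  simp only [switch_apply, Equiv.swap_apply_def]
  grind

/-- Exchanging either end of the two pairs produces the same new pairs {i, g j} and {j, g i}. Hence
it does not matter which end of a pair of α is the larger one. -/
theorem switch_partner_partner (i j : Fin N) : switch g (g.1 i) (g.1 j) = switch g i j := by
  apply Subtype.ext
  funext x
  have e1 := g.apply_apply
  have e2 := g.apply_ne
  simp only [switch_apply, Equiv.swap_apply_def]
  grind

/-- The switching at two fixed half-edges permutes the matchings. -/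
def switchEquiv (i j : Fin N) : Matching N ≃ Matching N where
  toFun g := switch g i j
  invFun g := switch g i j
  left_inv g := switch_switch g i j
  right_inv g := switch_switch g i j

theorem sum_switch (i j : Fin N) (f : Matching N → ℝ) :
    ∑ g, f (switch g i j) = ∑ g, f g :=
  Equiv.sum_comp (switchEquiv i j) f

end SwitchBasics

/-! ### Counting matchings with prescribed pairs -/

section Cylinder

variable {N : ℕ}

/-- The matchings that agree with `g₀` on `R`. -/
def cyl (R : Finset (Fin N)) (g₀ : Matching N) : Finset (Matching N) :=
  Finset.univ.filter fun g => ∀ x ∈ R, g.1 x = g₀.1 x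

variable {R : Finset (Fin N)} {g₀ : Matching N}

theorem mem_cyl {g : Matching N} : g ∈ cyl R g₀ ↔ ∀ x ∈ R, g.1 x = g₀.1 x := by
  simp [cyl]

theorem self_mem_cyl : g₀ ∈ cyl R g₀ := mem_cyl.2 fun _ _ => rfl

theorem apply_notMem_of_mem_cyl (hR : ∀ x ∈ R, g₀.1 x ∈ R) {g : Matching N} (hg : g ∈ cyl R g₀)
    {x : Fin N} (hx : x ∉ R) : g.1 x ∉ R := fun h => hx <| by
  have := mem_cyl.1 hg _ h
  rw [g.apply_apply] at this
  exact this ▸ hR _ h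

theorem switch_mem_cyl (hR : ∀ x ∈ R, g₀.1 x ∈ R) {g : Matching N} (hg : g ∈ cyl R g₀)
    {i j : Fin N} (hi : i ∉ R) (hj : j ∉ R) : switch g i j ∈ cyl R g₀ := by
  refine mem_cyl.2 fun x hx => ?_
  have h1 := mem_cyl.1 hg x hx
  have h2 := hR x hx
  rw [switch_apply, Equiv.swap_apply_of_ne_of_ne (x := x) (by grind) (by grind), h1,
    Equiv.swap_apply_of_ne_of_ne (by grind) (by grind)]

/-- The matchings of a cylinder in which `x` and `y` are partners. -/
def cylPair (R : Finset (Fin N)) (g₀ : Matching N) (x y : Fin N) : Finset (Matching N) :=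
  (cyl R g₀).filter fun g => g.1 x = y

theorem mem_cylPair {x y : Fin N} {g : Matching N} :
    g ∈ cylPair R g₀ x y ↔ g ∈ cyl R g₀ ∧ g.1 x = y := by simp [cylPair]

theorem cylPair_comm (x y : Fin N) : cylPair R g₀ x y = cylPair R g₀ y x := by
  ext g
  rw [mem_cylPair, mem_cylPair, g.apply_eq_iff, eq_comm]

theorem cylPair_self (x : Fin N) : cylPair R g₀ x x = ∅ := by
  ext g
  simp [mem_cylPair, g.apply_ne]

theorem cylPair_eq_cyl {x y : Fin N} {g₁ : Matching N} (h : g₁ ∈ cylPair R g₀ x y) :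
    cylPair R g₀ x y = cyl (insert x (insert y R)) g₁ := by
  obtain ⟨h1, h2⟩ := mem_cylPair.1 h
  rw [mem_cyl] at h1
  have h3 : g₁.1 y = x := by rw [g₁.apply_eq_iff, h2]
  ext g
  have e := g.apply_apply x
  simp only [mem_cylPair, mem_cyl, Finset.mem_insert]
  grind

theorem insert_pair_closed (hR : ∀ x ∈ R, g₀.1 x ∈ R) {x y : Fin N} {g₁ : Matching N}
    (h : g₁ ∈ cylPair R g₀ x y) :
    ∀ z ∈ insert x (insert y R), g₁.1 z ∈ insert x (insert y R) := by
  obtain ⟨h1, h2⟩ := mem_cylPair.1 h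
  rw [mem_cyl] at h1
  have h3 : g₁.1 y = x := by rw [g₁.apply_eq_iff, h2]
  simp only [Finset.mem_insert]
  grind

/-- Switching at `y` and `y'` is a bijection between the two sets, since it moves the partner of `x`
from one to the other and does not touch `R`. -/
theorem card_cylPair_eq (hR : ∀ x ∈ R, g₀.1 x ∈ R) {x y y' : Fin N}
    (hy : y ∉ R) (hy' : y' ∉ R) (hxy : y ≠ x) (hxy' : y' ≠ x) :
    (cylPair R g₀ x y).card = (cylPair R g₀ x y').card := by
  have key : ∀ z z' : Fin N, z ∉ R → z' ∉ R → z ≠ x → z' ≠ x → ∀ g ∈ cylPair R g₀ x z,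
      switch g z z' ∈ cylPair R g₀ x z' := by
    intro z z' hz hz' hne hne' g hg
    obtain ⟨h1, h2⟩ := mem_cylPair.1 hg
    refine mem_cylPair.2 ⟨switch_mem_cyl hR h1 hz hz', ?_⟩
    rw [switch_apply, Equiv.swap_apply_of_ne_of_ne hne.symm hne'.symm, h2, Equiv.swap_apply_left]
  refine Finset.card_bij' (fun g _ => switch g y y') (fun g _ => switch g y' y)
    (key y y' hy hy' hxy hxy') (key y' y hy' hy hxy' hxy) ?_ ?_
  · intro g _; rw [switch_comm _ y' y, switch_switch]
  · intro g _; rw [switch_comm _ y y', switch_switch]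

/-- All pairs of half-edges outside `R` are equally likely. -/
theorem exists_card_cylPair (hR : ∀ x ∈ R, g₀.1 x ∈ R) : ∃ c : ℕ,
    (Rᶜ.Nonempty → 0 < c) ∧ ∀ x ∉ R, ∀ y ∉ R, y ≠ x → (cylPair R g₀ x y).card = c := by
  by_cases h : Rᶜ.Nonempty
  · obtain ⟨x₀, hx₀⟩ := h
    rw [Finset.mem_compl] at hx₀
    have hy₀ := apply_notMem_of_mem_cyl hR self_mem_cyl hx₀
    have hne := g₀.apply_ne x₀
    refine ⟨(cylPair R g₀ x₀ (g₀.1 x₀)).card, fun _ => Finset.card_pos.2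
      ⟨g₀, mem_cylPair.2 ⟨self_mem_cyl, rfl⟩⟩, fun x hx y hy hxy => ?_⟩
    have main : ∀ z ∉ R, z ≠ x₀ → (cylPair R g₀ x₀ z).card = (cylPair R g₀ x₀ (g₀.1 x₀)).card :=
      fun z hz hz' => card_cylPair_eq hR hz hy₀ hz' hne
    by_cases h1 : x = x₀
    · subst h1; exact main y hy hxy
    · rw [← main x hx h1, cylPair_comm x₀ x]
      exact card_cylPair_eq hR hy hx₀ hxy (Ne.symm h1)
  · refine ⟨0, fun h' => (h h').elim, fun x hx => (h ⟨x, Finset.mem_compl.2 hx⟩).elim⟩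

theorem sum_cyl_fiberwise (hR : ∀ x ∈ R, g₀.1 x ∈ R) {x : Fin N} (hx : x ∉ R)
    (φ : Fin N → Matching N → ℝ) :
    ∑ y ∈ Rᶜ, ∑ g ∈ cylPair R g₀ x y, φ y g = ∑ g ∈ cyl R g₀, φ (g.1 x) g := by
  rw [← Finset.sum_fiberwise_of_maps_to (t := Rᶜ) (g := fun g : Matching N => g.1 x)
    (fun g hg => Finset.mem_compl.2 (apply_notMem_of_mem_cyl hR hg hx))]
  refine Finset.sum_congr rfl fun y _ => Finset.sum_congr rfl fun g hg => ?_
  rw [(mem_cylPair.1 hg).2]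

theorem card_compl_insert_pair {x y : Fin N} (hx : x ∉ R) (hy : y ∉ R) (hxy : y ≠ x) :
    (insert x (insert y R)).card = R.card + 2 := by
  rw [Finset.card_insert_of_notMem (by simp [hx, hxy.symm]), Finset.card_insert_of_notMem hy]

theorem card_cyl_eq (hR : ∀ x ∈ R, g₀.1 x ∈ R) {k : ℕ} (hk : R.card + (k + 1) = N) {c : ℕ}
    (hc : ∀ x ∉ R, ∀ y ∉ R, y ≠ x → (cylPair R g₀ x y).card = c) :
    (cyl R g₀).card = k * c := by
  have hcard : Rᶜ.card = k + 1 := by rw [Finset.card_compl, Fintype.card_fin]; omega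
  obtain ⟨x, hx⟩ : Rᶜ.Nonempty := Finset.card_pos.1 (by omega)
  have hx' := Finset.mem_compl.1 hx
  have h := sum_cyl_fiberwise hR hx' (fun _ _ => 1)
  simp only [Finset.sum_const, nsmul_eq_mul, mul_one] at h
  have h2 : ∑ y ∈ Rᶜ, (cylPair R g₀ x y).card = k * c := by
    rw [← Finset.add_sum_erase _ _ hx, cylPair_self, Finset.card_empty, zero_add,
      Finset.sum_congr rfl (g := fun _ => c), Finset.sum_const, Finset.card_erase_of_mem hx, hcard]
    · simp
    · intro y hy
      exact hc x hx' y (Finset.mem_compl.1 (Finset.mem_of_mem_erase hy)) (Finset.ne_of_mem_erase hy)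
  rw [← h2]
  exact_mod_cast h.symm

/-- `g₀` is a fixed-point-free involution of the complement of `R`. In the induction for the
Poincaré inequality this rules out one or three free half-edges. -/
theorem even_of_card_add (hR : ∀ x ∈ R, g₀.1 x ∈ R) {k : ℕ} (hk : R.card + k = N) : Even k := by
  have hcard : Rᶜ.card = k := by rw [Finset.card_compl, Fintype.card_fin]; omega
  have h : ∑ _x ∈ Rᶜ, (1 : ZMod 2) = 0 := by
    refine Finset.sum_involution (fun x _ => g₀.1 x) (fun _ _ => by decide)
      (fun x _ _ => g₀.apply_ne x) (fun x hx => ?_) (fun x _ => g₀.apply_apply x)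
    exact Finset.mem_compl.2 (apply_notMem_of_mem_cyl hR self_mem_cyl (Finset.mem_compl.1 hx))
  rw [Finset.sum_const, hcard, nsmul_eq_mul, mul_one] at h
  exact (ZMod.natCast_eq_zero_iff_even).1 h

end Cylinder

/-! ### The Poincaré inequality for switchings -/

section Poincare

variable {N : ℕ} {R : Finset (Fin N)} {g₀ : Matching N}

/-- The Dirichlet form of the switchings at half-edges outside `R`. -/
def dirichlet (R : Finset (Fin N)) (g₀ : Matching N) (f : Matching N → ℝ) : ℝ :=
  ∑ i ∈ Rᶜ, ∑ j ∈ Rᶜ, ∑ g ∈ cyl R g₀, (f (switch g i j) - f g) ^ 2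

theorem dirichlet_nonneg (f : Matching N → ℝ) : 0 ≤ dirichlet R g₀ f :=
  Finset.sum_nonneg fun _ _ => Finset.sum_nonneg fun _ _ => Finset.sum_nonneg fun _ _ => sq_nonneg _

theorem switch_injOn (g : Matching N) (i : Fin N) :
    Set.InjOn (switch g i) {j | j ≠ i ∧ j ≠ g.1 i} := by
  intro j hj j' hj' h
  have h1 : (switch g i j).1 (g.1 i) = j := by
    rw [switch_apply_eq g hj.1 hj.2, if_neg (g.apply_ne i), if_neg hj.2.symm, if_pos rfl]
  have h2 : (switch g i j').1 (g.1 i) = j' := by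
    rw [switch_apply_eq g hj'.1 hj'.2, if_neg (g.apply_ne i), if_neg hj'.2.symm, if_pos rfl]
  rw [← h1, h, h2]

theorem switch_ne {g : Matching N} {i j : Fin N} (h1 : j ≠ i) (h2 : j ≠ g.1 i) :
    switch g i j ≠ g := by
  intro h
  have h3 : (switch g i j).1 (g.1 i) = j := by
    rw [switch_apply_eq g h1 h2, if_neg (g.apply_ne i), if_neg h2.symm, if_pos rfl]
  rw [h, g.apply_apply] at h3
  exact h1 h3.symm

/-- A separate base case, because the induction step divides by k − 4. There are three matchings,
and for each fixed `i` the two nontrivial switchings at `i` lead to the two others. For centred `f`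
the squared differences over ordered pairs sum to 6 ∑ f², and there are four values of `i`. -/
theorem poincare_four (hR : ∀ x ∈ R, g₀.1 x ∈ R) (hk : R.card + 4 = N)
    (hcard : (cyl R g₀).card = 3) (f : Matching N → ℝ) (hf : ∑ g ∈ cyl R g₀, f g = 0) :
    24 * ∑ g ∈ cyl R g₀, f g ^ 2 ≤ dirichlet R g₀ f := by
  classical
  have hcR : Rᶜ.card = 4 := by rw [Finset.card_compl, Fintype.card_fin]; omega
  have key : ∀ i ∈ Rᶜ, ∀ g ∈ cyl R g₀,
      ∑ g' ∈ cyl R g₀, (f g' - f g) ^ 2 ≤ ∑ j ∈ Rᶜ, (f (switch g i j) - f g) ^ 2 := by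
    intro i hi g hg
    have hi' := Finset.mem_compl.1 hi
    set T := (Rᶜ.erase i).erase (g.1 i) with hT
    have hTmem : ∀ j ∈ T, j ≠ i ∧ j ≠ g.1 i ∧ j ∉ R := by
      intro j hj
      simp only [hT, Finset.mem_erase, Finset.mem_compl] at hj
      tauto
    have hTc : T.card = 2 := by
      rw [hT, Finset.card_erase_of_mem, Finset.card_erase_of_mem hi, hcR]
      exact Finset.mem_erase.2 ⟨g.apply_ne i,
        Finset.mem_compl.2 (apply_notMem_of_mem_cyl hR hg hi')⟩
    have hinj : Set.InjOn (switch g i) T := (switch_injOn g i).mono fun j hj => by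
      have h := hTmem j (Finset.mem_coe.1 hj)
      exact ⟨h.1, h.2.1⟩
    have himg : T.image (switch g i) = (cyl R g₀).erase g := by
      refine Finset.eq_of_subset_of_card_le ?_ ?_
      · intro g' hg'
        obtain ⟨j, hj, rfl⟩ := Finset.mem_image.1 hg'
        obtain ⟨h1, h2, h3⟩ := hTmem j hj
        exact Finset.mem_erase.2 ⟨switch_ne h1 h2, switch_mem_cyl hR hg hi' h3⟩
      · rw [Finset.card_erase_of_mem hg, hcard, Finset.card_image_of_injOn hinj, hTc]
    rw [← Finset.add_sum_erase _ _ hg, sub_self, ← himg, Finset.sum_image hinj]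
    simp only [ne_eq, OfNat.ofNat_ne_zero, not_false_eq_true, zero_pow, zero_add]
    exact Finset.sum_le_sum_of_subset_of_nonneg
      ((Finset.erase_subset _ _).trans (Finset.erase_subset _ _)) fun _ _ _ => sq_nonneg _
  have h1 : ∑ g ∈ cyl R g₀, ∑ g' ∈ cyl R g₀, (f g' - f g) ^ 2 = 6 * ∑ g ∈ cyl R g₀, f g ^ 2 := by
    have : ∀ g ∈ cyl R g₀, ∑ g' ∈ cyl R g₀, (f g' - f g) ^ 2
        = ∑ g' ∈ cyl R g₀, f g' ^ 2 + 3 * f g ^ 2 := by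
      intro g _
      have e : ∀ g', (f g' - f g) ^ 2 = f g' ^ 2 - 2 * f g * f g' + f g ^ 2 := fun g' => by ring
      simp only [e, Finset.sum_add_distrib, Finset.sum_sub_distrib, ← Finset.mul_sum, hf,
        Finset.sum_const, hcard, nsmul_eq_mul]
      norm_num
    rw [Finset.sum_congr rfl this, Finset.sum_add_distrib, ← Finset.mul_sum, Finset.sum_const,
      hcard, nsmul_eq_mul]
    push_cast; ring
  calc 24 * ∑ g ∈ cyl R g₀, f g ^ 2
      = ∑ i ∈ Rᶜ, ∑ g ∈ cyl R g₀, ∑ g' ∈ cyl R g₀, (f g' - f g) ^ 2 := by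
        rw [h1, Finset.sum_const, hcR, nsmul_eq_mul]; push_cast; ring
    _ ≤ ∑ i ∈ Rᶜ, ∑ g ∈ cyl R g₀, ∑ j ∈ Rᶜ, (f (switch g i j) - f g) ^ 2 :=
        Finset.sum_le_sum fun i hi => Finset.sum_le_sum fun g hg => key i hi g hg
    _ = dirichlet R g₀ f := Finset.sum_congr rfl fun i _ => Finset.sum_comm

/-- The conditional means of `f` given one pair of the matching are controlled by the second moment
of `f`. -/
theorem sum_sq_condMean_le (hR : ∀ x ∈ R, g₀.1 x ∈ R) {k : ℕ} (hk : R.card + k = N) (hk4 : 4 ≤ k)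
    {c : ℕ} (hc0 : 0 < c) (hc : ∀ x ∉ R, ∀ y ∉ R, y ≠ x → (cylPair R g₀ x y).card = c)
    (f : Matching N → ℝ) (hf : ∑ g ∈ cyl R g₀, f g = 0) (v : Fin N → Fin N → ℝ)
    (hv : ∀ x y, ∑ g ∈ cylPair R g₀ x y, f g = c * v x y) :
    ((k : ℝ) - 3) * (c * ∑ x ∈ Rᶜ, ∑ y ∈ Rᶜ, v x y ^ 2) ≤
      2 * ((k : ℝ) - 2) * ∑ g ∈ cyl R g₀, f g ^ 2 := by
  have hc0' : (0 : ℝ) < c := Nat.cast_pos.2 hc0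
  have hk4' : (4 : ℝ) ≤ k := by exact_mod_cast hk4
  have hvs : ∀ x y, v x y = v y x := fun x y => by
    have h := hv x y
    rw [cylPair_comm, hv y x] at h
    exact (mul_left_cancel₀ hc0'.ne' h).symm
  have hv0 : ∀ x, v x x = 0 := fun x => by
    have h := hv x x
    rw [cylPair_self, Finset.sum_empty] at h
    exact (mul_eq_zero.1 h.symm).resolve_left hc0'.ne'
  have hrow : ∀ x ∉ R, ∑ y ∈ Rᶜ, v x y = 0 := fun x hx => by
    have h := sum_cyl_fiberwise hR hx (fun _ g => f g)
    rw [hf, Finset.sum_congr rfl fun y _ => hv x y, ← Finset.mul_sum] at h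
    exact (mul_eq_zero.1 h).resolve_left hc0'.ne'
  -- `F` adds up the conditional means of `f` along the pairs of the matching. Its inner product
  -- with `f` is `Q`, and conditioning `F` on a pair returns a multiple of `v`, so its norm is also
  -- a multiple of `Q`; Cauchy–Schwarz then bounds `Q`.
  set F : Matching N → ℝ := fun g => ∑ x ∈ Rᶜ, v x (g.1 x) with hF
  set Q : ℝ := c * ∑ x ∈ Rᶜ, ∑ y ∈ Rᶜ, v x y ^ 2 with hQ
  have hfib : ∀ φ : Matching N → ℝ, ∑ g ∈ cyl R g₀, φ g * F g =
      ∑ x ∈ Rᶜ, ∑ y ∈ Rᶜ, v x y * ∑ g ∈ cylPair R g₀ x y, φ g := by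
    intro φ
    simp only [hF, Finset.mul_sum]
    rw [Finset.sum_comm]
    refine Finset.sum_congr rfl fun x hx => ?_
    rw [← sum_cyl_fiberwise hR (Finset.mem_compl.1 hx) (fun y g => φ g * v x y)]
    exact Finset.sum_congr rfl fun y _ => Finset.sum_congr rfl fun g _ => mul_comm _ _
  have hfF : ∑ g ∈ cyl R g₀, f g * F g = Q := by
    rw [hfib, hQ]
    simp only [hv, Finset.mul_sum]
    exact Finset.sum_congr rfl fun x _ => Finset.sum_congr rfl fun y _ => by ring
  have hcond : ∀ x ∉ R, ∀ y ∉ R, y ≠ x →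
      ((k : ℝ) - 3) * ∑ g ∈ cylPair R g₀ x y, F g = c * (2 * ((k : ℝ) - 2) * v x y) := by
    intro x hx y hy hxy
    obtain ⟨g₁, hg₁⟩ : (cylPair R g₀ x y).Nonempty := Finset.card_pos.1 (by rw [hc x hx y hy hxy]; exact hc0)
    have hR' := insert_pair_closed hR hg₁
    have heq := cylPair_eq_cyl hg₁
    set R' := insert x (insert y R) with hR'def
    have hcR' := card_compl_insert_pair hx hy hxy
    obtain ⟨c', -, hc'⟩ := exists_card_cylPair hR'
    have hcc : (c : ℝ) = (k - 3) * c' := by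
      have h := card_cyl_eq hR' (k := k - 3) (by rw [← hR'def] at hcR'; omega) hc'
      rw [← heq, hc x hx y hy hxy] at h
      rw [h, Nat.cast_mul, Nat.cast_sub (by omega)]
      norm_num
    have hterm : ∀ z ∈ R'ᶜ, ∑ g ∈ cylPair R g₀ x y, v z (g.1 z) = c' * (- v z x - v z y) := by
      intro z hz
      have hz' := Finset.mem_compl.1 hz
      rw [heq, ← sum_cyl_fiberwise hR' hz' (fun w _ => v z w)]
      have : ∀ w ∈ R'ᶜ, ∑ _g ∈ cylPair R' g₁ z w, v z w = c' * v z w := by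
        intro w hw
        rw [Finset.sum_const, nsmul_eq_mul]
        by_cases hwz : w = z
        · subst hwz; simp [hv0]
        · rw [hc' z hz' w (Finset.mem_compl.1 hw) hwz]
      rw [Finset.sum_congr rfl this, ← Finset.mul_sum]
      congr 1
      have hzR : z ∉ R := fun h => hz' (by simp [hR'def, h])
      have h0 := hrow z hzR
      have hxm : x ∈ Rᶜ := Finset.mem_compl.2 hx
      have hym : y ∈ Rᶜ.erase x := Finset.mem_erase.2 ⟨hxy, Finset.mem_compl.2 hy⟩
      rw [← Finset.add_sum_erase _ _ hxm, ← Finset.add_sum_erase _ _ hym] at h0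
      have : (Rᶜ.erase x).erase y = R'ᶜ := by
        ext w; simp [hR'def]; tauto
      rw [this] at h0
      linarith
    have hxm : x ∈ Rᶜ := Finset.mem_compl.2 hx
    have hym : y ∈ Rᶜ.erase x := Finset.mem_erase.2 ⟨hxy, Finset.mem_compl.2 hy⟩
    have hset : (Rᶜ.erase x).erase y = R'ᶜ := by
      ext w; simp [hR'def]; tauto
    have hsx : ∑ g ∈ cylPair R g₀ x y, v x (g.1 x) = c * v x y := by
      rw [Finset.sum_congr rfl fun g hg => by rw [(mem_cylPair.1 hg).2], Finset.sum_const,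
        hc x hx y hy hxy, nsmul_eq_mul]
    have hsy : ∑ g ∈ cylPair R g₀ x y, v y (g.1 y) = c * v x y := by
      rw [cylPair_comm, Finset.sum_congr rfl fun g hg => by rw [(mem_cylPair.1 hg).2],
        Finset.sum_const, hc y hy x hx hxy.symm, nsmul_eq_mul, hvs]
    have hcol : ∀ u ∈ [x, y], ∑ z ∈ R'ᶜ, v z u = - v x y := by
      intro u hu
      have hu' : u ∉ R := by
        simp only [List.mem_cons, List.not_mem_nil, or_false] at hu
        rcases hu with rfl | rfl <;> assumption
      have h0 := hrow u hu'
      rw [← Finset.add_sum_erase _ _ hxm, ← Finset.add_sum_erase _ _ hym, hset] at h0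
      rw [Finset.sum_congr rfl fun z _ => hvs z u]
      simp only [List.mem_cons, List.not_mem_nil, or_false] at hu
      rcases hu with rfl | rfl
      · rw [hv0] at h0; linarith
      · rw [hv0, hvs] at h0; linarith
    -- The half-edges `x` and `y` contribute c·v(x, y) each. Every other `z` sees a uniform partner
    -- outside {x, y}, and the zero row sums of `v` leave −v(z, x) − v(z, y); summing over `z` gives
    -- 2·v(x, y), with weight c' = c/(k − 3).
    have hsum : ∑ g ∈ cylPair R g₀ x y, F g = c * v x y + (c * v x y + c' * (2 * v x y)) := by
      simp only [hF]
      rw [Finset.sum_comm, ← Finset.add_sum_erase _ _ hxm, ← Finset.add_sum_erase _ _ hym, hset,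
        hsx, hsy, Finset.sum_congr rfl hterm, ← Finset.mul_sum, Finset.sum_sub_distrib,
        Finset.sum_neg_distrib, hcol x (by simp), hcol y (by simp)]
      ring
    rw [hsum, hcc]
    ring
  have hFF : ((k : ℝ) - 3) * ∑ g ∈ cyl R g₀, F g * F g = 2 * ((k : ℝ) - 2) * Q := by
    rw [hfib, hQ]
    simp only [Finset.mul_sum]
    refine Finset.sum_congr rfl fun x hx => Finset.sum_congr rfl fun y hy => ?_
    by_cases hxy : y = x
    · subst hxy; simp [hv0]
    · have := hcond x (Finset.mem_compl.1 hx) y (Finset.mem_compl.1 hy) hxy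
      rw [Finset.mul_sum] at this
      have h2 : ∀ t : ℝ, (k - 3 : ℝ) * ∑ i ∈ cylPair R g₀ x y, t * F i
          = t * ∑ i ∈ cylPair R g₀ x y, (k - 3 : ℝ) * F i := by
        intro t
        simp only [Finset.mul_sum]
        exact Finset.sum_congr rfl fun i _ => by ring
      rw [← Finset.mul_sum, h2, this]
      ring
  have hnn : ∀ μ : ℝ, 0 ≤ ∑ g ∈ cyl R g₀, f g ^ 2 - 2 * μ * Q + μ ^ 2 *
      ∑ g ∈ cyl R g₀, F g * F g := by
    intro μ
    have h : 0 ≤ ∑ g ∈ cyl R g₀, (f g - μ * F g) ^ 2 := Finset.sum_nonneg fun _ _ => sq_nonneg _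
    have e : ∀ g, (f g - μ * F g) ^ 2 = f g ^ 2 - 2 * μ * (f g * F g) + μ ^ 2 * (F g * F g) :=
      fun g => by ring
    simp only [e, Finset.sum_add_distrib, Finset.sum_sub_distrib, ← Finset.mul_sum, hfF] at h
    exact h
  have h3 : (0 : ℝ) < k - 3 := by linarith
  have h2 : (0 : ℝ) < k - 2 := by linarith
  -- The minimizing value of μ, namely Q divided by the squared norm of `F`.
  have h := hnn ((k - 3) / (2 * (k - 2)))
  have e1 : ∑ g ∈ cyl R g₀, F g * F g = 2 * ((k : ℝ) - 2) * Q / (k - 3) := by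
    rw [← hFF]; field_simp
  rw [e1] at h
  have e2 : ((k : ℝ) - 3) / (2 * (k - 2)) * (2 * (k - 2)) = k - 3 := by field_simp
  have e3 : (((k : ℝ) - 3) / (2 * (k - 2))) ^ 2 * (2 * (k - 2) * Q / (k - 3))
      = (k - 3) / (2 * (k - 2)) * Q := by field_simp
  rw [e3] at h
  have h5 : ((k : ℝ) - 3) / (2 * (k - 2)) * Q ≤ ∑ g ∈ cyl R g₀, f g ^ 2 := by linarith
  rw [div_mul_eq_mul_div, div_le_iff₀ (by positivity)] at h5
  linarith

/-- A switching that changes the matching involves four distinct half-edges, so it survives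
conditioning on the pair of `x` exactly when `x` is one of the other k − 4. A switching that changes
nothing contributes zero. -/
theorem sum_dirichlet_cylPair (hR : ∀ x ∈ R, g₀.1 x ∈ R) {k : ℕ} (hk : R.card + k = N)
    (hk4 : 4 ≤ k) (f : Matching N → ℝ) :
    ∑ x ∈ Rᶜ, ∑ y ∈ Rᶜ, ∑ g ∈ cylPair R g₀ x y, ∑ i ∈ (insert x (insert y R))ᶜ,
      ∑ j ∈ (insert x (insert y R))ᶜ, (f (switch g i j) - f g) ^ 2 ≤
      ((k : ℝ) - 4) * dirichlet R g₀ f := by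
  have hcR : Rᶜ.card = k := by rw [Finset.card_compl, Fintype.card_fin]; omega
  have hk4' : (4 : ℝ) ≤ k := by exact_mod_cast hk4
  set D : Matching N → Fin N → Fin N → ℝ := fun g i j => (f (switch g i j) - f g) ^ 2 with hD
  have step : ∀ x ∈ Rᶜ, ∑ y ∈ Rᶜ, ∑ g ∈ cylPair R g₀ x y, ∑ i ∈ (insert x (insert y R))ᶜ,
      ∑ j ∈ (insert x (insert y R))ᶜ, D g i j = ∑ g ∈ cyl R g₀, ∑ i ∈ Rᶜ, ∑ j ∈ Rᶜ,
        if x ∉ ({i, g.1 i, j, g.1 j} : Finset (Fin N)) then D g i j else 0 := by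
    intro x hx
    rw [sum_cyl_fiberwise hR (Finset.mem_compl.1 hx) fun y g => ∑ i ∈ (insert x (insert y R))ᶜ,
      ∑ j ∈ (insert x (insert y R))ᶜ, D g i j]
    refine Finset.sum_congr rfl fun g _ => ?_
    have hset : (insert x (insert (g.1 x) R))ᶜ = Rᶜ.filter fun i => x ≠ i ∧ x ≠ g.1 i := by
      ext i
      have := g.apply_eq_iff (x := x) (y := i)
      simp only [Finset.mem_compl, Finset.mem_insert, Finset.mem_filter]
      grind
    rw [hset, Finset.sum_filter]
    refine Finset.sum_congr rfl fun i _ => ?_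
    rw [Finset.sum_filter]
    split_ifs with h
    · refine Finset.sum_congr rfl fun j _ => ?_
      refine if_congr ?_ rfl rfl
      simp only [Finset.mem_insert, Finset.mem_singleton]
      tauto
    · refine (Finset.sum_eq_zero fun j _ => if_neg ?_).symm
      simp only [Finset.mem_insert, Finset.mem_singleton]
      tauto
  rw [Finset.sum_congr rfl step, Finset.sum_comm]
  have inner : ∀ g ∈ cyl R g₀, ∑ x ∈ Rᶜ, ∑ i ∈ Rᶜ, ∑ j ∈ Rᶜ,
      (if x ∉ ({i, g.1 i, j, g.1 j} : Finset (Fin N)) then D g i j else 0) ≤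
      ∑ i ∈ Rᶜ, ∑ j ∈ Rᶜ, ((k : ℝ) - 4) * D g i j := by
    intro g hg
    rw [Finset.sum_comm]
    refine Finset.sum_le_sum fun i hi => ?_
    rw [Finset.sum_comm]
    refine Finset.sum_le_sum fun j hj => ?_
    by_cases hij : j ≠ i ∧ j ≠ g.1 i
    · rw [← Finset.sum_filter, Finset.sum_const, nsmul_eq_mul]
      refine le_of_eq ?_
      congr 1
      have hT : ({i, g.1 i, j, g.1 j} : Finset (Fin N)) ⊆ Rᶜ := by
        have h1 := apply_notMem_of_mem_cyl hR hg (Finset.mem_compl.1 hi)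
        have h2 := apply_notMem_of_mem_cyl hR hg (Finset.mem_compl.1 hj)
        simp only [Finset.mem_compl] at hi hj
        intro z
        simp only [Finset.mem_insert, Finset.mem_singleton, Finset.mem_compl]
        grind
      have hTc : ({i, g.1 i, j, g.1 j} : Finset (Fin N)).card = 4 := by
        have e1 := g.apply_apply
        have e2 := g.apply_ne
        rw [Finset.card_insert_of_notMem, Finset.card_insert_of_notMem,
          Finset.card_insert_of_notMem, Finset.card_singleton]
        all_goals simp only [Finset.mem_insert, Finset.mem_singleton]; grind
      rw [Finset.filter_notMem_eq_sdiff, Finset.card_sdiff_of_subset hT, hcR, hTc,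
        Nat.cast_sub hk4]
      norm_num
    · have h0 : D g i j = 0 := by
        simp only [hD]
        by_cases h1 : j = i
        · subst h1; rw [switch_self, sub_self]; norm_num
        · have h2 : j = g.1 i := by tauto
          subst h2; rw [switch_partner, sub_self]; norm_num
      simp [h0]
  refine (Finset.sum_le_sum inner).trans (le_of_eq ?_)
  rw [dirichlet]
  simp only [Finset.mul_sum]
  rw [Finset.sum_comm]
  refine Finset.sum_congr rfl fun i _ => ?_
  rw [Finset.sum_comm]

/-- The Poincaré inequality for random switchings of a uniform matching, with the sharp constant,
on the matchings that contain given pairs. -/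
theorem poincare_cyl (k : ℕ) : ∀ (R : Finset (Fin N)) (g₀ : Matching N), (∀ x ∈ R, g₀.1 x ∈ R) →
    R.card + k = N → ∀ f : Matching N → ℝ, ∑ g ∈ cyl R g₀, f g = 0 →
    8 * ((k : ℝ) - 1) * ∑ g ∈ cyl R g₀, f g ^ 2 ≤ dirichlet R g₀ f := by
  induction k using Nat.strong_induction_on with
  | _ k ih =>
  intro R g₀ hR hk f hf
  have heven := even_of_card_add hR hk
  have hone : ∀ (R : Finset (Fin N)) (g₀ : Matching N), R.card = N → (cyl R g₀).card = 1 := by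
    intro R g₀ h
    have hu : R = Finset.univ := by
      rw [← Finset.card_eq_iff_eq_univ, Fintype.card_fin, h]
    refine Finset.card_eq_one.2 ⟨g₀, ?_⟩
    ext g
    rw [mem_cyl, Finset.mem_singleton, hu]
    simp only [Finset.mem_univ, true_implies]
    rw [Subtype.ext_iff, funext_iff]
  have htriv : (cyl R g₀).card = 1 →
      8 * ((k : ℝ) - 1) * ∑ g ∈ cyl R g₀, f g ^ 2 ≤ dirichlet R g₀ f := by
    intro h
    obtain ⟨g, hg⟩ := Finset.card_eq_one.1 h
    rw [hg, Finset.sum_singleton] at hf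
    rw [hg, Finset.sum_singleton, hf]
    simpa using dirichlet_nonneg f
  have htwo : ∀ (R : Finset (Fin N)) (g₀ : Matching N), (∀ x ∈ R, g₀.1 x ∈ R) → R.card + 2 = N →
      (cyl R g₀).card = 1 := by
    intro R g₀ hR hk
    obtain ⟨c, hc0, hc⟩ := exists_card_cylPair hR
    rw [card_cyl_eq hR (k := 1) hk hc, one_mul]
    obtain ⟨x, hx⟩ : Rᶜ.Nonempty :=
      Finset.card_pos.1 (by rw [Finset.card_compl, Fintype.card_fin]; omega)
    have hx' := Finset.mem_compl.1 hx
    have hy := apply_notMem_of_mem_cyl hR self_mem_cyl hx'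
    have hm : g₀ ∈ cylPair R g₀ x (g₀.1 x) := mem_cylPair.2 ⟨self_mem_cyl, rfl⟩
    rw [← hc x hx' _ hy (g₀.apply_ne x), cylPair_eq_cyl hm]
    exact hone _ _ (by rw [card_compl_insert_pair hx' hy (g₀.apply_ne x)]; exact hk)
  -- With zero or two free half-edges there is only one matching, so a centred function vanishes.
  rcases Nat.lt_or_ge k 4 with hk4 | hk4
  · have : k = 0 ∨ k = 2 := by
      obtain ⟨r, hr⟩ := heven
      omega
    rcases this with rfl | rfl
    · exact htriv (hone R g₀ (by omega))
    · exact htriv (htwo R g₀ hR hk)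
  have hne : Rᶜ.Nonempty :=
    Finset.card_pos.1 (by rw [Finset.card_compl, Fintype.card_fin]; omega)
  obtain ⟨c, hc0, hc⟩ := exists_card_cylPair hR
  have hc0 := hc0 hne
  rcases hk4.eq_or_lt with rfl | hk4
  · have h3 : (cyl R g₀).card = 3 := by
      rw [card_cyl_eq hR (k := 3) hk hc]
      obtain ⟨x, hx⟩ := hne
      have hx' := Finset.mem_compl.1 hx
      have hy := apply_notMem_of_mem_cyl hR self_mem_cyl hx'
      have hm : g₀ ∈ cylPair R g₀ x (g₀.1 x) := mem_cylPair.2 ⟨self_mem_cyl, rfl⟩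
      rw [← hc x hx' _ hy (g₀.apply_ne x), cylPair_eq_cyl hm, htwo _ _ (insert_pair_closed hR hm)
        (by rw [card_compl_insert_pair hx' hy (g₀.apply_ne x)]; omega)]
    have := poincare_four hR hk h3 f hf
    norm_num at this ⊢
    exact this
  have hc0' : (0 : ℝ) < c := Nat.cast_pos.2 hc0
  have hk4' : (4 : ℝ) < k := by exact_mod_cast hk4
  set v : Fin N → Fin N → ℝ := fun x y => (∑ g ∈ cylPair R g₀ x y, f g) / c with hvdef
  have hv : ∀ x y, ∑ g ∈ cylPair R g₀ x y, f g = c * v x y := fun x y => by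
    simp only [hvdef]; field_simp
  have hQ := sum_sq_condMean_le hR hk hk4.le hc0 hc f hf v hv
  set Q : ℝ := c * ∑ x ∈ Rᶜ, ∑ y ∈ Rᶜ, v x y ^ 2 with hQdef
  set A : ℝ := ∑ g ∈ cyl R g₀, f g ^ 2 with hA
  have hcR : (Rᶜ.card : ℝ) = k := by
    rw [Finset.card_compl, Fintype.card_fin]; congr 1; omega
  -- Given the pair {x, y} there remain k − 2 free half-edges, and the induction hypothesis applies
  -- to `f` minus its conditional mean.
  have hstep : ∀ x ∈ Rᶜ, ∀ y ∈ Rᶜ,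
      8 * ((k : ℝ) - 3) * (∑ g ∈ cylPair R g₀ x y, f g ^ 2 - c * v x y ^ 2) ≤
      ∑ g ∈ cylPair R g₀ x y, ∑ i ∈ (insert x (insert y R))ᶜ,
        ∑ j ∈ (insert x (insert y R))ᶜ, (f (switch g i j) - f g) ^ 2 := by
    intro x hx y hy
    have hx' := Finset.mem_compl.1 hx
    have hy' := Finset.mem_compl.1 hy
    by_cases hxy : y = x
    · subst hxy
      have : v y y = 0 := by simp only [hvdef, cylPair_self, Finset.sum_empty, zero_div]
      rw [this, cylPair_self]
      simp
    have hcard := hc x hx' y hy' hxy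
    obtain ⟨g₁, hg₁⟩ : (cylPair R g₀ x y).Nonempty := Finset.card_pos.1 (by rw [hcard]; exact hc0)
    have h := ih (k - 2) (by omega) (insert x (insert y R)) g₁ (insert_pair_closed hR hg₁)
      (by rw [card_compl_insert_pair hx' hy' hxy]; omega) (fun g => f g - v x y) ?_
    · rw [← cylPair_eq_cyl hg₁, Nat.cast_sub (by omega)] at h
      have e : ∀ g, (f g - v x y) ^ 2 = f g ^ 2 - 2 * v x y * f g + v x y ^ 2 := fun g => by ring
      simp only [e, Finset.sum_add_distrib, Finset.sum_sub_distrib, ← Finset.mul_sum, hv,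
        Finset.sum_const, hcard, nsmul_eq_mul] at h
      have e2 : dirichlet (insert x (insert y R)) g₁ (fun g => f g - v x y) =
          ∑ g ∈ cylPair R g₀ x y, ∑ i ∈ (insert x (insert y R))ᶜ,
            ∑ j ∈ (insert x (insert y R))ᶜ, (f (switch g i j) - f g) ^ 2 := by
        rw [dirichlet, ← cylPair_eq_cyl hg₁]
        simp only [sub_sub_sub_cancel_right]
        rw [Finset.sum_congr rfl fun i _ => Finset.sum_comm, Finset.sum_comm]
      rw [e2] at h
      refine le_trans (le_of_eq ?_) h
      push_cast
      ring
    · rw [← cylPair_eq_cyl hg₁, Finset.sum_sub_distrib, hv, Finset.sum_const, hcard, nsmul_eq_mul,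
        sub_self]
  have hsum := (Finset.sum_le_sum fun x hx => Finset.sum_le_sum (hstep x hx)).trans
    (sum_dirichlet_cylPair hR hk hk4.le f)
  have hfibA : ∑ x ∈ Rᶜ, ∑ y ∈ Rᶜ, ∑ g ∈ cylPair R g₀ x y, f g ^ 2 = k * A := by
    rw [Finset.sum_congr rfl fun x hx =>
      sum_cyl_fiberwise hR (Finset.mem_compl.1 hx) (fun _ g => f g ^ 2), Finset.sum_const,
      nsmul_eq_mul, hcR]
  simp only [← Finset.mul_sum, Finset.sum_sub_distrib] at hsum
  rw [hfibA, ← hQdef] at hsum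
  have h4 : (0 : ℝ) < k - 4 := by linarith
  -- The identity behind the constant: k(k − 3) − 2(k − 2) = (k − 1)(k − 4).
  refine le_of_mul_le_mul_left ?_ h4
  refine le_trans ?_ hsum
  nlinarith

/-- The mean of a function of a uniformly distributed matching. -/
def avg (f : Matching N → ℝ) : ℝ := (∑ g, f g) / Fintype.card (Matching N)

/-- The variance of a function of a uniformly distributed matching. -/
def mvar (f : Matching N → ℝ) : ℝ := avg fun g => (f g - avg f) ^ 2

/-- The Poincaré inequality for random switchings of a uniform matching. -/
theorem poincare (hN : 1 < N) (f : Matching N → ℝ) :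
    mvar f ≤ avg (fun g => ∑ i, ∑ j, (f (switch g i j) - f g) ^ 2) / (8 * ((N : ℝ) - 1)) := by
  have hN' : (1 : ℝ) < N := by exact_mod_cast hN
  rcases isEmpty_or_nonempty (Matching N) with h | ⟨⟨g₀⟩⟩
  · simp [mvar, avg]
  have hM : (0 : ℝ) < Fintype.card (Matching N) := Nat.cast_pos.2 (Fintype.card_pos_iff.2 ⟨g₀⟩)
  have hcyl : cyl ∅ g₀ = Finset.univ := by ext; simp [mem_cyl]
  have h := poincare_cyl N ∅ g₀ (by simp) (by simp) (fun g => f g - avg f) (by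
    rw [hcyl, Finset.sum_sub_distrib, Finset.sum_const, nsmul_eq_mul, avg, Finset.card_univ]
    field_simp
    ring)
  rw [dirichlet, hcyl, Finset.compl_empty] at h
  simp only [sub_sub_sub_cancel_right] at h
  rw [Finset.sum_congr rfl fun i _ => Finset.sum_comm, Finset.sum_comm] at h
  rw [le_div_iff₀ (by linarith)]
  simp only [mvar, avg] at h ⊢
  rw [div_mul_eq_mul_div, div_le_div_iff_of_pos_right hM]
  linarith

end Poincare

/-! ### Means, variances and decrements -/

section Average

variable {N : ℕ}

theorem avg_add (f f' : Matching N → ℝ) : avg (fun g => f g + f' g) = avg f + avg f' := by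
  simp [avg, Finset.sum_add_distrib, add_div]

theorem avg_const_mul (c : ℝ) (f : Matching N → ℝ) : avg (fun g => c * f g) = c * avg f := by
  simp [avg, ← Finset.mul_sum, mul_div_assoc]

theorem avg_sum {ι : Type*} (s : Finset ι) (f : ι → Matching N → ℝ) :
    avg (fun g => ∑ i ∈ s, f i g) = ∑ i ∈ s, avg (f i) := by
  simp only [avg]
  rw [Finset.sum_comm, Finset.sum_div]

theorem avg_mono {f f' : Matching N → ℝ} (h : ∀ g, f g ≤ f' g) : avg f ≤ avg f' :=
  div_le_div_of_nonneg_right (Finset.sum_le_sum fun g _ => h g) (Nat.cast_nonneg _)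

theorem avg_nonneg {f : Matching N → ℝ} (h : ∀ g, 0 ≤ f g) : 0 ≤ avg f :=
  div_nonneg (Finset.sum_nonneg fun g _ => h g) (Nat.cast_nonneg _)

theorem avg_switch (i j : Fin N) (f : Matching N → ℝ) :
    avg (fun g => f (switch g i j)) = avg f := by
  simp only [avg, sum_switch]

/-- Only an inequality, because the mean over an empty set of matchings is 0 by the convention for
division by zero. -/
theorem avg_one_le : avg (fun _ : Matching N => 1) ≤ 1 := by
  simp only [avg, Finset.sum_const, Finset.card_univ, nsmul_eq_mul, mul_one]
  exact div_self_le_one _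

theorem mvar_nonneg (f : Matching N → ℝ) : 0 ≤ mvar f := avg_nonneg fun _ => sq_nonneg _

theorem mvar_const_mul (c : ℝ) (f : Matching N → ℝ) : mvar (fun g => c * f g) = c ^ 2 * mvar f := by
  simp only [mvar, avg_const_mul, ← mul_sub, mul_pow]

theorem avg_mul_sq_le (f f' : Matching N → ℝ) :
    avg (fun g => f g * f' g) ^ 2 ≤ avg (fun g => f g ^ 2) * avg (fun g => f' g ^ 2) := by
  simp only [avg, div_pow, div_mul_div_comm, ← sq]
  exact div_le_div_of_nonneg_right (Finset.sum_mul_sq_le_sq_mul_sq _ _ _) (by positivity)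

theorem sqrt_mvar_add_le (f f' : Matching N → ℝ) :
    √(mvar fun g => f g + f' g) ≤ √(mvar f) + √(mvar f') := by
  have h1 := mvar_nonneg f
  have h2 := mvar_nonneg f'
  refine Real.sqrt_le_iff.2 ⟨by positivity, ?_⟩
  have hc := Real.abs_le_sqrt (avg_mul_sq_le (fun g => f g - avg f) fun g => f' g - avg f')
  rw [Real.sqrt_mul (by exact h1)] at hc
  have e : mvar (fun g => f g + f' g) =
      mvar f + 2 * avg (fun g => (f g - avg f) * (f' g - avg f')) + mvar f' := by
    simp only [mvar]
    rw [← avg_const_mul, ← avg_add, ← avg_add]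
    refine congrArg avg (funext fun g => ?_)
    rw [avg_add]
    ring
  rw [e]
  have h3 := Real.sq_sqrt h1
  have h4 := Real.sq_sqrt h2
  have h5 := (le_abs_self _).trans hc
  change _ ≤ √(mvar f) * √(mvar f') at h5
  nlinarith

theorem sqrt_mvar_const_mul (c : ℝ) (f : Matching N → ℝ) :
    √(mvar fun g => c * f g) = |c| * √(mvar f) := by
  rw [mvar_const_mul, Real.sqrt_mul (sq_nonneg c), Real.sqrt_sq_eq_abs]

/-- The sum of the squared decrements of `f` under the switchings of `g`. -/
def down (f : Matching N → ℝ) (g : Matching N) : ℝ :=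
  ∑ i, ∑ j, (max (f g - f (switch g i j)) 0) ^ 2

theorem down_nonneg (f : Matching N → ℝ) (g : Matching N) : 0 ≤ down f g :=
  Finset.sum_nonneg fun _ _ => Finset.sum_nonneg fun _ _ => sq_nonneg _

theorem sq_eq_max_sq_add (x : ℝ) : x ^ 2 = (max (-x) 0) ^ 2 + (max x 0) ^ 2 := by
  rcases le_total x 0 with h | h
  · rw [max_eq_left (by linarith), max_eq_right h]; ring
  · rw [max_eq_right (by linarith), max_eq_left h]; ring

/-- For fixed `i` and `j` the switching is an involution that preserves the uniform law and turns
increments into decrements, so both have the same second moment. -/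
theorem avg_sum_sq_eq (f : Matching N → ℝ) :
    avg (fun g => ∑ i, ∑ j, (f (switch g i j) - f g) ^ 2) = 2 * avg (down f) := by
  have h : ∀ i j, avg (fun g => (f (switch g i j) - f g) ^ 2) =
      2 * avg (fun g => (max (f g - f (switch g i j)) 0) ^ 2) := by
    intro i j
    have h1 := avg_switch i j fun g => (max (f g - f (switch g i j)) 0) ^ 2
    simp only [switch_switch] at h1
    rw [two_mul]
    nth_rewrite 2 [← h1]
    rw [← avg_add]
    congr 1
    funext g
    rw [sq_eq_max_sq_add, neg_sub]
  unfold down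
  simp only [avg_sum, h, Finset.mul_sum]

/-- Reversibility turns the Poincaré inequality into a bound by decrements. -/
theorem mvar_le_down (hN : 1 < N) (f : Matching N → ℝ) :
    mvar f ≤ avg (down f) / (4 * ((N : ℝ) - 1)) := by
  have h := poincare hN f
  have hN' : (1 : ℝ) < N := by exact_mod_cast hN
  rw [avg_sum_sq_eq] at h
  refine h.trans (le_of_eq ?_)
  have : (N : ℝ) - 1 ≠ 0 := by linarith
  field_simp
  ring

/-- For nonnegative numbers, xy − x'y' ≤ y(x − x')⁺ + x(y − y')⁺. Restricting to decrements is what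
allows both coefficients to be values at `g`, before the switching. -/
theorem down_mul_le {X Y : Matching N → ℝ} (hX : ∀ g, 0 ≤ X g) (hY : ∀ g, 0 ≤ Y g)
    (g : Matching N) :
    down (fun g => X g * Y g) g ≤ 2 * Y g ^ 2 * down X g + 2 * X g ^ 2 * down Y g := by
  simp only [down, Finset.mul_sum, ← Finset.sum_add_distrib]
  refine Finset.sum_le_sum fun i _ => Finset.sum_le_sum fun j _ => ?_
  generalize hx' : X (switch g i j) = x'
  generalize hy' : Y (switch g i j) = y'
  have h1 := hX g
  have h2 := hY g
  have h3 : 0 ≤ x' := hx' ▸ hX _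
  have h4 : 0 ≤ y' := hy' ▸ hY _
  generalize X g = x at *
  generalize Y g = y at *
  have hp := le_max_left (x - x') 0
  have hp0 := le_max_right (x - x') 0
  have hq := le_max_left (y - y') 0
  have hq0 := le_max_right (y - y') 0
  have key : max (x * y - x' * y') 0 ≤ y * max (x - x') 0 + x * max (y - y') 0 := by
    refine max_le ?_ (by positivity)
    rcases le_total x' x with h | h
    · nlinarith [mul_le_mul_of_nonneg_left hp h2, mul_le_mul_of_nonneg_left hq h3,
        mul_le_mul_of_nonneg_right h hq0]
    · nlinarith [mul_nonneg h2 hp0, mul_le_mul_of_nonneg_left hq h1,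
        mul_le_mul_of_nonneg_right h h4]
  have h0 : 0 ≤ max (x * y - x' * y') 0 := le_max_right _ _
  nlinarith [sq_nonneg (y * max (x - x') 0 - x * max (y - y') 0), mul_self_le_mul_self h0 key]

end Average

/-! ### Probability of prescribed pairs -/

section PairProbability

variable {N : ℕ}

theorem ind_nonneg (g : Matching N) (α : Finset (Sym2 (Fin N))) : 0 ≤ ind g α := by
  unfold ind; split_ifs <;> norm_num

/-- The half-edges of the pairs of `α`. -/
def support (α : Finset (Sym2 (Fin N))) : Finset (Fin N) :=
  Finset.univ.filter fun x => ∃ p ∈ α, x ∈ p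

theorem mem_support {α : Finset (Sym2 (Fin N))} {x : Fin N} :
    x ∈ support α ↔ ∃ p ∈ α, x ∈ p := by simp [support]

theorem card_support_le (α : Finset (Sym2 (Fin N))) : (support α).card ≤ 2 * α.card := by
  classical
  have h : support α ⊆ α.biUnion fun p => p.toFinset := by
    intro x hx
    obtain ⟨p, hp, hxp⟩ := mem_support.1 hx
    exact Finset.mem_biUnion.2 ⟨p, hp, Sym2.mem_toFinset.2 hxp⟩
  refine (Finset.card_le_card h).trans ((Finset.card_biUnion_le_card_mul _ _ 2 fun p _ => ?_).trans
    (mul_comm _ _).le)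
  induction p using Sym2.ind with
  | _ x y =>
    rw [Sym2.toFinset_mk_eq]
    exact Finset.card_le_two

theorem subset_pairs_switch {α : Finset (Sym2 (Fin N))} {g : Matching N} {t t' : Fin N}
    (ht : t ∉ support α) (ht' : t' ∉ support α) (h : α ⊆ g.pairs) : α ⊆ (switch g t t').pairs := by
  intro p hp
  have h1 := h hp
  have hx : ∀ x ∈ p, x ≠ t ∧ x ≠ t' := fun x hx =>
    ⟨fun e => ht (e ▸ mem_support.2 ⟨p, hp, hx⟩), fun e => ht' (e ▸ mem_support.2 ⟨p, hp, hx⟩)⟩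
  induction p using Sym2.ind with
  | _ x y =>
    rw [Matching.mem_pairs] at h1 ⊢
    obtain ⟨a1, a2⟩ := hx x (Sym2.mem_mk_left x y)
    obtain ⟨b1, b2⟩ := hx y (Sym2.mem_mk_right x y)
    rw [switch_apply, Equiv.swap_apply_of_ne_of_ne a1 a2, h1, Equiv.swap_apply_of_ne_of_ne b1 b2]

theorem ind_switch {α : Finset (Sym2 (Fin N))} {g : Matching N} {t t' : Fin N}
    (ht : t ∉ support α) (ht' : t' ∉ support α) : ind (switch g t t') α = ind g α := by
  unfold ind
  refine if_congr ⟨fun h => ?_, subset_pairs_switch ht ht'⟩ rfl rfl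
  have := subset_pairs_switch ht ht' h
  rwa [switch_switch] at this

/-- If the new pair is degenerate or meets `β` in a half-edge, the event is impossible. Otherwise
switching `t` with any `t'` outside `s` and the support of `β` preserves the probability, the events
g s = t' are disjoint, and there are at least N − 1 − 2|β| such `t'`. -/
theorem avg_ind_insert_le {β : Finset (Sym2 (Fin N))} {e : Sym2 (Fin N)} (he : e ∉ β) :
    avg (fun g => ind g (insert e β)) * ((N : ℝ) - 1 - 2 * β.card) ≤ avg (fun g => ind g β) := by
  classical
  have hz : (∀ g : Matching N, β ⊆ g.pairs → e ∉ g.pairs) →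
      avg (fun g => ind g (insert e β)) * ((N : ℝ) - 1 - 2 * β.card) ≤ avg (fun g => ind g β) := by
    intro h
    have h0 : (fun g : Matching N => ind g (insert e β)) = fun _ => 0 := by
      funext g
      rw [ind, if_neg]
      intro hg
      rw [Finset.insert_subset_iff] at hg
      exact h g hg.2 hg.1
    rw [h0]
    simpa [avg] using avg_nonneg fun g => ind_nonneg g β
  induction e using Sym2.ind with
  | _ s t =>
  have hmem : ∀ x y, s(x, y) ∉ β → x ∈ support β → ∀ g : Matching N, β ⊆ g.pairs →
      s(x, y) ∉ g.pairs := by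
    intro x y hxy hx g hg h
    obtain ⟨p, hp, hxp⟩ := mem_support.1 hx
    obtain ⟨z, rfl⟩ := hxp
    have h1 := hg hp
    rw [Matching.mem_pairs] at h h1
    rw [h1] at h
    exact hxy (h ▸ hp)
  by_cases hst : t = s
  · subst hst
    refine hz fun g _ h => ?_
    rw [Matching.mem_pairs] at h
    exact g.apply_ne t h
  by_cases hs : s ∈ support β
  · exact hz (hmem s t he hs)
  by_cases ht : t ∈ support β
  · rw [Sym2.eq_swap] at he hz ⊢
    exact hz (hmem t s he ht)
  set T := Finset.univ \ insert s (support β) with hT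
  have hTcard : (N : ℝ) - 1 - 2 * β.card ≤ T.card := by
    have h1 : N ≤ T.card + (insert s (support β)).card := by
      have := Finset.le_card_sdiff (insert s (support β)) Finset.univ
      rw [Finset.card_univ, Fintype.card_fin, ← hT] at this
      omega
    have h2 := Finset.card_insert_le s (support β)
    have h3 := card_support_le β
    have : (N : ℝ) ≤ T.card + (2 * β.card + 1) := by exact_mod_cast (by omega)
    linarith
  have hsym : ∀ t' ∈ T, avg (fun g => ind g (insert s(s, t) β)) =
      avg (fun g => ind g (insert s(s, t') β)) := by
    intro t' ht'
    simp only [hT, Finset.mem_sdiff, Finset.mem_univ, true_and, Finset.mem_insert, not_or] at ht'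
    rw [← avg_switch t t']
    congr 1
    funext g
    have e1 := ind_switch (g := g) ht ht'.2
    unfold ind at e1 ⊢
    simp only [Finset.insert_subset_iff, Matching.mem_pairs]
    have e2 : (switch g t t').1 s = t ↔ g.1 s = t' := by
      rw [switch_apply, Equiv.swap_apply_of_ne_of_ne (Ne.symm hst) (Ne.symm ht'.1),
        Equiv.swap_apply_eq_iff, Equiv.swap_apply_left]
    simp only [e2]
    by_cases h : g.1 s = t'
    · simpa [h] using e1
    · simp [h]
  calc avg (fun g => ind g (insert s(s, t) β)) * ((N : ℝ) - 1 - 2 * β.card)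
      ≤ avg (fun g => ind g (insert s(s, t) β)) * T.card :=
        mul_le_mul_of_nonneg_left hTcard (avg_nonneg fun g => ind_nonneg _ _)
    _ = ∑ t' ∈ T, avg (fun g => ind g (insert s(s, t') β)) := by
        rw [← Finset.sum_congr rfl hsym, Finset.sum_const, nsmul_eq_mul, mul_comm]
    _ = avg (fun g => ∑ t' ∈ T, ind g (insert s(s, t') β)) := (avg_sum _ _).symm
    _ ≤ avg (fun g => ind g β) := by
        refine avg_mono fun g => ?_
        by_cases hβ : β ⊆ g.pairs
        · rw [ind, if_pos hβ]
          have : ∀ t' ∈ T, ind g (insert s(s, t') β) = if t' = g.1 s then 1 else 0 := by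
            intro t' _
            unfold ind
            simp [Finset.insert_subset_iff, Matching.mem_pairs, hβ, eq_comm]
          rw [Finset.sum_congr rfl this, Finset.sum_ite_eq']
          split_ifs <;> norm_num
        · rw [Finset.sum_eq_zero fun t' _ => ?_]
          · exact ind_nonneg _ _
          · rw [ind, if_neg fun h => hβ (Finset.insert_subset_iff.1 h).2]

/-- The probability that given pairs are matched. -/
theorem avg_ind_le (α : Finset (Sym2 (Fin N))) (h : 2 * α.card ≤ N) :
    avg (fun g => ind g α) * ∏ i ∈ Finset.range α.card, ((N : ℝ) - 1 - 2 * i) ≤ 1 := by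
  classical
  induction α using Finset.induction_on with
  | empty =>
    simp only [ind, Finset.empty_subset, if_true, Finset.card_empty, Finset.range_zero,
      Finset.prod_empty, mul_one]
    exact avg_one_le
  | insert e β he ih =>
    rw [Finset.card_insert_of_notMem he] at h ⊢
    rw [Finset.prod_range_succ, mul_comm (Finset.prod _ _), ← mul_assoc]
    refine le_trans (mul_le_mul_of_nonneg_right (avg_ind_insert_le he) ?_) (ih (by omega))
    refine Finset.prod_nonneg fun i hi => ?_
    have : i + 1 ≤ β.card := Finset.mem_range.1 hi
    have : (2 * (i + 1 + 1) : ℝ) ≤ N := by exact_mod_cast (by omega)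
    linarith

end PairProbability

/-! ### Isolated edges and 2-stars under a switching -/

section Statistics

variable {N : ℕ}

/-- `a` and `c` are the indicators of the half-edges at vertices of degree one and of degree two, and
`τ` exchanges the two half-edges of each vertex of degree two. -/
structure HalfEdgeTypes (a c : Fin N → ℝ) (τ : Fin N → Fin N) : Prop where
  leaf_zero_or_one : ∀ x, a x = 0 ∨ a x = 1
  mid_zero_or_one : ∀ x, c x = 0 ∨ c x = 1
  leaf_of_mid : ∀ x, c x = 1 → a x = 0
  mid_twin : ∀ x, c (τ x) = c x
  twin_twin : ∀ x, τ (τ x) = x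
  twin_ne : ∀ x, c x = 1 → τ x ≠ x

/-- The number of isolated edges. -/
def edgeCount (a : Fin N → ℝ) (g : Matching N) : ℝ := (∑ x, a x * a (g.1 x)) / 2

/-- The number of isolated 2-stars. -/
def starCount (a c : Fin N → ℝ) (τ : Fin N → Fin N) (g : Matching N) : ℝ :=
  (∑ x, c x * a (g.1 x) * a (g.1 (τ x))) / 2

/-- The number of vertices of degree two with exactly one neighbour of degree one, plus `κ` times the
number of self-loops at vertices of degree two. -/
def halfStarCount (κ : ℝ) (a c : Fin N → ℝ) (τ : Fin N → Fin N) (g : Matching N) : ℝ :=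
  ∑ x, c x * a (g.1 x) * (1 - a (g.1 (τ x))) + κ / 2 * ∑ x, c x * (if g.1 x = τ x then 1 else 0)

variable {a c : Fin N → ℝ} {τ : Fin N → Fin N} {g : Matching N} {i j : Fin N}

theorem sum_touched (h1 : j ≠ i) (h2 : j ≠ g.1 i) (φ : Fin N → ℝ)
    (hφ : ∀ x, x ≠ i → x ≠ j → x ≠ g.1 i → x ≠ g.1 j → φ x = 0) :
    ∑ x, φ x = φ i + φ (g.1 i) + (φ j + φ (g.1 j)) := by
  have e1 := g.apply_apply
  have e2 := g.apply_ne
  rw [← Finset.sum_subset (Finset.subset_univ {i, g.1 i, j, g.1 j}),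
    Finset.sum_insert, Finset.sum_insert, Finset.sum_insert, Finset.sum_singleton, add_assoc]
  all_goals simp only [Finset.mem_insert, Finset.mem_singleton]
  all_goals grind

theorem sum_touched_ite (h1 : j ≠ i) (h2 : j ≠ g.1 i) (φ : Fin N → ℝ) :
    ∑ x, φ x * (if x = i ∨ x = g.1 i ∨ x = j ∨ x = g.1 j then 1 else 0) =
      φ i + φ (g.1 i) + (φ j + φ (g.1 j)) := by
  rw [sum_touched h1 h2]
  · simp
  · intro x h3 h4 h5 h6
    simp [h3, h4, h5, h6]

theorem switch_eq_self (h : ¬ (j ≠ i ∧ j ≠ g.1 i)) : switch g i j = g := by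
  by_cases h1 : j = i
  · rw [h1, switch_self]
  · have h2 : j = g.1 i := by tauto
    rw [h2, switch_partner]

theorem leaf_switch (a : Fin N → ℝ) (h1 : j ≠ i) (h2 : j ≠ g.1 i) (x : Fin N) :
    a ((switch g i j).1 x) = if x = i then a (g.1 j) else if x = j then a (g.1 i) else
      if x = g.1 i then a j else if x = g.1 j then a i else a (g.1 x) := by
  rw [switch_apply_eq g h1 h2]
  split_ifs <;> rfl

theorem leaf_switch_eq (a : Fin N → ℝ) (h1 : j ≠ i) (h2 : j ≠ g.1 i) {x : Fin N}
    (hx : ¬ (x = i ∨ x = g.1 i ∨ x = j ∨ x = g.1 j)) : a ((switch g i j).1 x) = a (g.1 x) := by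
  rw [leaf_switch a h1 h2]
  push Not at hx
  rw [if_neg hx.1, if_neg hx.2.2.1, if_neg hx.2.1, if_neg hx.2.2.2]

theorem leaf_switch_self (a : Fin N → ℝ) (h1 : j ≠ i) (h2 : j ≠ g.1 i) :
    a ((switch g i j).1 i) = a (g.1 j) ∧ a ((switch g i j).1 j) = a (g.1 i) ∧
    a ((switch g i j).1 (g.1 i)) = a j ∧ a ((switch g i j).1 (g.1 j)) = a i := by
  have e1 := g.apply_apply
  have e2 := g.apply_ne
  refine ⟨?_, ?_, ?_, ?_⟩ <;> rw [leaf_switch a h1 h2] <;> grind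

/-- The pairs {i, g i}, {j, g j} become {i, g j}, {j, g i}, and the difference of the four products
of leaf indicators factors. -/
theorem edgeCount_sub_switch (a : Fin N → ℝ) (h1 : j ≠ i) (h2 : j ≠ g.1 i) :
    edgeCount a g - edgeCount a (switch g i j) = (a i - a j) * (a (g.1 i) - a (g.1 j)) := by
  have e : ∑ x, (a x * a (g.1 x) - a x * a ((switch g i j).1 x)) =
      2 * ((a i - a j) * (a (g.1 i) - a (g.1 j))) := by
    rw [sum_touched h1 h2]
    · obtain ⟨f1, f2, f3, f4⟩ := leaf_switch_self a h1 h2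
      rw [f1, f2, f3, f4, g.apply_apply, g.apply_apply]
      ring
    · intro x h3 h4 h5 h6
      rw [leaf_switch_eq a h1 h2 (by tauto), sub_self]
  rw [Finset.sum_sub_distrib] at e
  simp only [edgeCount]
  linarith

/-- At `j = g i` nothing changes, while the product equals −(a i − a j)²; the correction lets sums
run over all `j`. -/
theorem edgeCount_sub_switch' (a : Fin N → ℝ) (g : Matching N) (i j : Fin N) :
    edgeCount a g - edgeCount a (switch g i j) = (a i - a j) * (a (g.1 i) - a (g.1 j)) +
      if j = g.1 i then (a i - a j) ^ 2 else 0 := by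
  by_cases h : j ≠ i ∧ j ≠ g.1 i
  · rw [edgeCount_sub_switch a h.1 h.2, if_neg h.2, add_zero]
  · rw [switch_eq_self h, sub_self]
    by_cases h1 : j = i
    · subst h1; simp
    · have h2 : j = g.1 i := by tauto
      rw [if_pos h2, h2, g.apply_apply]
      ring

theorem sum_comp_partner (g : Matching N) (φ : Fin N → ℝ) : ∑ x, φ (g.1 x) = ∑ x, φ x :=
  Equiv.sum_comp (Function.Involutive.toPerm g.1 g.apply_apply) φ

theorem HalfEdgeTypes.sum_comp_twin (h : HalfEdgeTypes a c τ) (φ : Fin N → ℝ) :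
    ∑ x, φ (τ x) = ∑ x, φ x :=
  Equiv.sum_comp (Function.Involutive.toPerm τ h.twin_twin) φ

theorem sum_sum_add (φ : Fin N → ℝ) : ∑ i, ∑ j, (φ i + φ j) = 2 * N * ∑ i, φ i := by
  simp only [Finset.sum_add_distrib, Finset.sum_const, Finset.card_univ, Fintype.card_fin,
    nsmul_eq_mul, ← Finset.mul_sum]
  ring

theorem HalfEdgeTypes.edgeCount_nonneg (h : HalfEdgeTypes a c τ) : 0 ≤ edgeCount a g := by
  refine div_nonneg (Finset.sum_nonneg fun x _ => ?_) (by norm_num)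
  rcases h.leaf_zero_or_one x with h1 | h1 <;>
    rcases h.leaf_zero_or_one (g.1 x) with h2 | h2 <;> simp [h1, h2]

/-- A switching destroys at most one isolated edge net, and only if the pair of `i` or the pair of
`j` is one. -/
theorem HalfEdgeTypes.down_edgeCount_le (h : HalfEdgeTypes a c τ) (g : Matching N) :
    down (edgeCount a) g ≤ 4 * N * edgeCount a g := by
  have hb : ∀ i j, (max (edgeCount a g - edgeCount a (switch g i j)) 0) ^ 2 ≤
      a i * a (g.1 i) + a j * a (g.1 j) := by
    intro i j
    have h1 := h.leaf_zero_or_one i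
    have h2 := h.leaf_zero_or_one j
    have h3 := h.leaf_zero_or_one (g.1 i)
    have h4 := h.leaf_zero_or_one (g.1 j)
    by_cases hij : j ≠ i ∧ j ≠ g.1 i
    · rw [edgeCount_sub_switch a hij.1 hij.2]
      rcases h1 with h1 | h1 <;> rcases h2 with h2 | h2 <;> rcases h3 with h3 | h3 <;>
        rcases h4 with h4 | h4 <;> rw [h1, h2, h3, h4] <;> norm_num
    · rw [switch_eq_self hij, sub_self, max_self]
      rcases h1 with h1 | h1 <;> rcases h2 with h2 | h2 <;> rcases h3 with h3 | h3 <;>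
        rcases h4 with h4 | h4 <;> rw [h1, h2, h3, h4] <;> norm_num
  refine (Finset.sum_le_sum fun i _ => Finset.sum_le_sum fun j _ => hb i j).trans (le_of_eq ?_)
  rw [sum_sum_add fun i => a i * a (g.1 i), edgeCount]
  ring

/-- The number of half-edges of degree one whose partner does not have degree one. -/
theorem sum_leaf_nonleaf (a : Fin N → ℝ) (g : Matching N) :
    ∑ x, a x * (1 - a (g.1 x)) = ∑ x, a x - 2 * edgeCount a g := by
  simp only [mul_sub, mul_one, Finset.sum_sub_distrib, edgeCount]
  ring

theorem HalfEdgeTypes.two_mul_edgeCount_le (h : HalfEdgeTypes a c τ) (g : Matching N) :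
    2 * edgeCount a g ≤ ∑ x, a x := by
  have : 0 ≤ ∑ x, a x * (1 - a (g.1 x)) := Finset.sum_nonneg fun x _ => by
    rcases h.leaf_zero_or_one x with h1 | h1 <;>
    rcases h.leaf_zero_or_one (g.1 x) with h2 | h2 <;> simp [h1, h2]
  rw [sum_leaf_nonleaf] at this
  linarith

/-- The truncated number `(2 (n₁ - 2 E) - 3)⁺`, where `E` is the number of isolated edges. -/
def outerCount (a : Fin N → ℝ) (g : Matching N) : ℝ :=
  max (2 * ∑ x, a x - 4 * edgeCount a g - 3) 0

/-- A decrement is at most four times an increment of the number of isolated edges. A new isolated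
edge needs a leaf and a non-leaf in each of the two switched pairs, and the number of leaves matched
to non-leaves is A − 2E ≤ A. -/
theorem HalfEdgeTypes.down_outerCount_le (h : HalfEdgeTypes a c τ) (g : Matching N) :
    down (outerCount a) g ≤ 32 * (∑ x, a x) ^ 2 := by
  have hb : ∀ i j, (max (outerCount a g - outerCount a (switch g i j)) 0) ^ 2 ≤
      16 * ((a i * (1 - a (g.1 i))) * (a (g.1 j) * (1 - a j)) +
        (a (g.1 i) * (1 - a i)) * (a j * (1 - a (g.1 j)))) := by
    intro i j
    have h1 := h.leaf_zero_or_one i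
    have h2 := h.leaf_zero_or_one j
    have h3 := h.leaf_zero_or_one (g.1 i)
    have h4 := h.leaf_zero_or_one (g.1 j)
    by_cases hij : j ≠ i ∧ j ≠ g.1 i
    · have hd := edgeCount_sub_switch a hij.1 hij.2
      have hle : max (outerCount a g - outerCount a (switch g i j)) 0 ≤
          4 * max (-(edgeCount a g - edgeCount a (switch g i j))) 0 := by
        refine max_le ?_ (by positivity)
        have h5 := le_max_left (-(edgeCount a g - edgeCount a (switch g i j))) 0
        have h6 := le_max_right (-(edgeCount a g - edgeCount a (switch g i j))) 0
        simp only [outerCount]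
        rw [sub_le_iff_le_add]
        refine max_le ?_ (by positivity)
        have h7 := le_max_left (2 * ∑ x, a x - 4 * edgeCount a (switch g i j) - 3) 0
        linarith
      refine (pow_le_pow_left₀ (le_max_right _ _) hle 2).trans ?_
      rw [hd, mul_pow]
      rcases h1 with h1 | h1 <;> rcases h2 with h2 | h2 <;> rcases h3 with h3 | h3 <;>
        rcases h4 with h4 | h4 <;> rw [h1, h2, h3, h4] <;> norm_num
    · rw [switch_eq_self hij, sub_self, max_self]
      rcases h1 with h1 | h1 <;> rcases h2 with h2 | h2 <;> rcases h3 with h3 | h3 <;>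
        rcases h4 with h4 | h4 <;> rw [h1, h2, h3, h4] <;> norm_num
  refine (Finset.sum_le_sum fun i _ => Finset.sum_le_sum fun j _ => hb i j).trans ?_
  have hs : ∑ x, a (g.1 x) * (1 - a x) = ∑ x, a x * (1 - a (g.1 x)) := by
    rw [← sum_comp_partner g]
    simp only [g.apply_apply]
  simp only [← Finset.mul_sum, Finset.sum_add_distrib]
  rw [← Finset.sum_mul, ← Finset.sum_mul, hs, sum_leaf_nonleaf]
  have h1 := h.two_mul_edgeCount_le g
  have h2 := h.edgeCount_nonneg (g := g)
  nlinarith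

section Stars

/-- Whether `x` is one of the central half-edges of an isolated 2-star. -/
def starAt (a c : Fin N → ℝ) (τ : Fin N → Fin N) (g : Matching N) (x : Fin N) : ℝ :=
  c x * a (g.1 x) * a (g.1 (τ x))

theorem HalfEdgeTypes.starAt_zero_or_one (h : HalfEdgeTypes a c τ) (g : Matching N) (x : Fin N) :
    starAt a c τ g x = 0 ∨ starAt a c τ g x = 1 := by
  unfold starAt
  rcases h.mid_zero_or_one x with h1 | h1 <;> rcases h.leaf_zero_or_one (g.1 x) with h2 | h2 <;>
    rcases h.leaf_zero_or_one (g.1 (τ x)) with h3 | h3 <;> simp [h1, h2, h3]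

theorem HalfEdgeTypes.starAt_eq_one (h : HalfEdgeTypes a c τ) {x : Fin N}
    (hx : starAt a c τ g x = 1) : c x = 1 ∧ a x = 0 ∧ a (g.1 x) = 1 ∧ c (g.1 x) = 0 := by
  unfold starAt at hx
  have h4 := h.leaf_of_mid x
  have h5 := h.leaf_of_mid (g.1 x)
  have h6 := h.mid_zero_or_one (g.1 x)
  rcases h.mid_zero_or_one x with h1 | h1 <;> rcases h.leaf_zero_or_one (g.1 x) with h2 | h2 <;>
    rcases h.leaf_zero_or_one (g.1 (τ x)) with h3 | h3 <;> simp_all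

theorem HalfEdgeTypes.starAt_twin (h : HalfEdgeTypes a c τ) (x : Fin N) :
    starAt a c τ g (τ x) = starAt a c τ g x := by
  unfold starAt
  rw [h.mid_twin, h.twin_twin]
  ring

/-- A destroyed 2-star must have one of its two central half-edges among the four touched ones. Each
star is counted twice in the sum over half-edges, once through `x` and once through its twin, which
cancels the factor 1/2. -/
theorem HalfEdgeTypes.starCount_sub_le (h : HalfEdgeTypes a c τ) (h1 : j ≠ i) (h2 : j ≠ g.1 i) :
    starCount a c τ g - starCount a c τ (switch g i j) ≤ starAt a c τ g i + starAt a c τ g (g.1 i) +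
      (starAt a c τ g j + starAt a c τ g (g.1 j)) := by
  have key : ∀ x, starAt a c τ g x - starAt a c τ (switch g i j) x ≤
      starAt a c τ g x * (if x = i ∨ x = g.1 i ∨ x = j ∨ x = g.1 j then 1 else 0) +
      starAt a c τ g (τ x) *
        (if τ x = i ∨ τ x = g.1 i ∨ τ x = j ∨ τ x = g.1 j then 1 else 0) := by
    intro x
    have e0 : 0 ≤ starAt a c τ g x := by
      rcases h.starAt_zero_or_one g x with e | e <;> rw [e]; norm_num
    have e1 : 0 ≤ starAt a c τ (switch g i j) x := by
      rcases h.starAt_zero_or_one (switch g i j) x with e | e <;> rw [e]; norm_num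
    rw [h.starAt_twin]
    by_cases hx : x = i ∨ x = g.1 i ∨ x = j ∨ x = g.1 j
    · rw [if_pos hx]
      split_ifs <;> linarith
    · by_cases hτ : τ x = i ∨ τ x = g.1 i ∨ τ x = j ∨ τ x = g.1 j
      · rw [if_pos hτ, if_neg hx]; linarith
      · rw [if_neg hτ, if_neg hx]
        unfold starAt
        rw [leaf_switch_eq a h1 h2 hx, leaf_switch_eq a h1 h2 hτ]
        linarith
  have hsum := Finset.sum_le_sum fun x (_ : x ∈ Finset.univ) => key x
  rw [Finset.sum_add_distrib, Finset.sum_sub_distrib, sum_touched_ite h1 h2,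
    h.sum_comp_twin fun x => starAt a c τ g x *
      (if x = i ∨ x = g.1 i ∨ x = j ∨ x = g.1 j then 1 else 0), sum_touched_ite h1 h2] at hsum
  have e1 : starCount a c τ g = (∑ x, starAt a c τ g x) / 2 := rfl
  have e2 : starCount a c τ (switch g i j) = (∑ x, starAt a c τ (switch g i j) x) / 2 := rfl
  rw [e1, e2]
  linarith

/-- Switching pairs of the same types changes no leaf indicator of a partner. In particular two
stars that exchange their leaves survive. -/
theorem starCount_switch_eq (h1 : j ≠ i) (h2 : j ≠ g.1 i) (h3 : a i = a j)
    (h4 : a (g.1 i) = a (g.1 j)) : starCount a c τ (switch g i j) = starCount a c τ g := by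
  have : ∀ x, a ((switch g i j).1 x) = a (g.1 x) := by
    intro x
    rw [leaf_switch a h1 h2]
    have := g.apply_apply
    split_ifs <;> simp_all
  simp only [starCount, this]

theorem HalfEdgeTypes.starCount_nonneg (h : HalfEdgeTypes a c τ) (g : Matching N) :
    0 ≤ starCount a c τ g := by
  refine div_nonneg (Finset.sum_nonneg fun x _ => ?_) (by norm_num)
  have : c x * a (g.1 x) * a (g.1 (τ x)) = starAt a c τ g x := rfl
  rcases h.starAt_zero_or_one g x with e | e <;> rw [this, e]; norm_num

theorem HalfEdgeTypes.down_starCount_le (h : HalfEdgeTypes a c τ) (g : Matching N) :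
    down (starCount a c τ) g ≤ 8 * N * starCount a c τ g := by
  set s : Fin N → ℝ := starAt a c τ g with hs
  -- The first three terms come from squaring the bound of `starCount_sub_le`. The last two may be
  -- subtracted because nothing is lost when `i` and `j`, or `g i` and `g j`, are both central
  -- half-edges. They are chosen so that after summation over `i` and `j` all quadratic terms cancel
  -- and a bound linear in S remains.
  have hb : ∀ i j, (max (starCount a c τ g - starCount a c τ (switch g i j)) 0) ^ 2 ≤
      (s i + s (g.1 i)) + (s j + s (g.1 j)) + 2 * ((s i + s (g.1 i)) * (s j + s (g.1 j))) -
        4 * (s i * s j) - 4 * (s (g.1 i) * s (g.1 j)) := by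
    intro i j
    have c1 := h.starAt_zero_or_one g i
    have c2 := h.starAt_zero_or_one g j
    have c3 := h.starAt_zero_or_one g (g.1 i)
    have c4 := h.starAt_zero_or_one g (g.1 j)
    have d1 := h.starAt_eq_one (g := g) (x := i)
    have d2 := h.starAt_eq_one (g := g) (x := j)
    have d3 := h.starAt_eq_one (g := g) (x := g.1 i)
    have d4 := h.starAt_eq_one (g := g) (x := g.1 j)
    rw [g.apply_apply] at d3 d4
    simp only [← hs] at c1 c2 c3 c4 d1 d2 d3 d4
    by_cases hij : j ≠ i ∧ j ≠ g.1 i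
    · have hle := h.starCount_sub_le hij.1 hij.2
      rw [← hs] at hle
      have heq := starCount_switch_eq (a := a) (c := c) (τ := τ) hij.1 hij.2
      have hpos : ∀ y : ℝ, s i + s (g.1 i) + (s j + s (g.1 j)) ≤ y → 0 ≤ y →
          (max (starCount a c τ g - starCount a c τ (switch g i j)) 0) ^ 2 ≤ y ^ 2 :=
        fun y hy hy0 => pow_le_pow_left₀ (le_max_right _ _) (max_le (hle.trans hy) hy0) 2
      by_cases e1 : s i = 1 ∧ s j = 1
      · rw [heq (by rw [(d1 e1.1).2.1, (d2 e1.2).2.1]) (by rw [(d1 e1.1).2.2.1, (d2 e1.2).2.2.1]),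
          sub_self, max_self]
        rcases c3 with c3 | c3 <;> rcases c4 with c4 | c4 <;> rw [e1.1, e1.2, c3, c4] <;> norm_num
      · by_cases e2 : s (g.1 i) = 1 ∧ s (g.1 j) = 1
        · rw [heq (by rw [(d3 e2.1).2.2.1, (d4 e2.2).2.2.1]) (by rw [(d3 e2.1).2.1, (d4 e2.2).2.1]),
            sub_self, max_self]
          rcases c1 with c1 | c1 <;> rcases c2 with c2 | c2 <;> rw [e2.1, e2.2, c1, c2] <;> norm_num
        · refine (hpos _ le_rfl ?_).trans (le_of_eq ?_)
          · rcases c1 with c1 | c1 <;> rcases c2 with c2 | c2 <;> rcases c3 with c3 | c3 <;>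
            rcases c4 with c4 | c4 <;> rw [c1, c2, c3, c4] <;> norm_num
          · have n1 : s i * s (g.1 i) = 0 := by
              rcases c1 with c1 | c1
              · rw [c1, zero_mul]
              · rcases c3 with c3 | c3
                · rw [c3, mul_zero]
                · exact absurd (d1 c1).2.1 (by rw [(d3 c3).2.2.1]; norm_num)
            have n2 : s j * s (g.1 j) = 0 := by
              rcases c2 with c2 | c2
              · rw [c2, zero_mul]
              · rcases c4 with c4 | c4
                · rw [c4, mul_zero]
                · exact absurd (d2 c2).2.1 (by rw [(d4 c4).2.2.1]; norm_num)
            have n3 : s i * s j = 0 := by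
              rcases c1 with c1 | c1
              · rw [c1, zero_mul]
              · rcases c2 with c2 | c2
                · rw [c2, mul_zero]
                · exact absurd ⟨c1, c2⟩ e1
            have n4 : s (g.1 i) * s (g.1 j) = 0 := by
              rcases c3 with c3 | c3
              · rw [c3, zero_mul]
              · rcases c4 with c4 | c4
                · rw [c4, mul_zero]
                · exact absurd ⟨c3, c4⟩ e2
            have q : ∀ y : ℝ, y = 0 ∨ y = 1 → y ^ 2 = y := by
              rintro y (rfl | rfl) <;> norm_num
            nlinarith [q _ c1, q _ c2, q _ c3, q _ c4]
    · rw [switch_eq_self hij, sub_self, max_self]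
      by_cases h1 : j = i
      · subst h1
        rcases c2 with c2 | c2 <;> rcases c4 with c4 | c4 <;> rw [c2, c4] <;> norm_num
      · have h2 : j = g.1 i := by tauto
        rw [h2, g.apply_apply]
        rcases c1 with c1 | c1 <;> rcases c3 with c3 | c3 <;> rw [c1, c3] <;> norm_num
  refine (Finset.sum_le_sum fun i _ => Finset.sum_le_sum fun j _ => hb i j).trans (le_of_eq ?_)
  have e1 : starCount a c τ g = (∑ x, s x) / 2 := rfl
  have e2 := sum_comp_partner g s
  simp only [Finset.sum_sub_distrib, Finset.sum_add_distrib (f := fun j => s _ + s _ + (s j + s _)),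
    ← Finset.mul_sum]
  rw [Finset.sum_add_distrib, sum_sum_add fun i => s i + s (g.1 i), ← Finset.mul_sum]
  rw [← Finset.sum_mul, ← Finset.sum_mul, ← Finset.sum_mul, Finset.sum_add_distrib, e2, e1]
  ring

end Stars

end Statistics

/-! ### Half-stars and loops under a switching -/

section HalfStars

variable {N : ℕ} {a c : Fin N → ℝ} {τ : Fin N → Fin N} {g : Matching N} {i j : Fin N} {κ : ℝ}

/-- Whether `x` belongs to a vertex of degree two, is matched to a half-edge of degree one, and its
twin is not. -/
def halfStarAt (a c : Fin N → ℝ) (τ : Fin N → Fin N) (g : Matching N) (x : Fin N) : ℝ :=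
  c x * a (g.1 x) * (1 - a (g.1 (τ x)))

/-- Whether `x` belongs to a self-loop at a vertex of degree two. -/
def loopAt (c : Fin N → ℝ) (τ : Fin N → Fin N) (g : Matching N) (x : Fin N) : ℝ :=
  c x * (if g.1 x = τ x then 1 else 0)

theorem halfStarCount_eq (κ : ℝ) (a c : Fin N → ℝ) (τ : Fin N → Fin N) (g : Matching N) :
    halfStarCount κ a c τ g = ∑ x, halfStarAt a c τ g x + κ / 2 * ∑ x, loopAt c τ g x := rfl

theorem HalfEdgeTypes.halfStarAt_zero_or_one (h : HalfEdgeTypes a c τ) (g : Matching N) (x : Fin N) :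
    halfStarAt a c τ g x = 0 ∨ halfStarAt a c τ g x = 1 := by
  unfold halfStarAt
  rcases h.mid_zero_or_one x with h1 | h1 <;> rcases h.leaf_zero_or_one (g.1 x) with h2 | h2 <;>
    rcases h.leaf_zero_or_one (g.1 (τ x)) with h3 | h3 <;> simp [h1, h2, h3]

theorem HalfEdgeTypes.loopAt_zero_or_one (h : HalfEdgeTypes a c τ) (g : Matching N) (x : Fin N) :
    loopAt c τ g x = 0 ∨ loopAt c τ g x = 1 := by
  unfold loopAt
  rcases h.mid_zero_or_one x with h1 | h1 <;> rw [h1] <;> split_ifs <;> norm_num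

theorem HalfEdgeTypes.halfStarAt_eq_one (h : HalfEdgeTypes a c τ) {x : Fin N} (hx : halfStarAt a c τ g x = 1) :
    c x = 1 ∧ a x = 0 ∧ a (g.1 x) = 1 ∧ c (g.1 x) = 0 ∧ a (g.1 (τ x)) = 0 := by
  unfold halfStarAt at hx
  have h4 := h.leaf_of_mid x
  have h5 := h.leaf_of_mid (g.1 x)
  have h6 := h.mid_zero_or_one (g.1 x)
  rcases h.mid_zero_or_one x with h1 | h1 <;> rcases h.leaf_zero_or_one (g.1 x) with h2 | h2 <;>
    rcases h.leaf_zero_or_one (g.1 (τ x)) with h3 | h3 <;> simp_all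

theorem HalfEdgeTypes.loopAt_eq_one (h : HalfEdgeTypes a c τ) {x : Fin N} (hx : loopAt c τ g x = 1) :
    c x = 1 ∧ c (g.1 x) = 1 ∧ a x = 0 ∧ a (g.1 x) = 0 ∧ g.1 x = τ x := by
  unfold loopAt at hx
  have h4 := h.leaf_of_mid x
  have h5 := h.leaf_of_mid (g.1 x)
  have h6 := h.mid_twin x
  by_cases e : g.1 x = τ x
  · rw [if_pos e, mul_one] at hx
    rw [← e, hx] at h6
    exact ⟨hx, h6, h4 hx, h5 h6, e⟩
  · rw [if_neg e, mul_zero] at hx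
    norm_num at hx

theorem HalfEdgeTypes.loopAt_partner (h : HalfEdgeTypes a c τ) (x : Fin N) : loopAt c τ g (g.1 x) = loopAt c τ g x := by
  have key : ∀ y, loopAt c τ g y = 1 → loopAt c τ g (g.1 y) = 1 := by
    intro y hy
    obtain ⟨e1, e2, -, -, e5⟩ := h.loopAt_eq_one hy
    unfold loopAt
    rw [e2, one_mul, g.apply_apply, if_pos]
    rw [e5, h.twin_twin]
  rcases h.loopAt_zero_or_one g x with e | e
  · rcases h.loopAt_zero_or_one g (g.1 x) with e' | e'
    · rw [e, e']
    · have := key _ e'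
      rw [g.apply_apply, e] at this
      norm_num at this
  · rw [e, key x e]

/-- A bound for the number of half-stars that a switching at `i` and `j` destroys. -/
theorem HalfEdgeTypes.halfStarCount_sub_le (h : HalfEdgeTypes a c τ) (hκ : 0 ≤ κ) (h1 : j ≠ i) (h2 : j ≠ g.1 i) :
    halfStarCount κ a c τ g - halfStarCount κ a c τ (switch g i j) ≤
      (halfStarAt a c τ g i + halfStarAt a c τ g (g.1 i) +
        (halfStarAt a c τ g j + halfStarAt a c τ g (g.1 j))) +
      (halfStarAt a c τ g (τ i) * a (g.1 j) + halfStarAt a c τ g (τ (g.1 i)) * a j +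
        (halfStarAt a c τ g (τ j) * a (g.1 i) + halfStarAt a c τ g (τ (g.1 j)) * a i)) +
      κ * (loopAt c τ g i + loopAt c τ g j) := by
  set T : Fin N → Prop := fun x => x = i ∨ x = g.1 i ∨ x = j ∨ x = g.1 j with hT
  -- A half-star can be lost in two ways: its own half-edge `x` is touched, or the twin of `x` is
  -- touched and acquires a leaf, which completes a 2-star. The second summand, written at τ x, is
  -- the latter.
  have key : ∀ x, halfStarAt a c τ g x - halfStarAt a c τ (switch g i j) x ≤
      halfStarAt a c τ g x * (if x = i ∨ x = g.1 i ∨ x = j ∨ x = g.1 j then 1 else 0) +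
      (halfStarAt a c τ g (τ (τ x)) * a ((switch g i j).1 (τ x))) *
        (if τ x = i ∨ τ x = g.1 i ∨ τ x = j ∨ τ x = g.1 j then 1 else 0) := by
    intro x
    have e0 : 0 ≤ halfStarAt a c τ g x := by
      rcases h.halfStarAt_zero_or_one g x with e | e <;> rw [e]; norm_num
    have e1 : 0 ≤ halfStarAt a c τ (switch g i j) x := by
      rcases h.halfStarAt_zero_or_one (switch g i j) x with e | e <;> rw [e]; norm_num
    have e2 : 0 ≤ a ((switch g i j).1 (τ x)) := by
      rcases h.leaf_zero_or_one ((switch g i j).1 (τ x)) with e | e <;> rw [e]; norm_num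
    rw [h.twin_twin]
    by_cases hx : x = i ∨ x = g.1 i ∨ x = j ∨ x = g.1 j
    · rw [if_pos hx]
      split_ifs <;> nlinarith [mul_nonneg e0 e2]
    · rw [if_neg hx]
      by_cases hτ : τ x = i ∨ τ x = g.1 i ∨ τ x = j ∨ τ x = g.1 j
      · rw [if_pos hτ]
        unfold halfStarAt
        rw [leaf_switch_eq a h1 h2 hx]
        rcases h.mid_zero_or_one x with c1 | c1 <;> rcases h.leaf_zero_or_one (g.1 x) with c2 | c2 <;>
        rcases h.leaf_zero_or_one (g.1 (τ x)) with c3 | c3 <;>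
        rcases h.leaf_zero_or_one ((switch g i j).1 (τ x)) with c4 | c4 <;>
        rw [c1, c2, c3, c4] <;> norm_num
      · rw [if_neg hτ]
        unfold halfStarAt
        rw [leaf_switch_eq a h1 h2 hx, leaf_switch_eq a h1 h2 hτ]
        linarith
  have keyl : ∀ x, loopAt c τ g x - loopAt c τ (switch g i j) x ≤
      loopAt c τ g x * (if x = i ∨ x = g.1 i ∨ x = j ∨ x = g.1 j then 1 else 0) := by
    intro x
    have e1 : 0 ≤ loopAt c τ (switch g i j) x := by
      rcases h.loopAt_zero_or_one (switch g i j) x with e | e <;> rw [e]; norm_num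
    by_cases hx : x = i ∨ x = g.1 i ∨ x = j ∨ x = g.1 j
    · rw [if_pos hx]; linarith
    · rw [if_neg hx]
      push Not at hx
      unfold loopAt
      rw [switch_apply_eq g h1 h2, if_neg hx.1, if_neg hx.2.2.1, if_neg hx.2.1, if_neg hx.2.2.2]
      linarith
  obtain ⟨f1, f2, f3, f4⟩ := leaf_switch_self a h1 h2
  have hsum := Finset.sum_le_sum fun x (_ : x ∈ Finset.univ) => key x
  have hsuml := Finset.sum_le_sum fun x (_ : x ∈ Finset.univ) => keyl x
  rw [Finset.sum_add_distrib, Finset.sum_sub_distrib, sum_touched_ite h1 h2,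
    h.sum_comp_twin fun x => (halfStarAt a c τ g (τ x) * a ((switch g i j).1 x)) *
      (if x = i ∨ x = g.1 i ∨ x = j ∨ x = g.1 j then 1 else 0), sum_touched_ite h1 h2,
      f1, f2, f3, f4] at hsum
  rw [Finset.sum_sub_distrib, sum_touched_ite h1 h2, h.loopAt_partner, h.loopAt_partner] at hsuml
  rw [halfStarCount_eq, halfStarCount_eq]
  nlinarith

theorem HalfEdgeTypes.halfStarCount_nonneg (h : HalfEdgeTypes a c τ) (hκ : 0 ≤ κ) (g : Matching N) :
    0 ≤ halfStarCount κ a c τ g := by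
  rw [halfStarCount_eq]
  refine add_nonneg (Finset.sum_nonneg fun x _ => ?_)
    (mul_nonneg (by positivity) (Finset.sum_nonneg fun x _ => ?_))
  · rcases h.halfStarAt_zero_or_one g x with e | e <;> rw [e]; norm_num
  · rcases h.loopAt_zero_or_one g x with e | e <;> rw [e]; norm_num

/-- The case analysis of `touched_halfStars_le_two`: `p` and `q` are the losses on the two pairs,
the `w` mark half-stars at twins, the `y` are leaf indicators. A half-star at a twin on the first
pair forces `p` and its leaf indicators to vanish; if two twins there are completed, the second pair
consists of leaves and `q` vanishes too. -/
theorem touch_bound {p q w1 w3 y1 y2 y3 y4 w2 w4 : ℝ} (hp : p ≤ 1) (hq : q ≤ 1)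
    (hw1 : w1 = 0 ∨ w1 = 1) (hw3 : w3 = 0 ∨ w3 = 1) (hy2 : y2 = 0 ∨ y2 = 1) (hy4 : y4 = 0 ∨ y4 = 1)
    (k1 : w1 = 1 ∨ w3 = 1) (k2 : w1 = 1 ∨ w3 = 1 → p = 0 ∧ y1 = 0 ∧ y3 = 0)
    (k3 : y2 = 1 → y4 = 1 → q = 0) :
    p + q + (w1 * y4 + w3 * y2 + y3 * w2 + y1 * w4) ≤ 2 := by
  obtain ⟨rfl, rfl, rfl⟩ := k2 k1
  rcases hy2 with rfl | rfl
  · rcases hy4 with rfl | rfl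
    · linarith
    · rcases hw1 with rfl | rfl <;> linarith
  · rcases hy4 with rfl | rfl
    · rcases hw3 with rfl | rfl <;> linarith
    · rw [k3 rfl rfl]
      rcases hw1 with rfl | rfl <;> rcases hw3 with rfl | rfl <;> norm_num

theorem HalfEdgeTypes.pairHalfStar_le_one (h : HalfEdgeTypes a c τ) (hκ1 : κ ≤ 1) (g : Matching N)
    (x : Fin N) :
    halfStarAt a c τ g x + halfStarAt a c τ g (g.1 x) + κ * loopAt c τ g x ≤ 1 := by
  set z : Fin N → ℝ := halfStarAt a c τ g with hz
  set l : Fin N → ℝ := loopAt c τ g with hl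
  have c1 := h.halfStarAt_zero_or_one g x
  have c2 := h.halfStarAt_zero_or_one g (g.1 x)
  have c3 := h.loopAt_zero_or_one g x
  have d1 := h.halfStarAt_eq_one (g := g) (x := x)
  have d2 := h.halfStarAt_eq_one (g := g) (x := g.1 x)
  have d3 := h.loopAt_eq_one (g := g) (x := x)
  simp only [← hz, ← hl] at c1 c2 c3 d1 d2 d3
  rw [g.apply_apply] at d2
  rcases c1 with c1 | c1
  · rcases c2 with c2 | c2
    · rcases c3 with c3 | c3 <;> rw [c1, c2, c3] <;> linarith
    · rcases c3 with c3 | c3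
      · rw [c1, c2, c3]; linarith
      · exact absurd (d2 c2).2.2.1 (by rw [(d3 c3).2.2.1]; norm_num)
  · rcases c2 with c2 | c2
    · rcases c3 with c3 | c3
      · rw [c1, c2, c3]; linarith
      · exact absurd (d1 c1).2.2.1 (by rw [(d3 c3).2.2.2.1]; norm_num)
    · exact absurd (d1 c1).2.2.1 (by rw [(d2 c2).2.1]; norm_num)

/-- When the twin of `x` carries a half-star, `x` has degree two and its partner is neither a leaf
nor its twin, so the pair of `x` carries neither a half-star nor a loop. -/
theorem HalfEdgeTypes.pairHalfStar_eq_zero (h : HalfEdgeTypes a c τ) {x : Fin N}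
    (hx : halfStarAt a c τ g (τ x) = 1) :
    halfStarAt a c τ g x + halfStarAt a c τ g (g.1 x) + κ * loopAt c τ g x = 0 ∧
      a x = 0 ∧ a (g.1 x) = 0 := by
  set z : Fin N → ℝ := halfStarAt a c τ g with hz
  set l : Fin N → ℝ := loopAt c τ g with hl
  have c1 := h.halfStarAt_zero_or_one g x
  have c2 := h.halfStarAt_zero_or_one g (g.1 x)
  have c3 := h.loopAt_zero_or_one g x
  have d0 := h.halfStarAt_eq_one (g := g) (x := τ x) hx
  have d1 := h.halfStarAt_eq_one (g := g) (x := x)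
  have d2 := h.halfStarAt_eq_one (g := g) (x := g.1 x)
  have d3 := h.loopAt_eq_one (g := g) (x := x)
  simp only [← hz, ← hl] at c1 c2 c3 d0 d1 d2 d3
  rw [g.apply_apply] at d2
  rw [h.twin_twin, h.mid_twin] at d0
  have a0 := h.leaf_of_mid x d0.1
  have z1 : z x = 0 := c1.resolve_right fun e => by
    have := (d1 e).2.2.1; rw [d0.2.2.2.2] at this; norm_num at this
  have z2 : z (g.1 x) = 0 := c2.resolve_right fun e => by
    have := (d2 e).2.2.1; rw [a0] at this; norm_num at this
  have z3 : l x = 0 := c3.resolve_right fun e => by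
    have h1 := (d3 e).2.2.2.2
    have h2 := d0.2.2.1
    rw [← h1, g.apply_apply, a0] at h2
    norm_num at h2
  exact ⟨by rw [z1, z2, z3]; ring, a0, d0.2.2.2.2⟩

theorem HalfEdgeTypes.pairHalfStar_eq_zero_of_leaves (h : HalfEdgeTypes a c τ) {x : Fin N}
    (hx : a x = 1) (hx' : a (g.1 x) = 1) :
    halfStarAt a c τ g x + halfStarAt a c τ g (g.1 x) + κ * loopAt c τ g x = 0 := by
  set z : Fin N → ℝ := halfStarAt a c τ g with hz
  set l : Fin N → ℝ := loopAt c τ g with hl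
  have z1 : z x = 0 := (h.halfStarAt_zero_or_one g x).resolve_right fun e => by
    have := (h.halfStarAt_eq_one e).2.1; rw [hx] at this; norm_num at this
  have z2 : z (g.1 x) = 0 := (h.halfStarAt_zero_or_one g (g.1 x)).resolve_right fun e => by
    have := (h.halfStarAt_eq_one e).2.1; rw [hx'] at this; norm_num at this
  have z3 : l x = 0 := (h.loopAt_zero_or_one g x).resolve_right fun e => by
    have := (h.loopAt_eq_one e).2.2.1; rw [hx] at this; norm_num at this
  rw [z1, z2, z3]; ring

/-- The bound 2 on the possible loss makes its square at most twice the loss itself, so that the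
squared decrements sum to something linear in the half-star count. -/
theorem HalfEdgeTypes.touched_halfStars_le_two (h : HalfEdgeTypes a c τ) (hκ1 : κ ≤ 1)
    (g : Matching N) (i j : Fin N) :
    (halfStarAt a c τ g i + halfStarAt a c τ g (g.1 i) + κ * loopAt c τ g i) +
      (halfStarAt a c τ g j + halfStarAt a c τ g (g.1 j) + κ * loopAt c τ g j) +
      (halfStarAt a c τ g (τ i) * a (g.1 j) + halfStarAt a c τ g (τ (g.1 i)) * a j +
        a (g.1 i) * halfStarAt a c τ g (τ j) + a i * halfStarAt a c τ g (τ (g.1 j))) ≤ 2 := by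
  have s1 := h.pairHalfStar_le_one hκ1 g i
  have s2 := h.pairHalfStar_le_one hκ1 g j
  have t1 := h.pairHalfStar_eq_zero (g := g) (κ := κ) (x := i)
  have t2 := h.pairHalfStar_eq_zero (g := g) (κ := κ) (x := j)
  have t3 := h.pairHalfStar_eq_zero (g := g) (κ := κ) (x := g.1 i)
  have t4 := h.pairHalfStar_eq_zero (g := g) (κ := κ) (x := g.1 j)
  rw [g.apply_apply, h.loopAt_partner, add_comm (halfStarAt a c τ g (g.1 i))] at t3
  rw [g.apply_apply, h.loopAt_partner, add_comm (halfStarAt a c τ g (g.1 j))] at t4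
  have v1 := h.pairHalfStar_eq_zero_of_leaves (g := g) (κ := κ) (x := i)
  have v2 := h.pairHalfStar_eq_zero_of_leaves (g := g) (κ := κ) (x := j)
  have u1 := h.halfStarAt_zero_or_one g (τ i)
  have u2 := h.halfStarAt_zero_or_one g (τ j)
  have u3 := h.halfStarAt_zero_or_one g (τ (g.1 i))
  have u4 := h.halfStarAt_zero_or_one g (τ (g.1 j))
  have a1 := h.leaf_zero_or_one i
  have a2 := h.leaf_zero_or_one j
  have a3 := h.leaf_zero_or_one (g.1 i)
  have a4 := h.leaf_zero_or_one (g.1 j)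
  by_cases k1 : halfStarAt a c τ g (τ i) = 1 ∨ halfStarAt a c τ g (τ (g.1 i)) = 1
  · refine touch_bound s1 s2 u1 u3 a2 a4 k1 (fun k => ?_) v2
    rcases k with k | k
    · exact t1 k
    · exact ⟨(t3 k).1, (t3 k).2.2, (t3 k).2.1⟩
  · by_cases k2 : halfStarAt a c τ g (τ j) = 1 ∨ halfStarAt a c τ g (τ (g.1 j)) = 1
    · have := touch_bound (w2 := halfStarAt a c τ g (τ i)) (w4 := halfStarAt a c τ g (τ (g.1 i)))
        (y1 := a j) (y3 := a (g.1 j)) s2 s1 u2 u4 a1 a3 k2 (fun k => by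
          rcases k with k | k
          · exact t2 k
          · exact ⟨(t4 k).1, (t4 k).2.2, (t4 k).2.1⟩) v1
      linarith
    · push Not at k1 k2
      rw [u1.resolve_right k1.1, u2.resolve_right k2.1, u3.resolve_right k1.2,
        u4.resolve_right k2.2]
      linarith

theorem HalfEdgeTypes.down_halfStarCount_le (h : HalfEdgeTypes a c τ) (hκ : 0 ≤ κ) (hκ1 : κ ≤ 1) (g : Matching N) :
    down (halfStarCount κ a c τ) g ≤ 8 * (N + ∑ x, a x) * halfStarCount κ a c τ g := by
  set z : Fin N → ℝ := halfStarAt a c τ g with hz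
  set l : Fin N → ℝ := loopAt c τ g with hl
  have hb : ∀ i j, (max (halfStarCount κ a c τ g - halfStarCount κ a c τ (switch g i j)) 0) ^ 2 ≤
      2 * ((z i + z (g.1 i) + κ * l i) + (z j + z (g.1 j) + κ * l j)) +
      2 * (z (τ i) * a (g.1 j) + z (τ (g.1 i)) * a j + a (g.1 i) * z (τ j) +
        a i * z (τ (g.1 j))) := by
    intro i j
    have mono : ∀ x, 0 ≤ a x := fun x => by
      rcases h.leaf_zero_or_one x with e | e <;> rw [e]; norm_num
    have zn : ∀ x, 0 ≤ z x := fun x => by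
      rcases h.halfStarAt_zero_or_one g x with e | e <;> rw [hz, e]; norm_num
    have ln : ∀ x, 0 ≤ l x := fun x => by
      rcases h.loopAt_zero_or_one g x with e | e <;> rw [hl, e]; norm_num
    have hnn : 0 ≤ ((z i + z (g.1 i) + κ * l i) + (z j + z (g.1 j) + κ * l j)) +
      (z (τ i) * a (g.1 j) + z (τ (g.1 i)) * a j + a (g.1 i) * z (τ j) +
        a i * z (τ (g.1 j))) := by
      have := fun x => mul_nonneg hκ (ln x)
      have := fun x y => mul_nonneg (zn x) (mono y)
      have := fun x y => mul_nonneg (mono x) (zn y)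
      have := zn i; have := zn j; have := zn (g.1 i); have := zn (g.1 j)
      have : ∀ x y z u v w : ℝ, 0 ≤ x → 0 ≤ y → 0 ≤ z → 0 ≤ u → 0 ≤ v → 0 ≤ w →
        0 ≤ (x + y + z) + (u + v + w) := fun _ _ _ _ _ _ _ _ _ _ _ _ => by positivity
      refine add_nonneg (this _ _ _ _ _ _ ?_ ?_ ?_ ?_ ?_ ?_) (add_nonneg (add_nonneg
        (add_nonneg ?_ ?_) ?_) ?_) <;> solve_by_elim
    by_cases hij : j ≠ i ∧ j ≠ g.1 i
    · have hle := h.halfStarCount_sub_le hκ hij.1 hij.2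
      rw [← hz, ← hl] at hle
      have two := h.touched_halfStars_le_two hκ1 g i j
      rw [← hz, ← hl] at two
      have hpos := pow_le_pow_left₀ (le_max_right (halfStarCount κ a c τ g -
        halfStarCount κ a c τ (switch g i j)) 0) (max_le (hle.trans (le_of_eq (by ring))) hnn) 2
      refine hpos.trans ?_
      nlinarith
    · rw [switch_eq_self hij, sub_self, max_self]
      linarith
  refine (Finset.sum_le_sum fun i _ => Finset.sum_le_sum fun j _ => hb i j).trans ?_
  have e2 := sum_comp_partner g z
  have e3 := sum_comp_partner g a
  have e4 := h.sum_comp_twin z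
  have e5 := sum_comp_partner g fun x => z (τ x)
  have e6 : halfStarCount κ a c τ g = ∑ x, z x + κ / 2 * ∑ x, l x := rfl
  simp only [Finset.sum_add_distrib (f := fun j => 2 * (z _ + z _ + κ * l _ + (z j + _ + _))),
    ← Finset.mul_sum]
  rw [Finset.sum_add_distrib, ← Finset.mul_sum, ← Finset.mul_sum,
    sum_sum_add fun i => z i + z (g.1 i) + κ * l i]
  simp only [Finset.sum_add_distrib, ← Finset.mul_sum, ← Finset.sum_mul, e2, e3, e4, e5, e6]
  have hA : 0 ≤ ∑ x, a x := Finset.sum_nonneg fun x _ => by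
    rcases h.leaf_zero_or_one x with e | e <;> rw [e]; norm_num
  have hl0 : 0 ≤ κ * ∑ x, l x := mul_nonneg hκ (Finset.sum_nonneg fun x _ => by
    rcases h.loopAt_zero_or_one g x with e | e <;> rw [hl, e]; norm_num)
  nlinarith [mul_nonneg hA hl0]

end HalfStars

/-! ### Exact mean changes of the counts -/

section ExactIncrements

variable {N : ℕ} {a c : Fin N → ℝ} {τ : Fin N → Fin N} {g : Matching N} {i j : Fin N}

theorem sum_edgeCount_sub_switch (a : Fin N → ℝ) (g : Matching N) (b : Fin N) :
    ∑ t, (edgeCount a g - edgeCount a (switch g b t)) =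
      N * (a b * a (g.1 b)) - (∑ x, a x) * (a b + a (g.1 b)) + 2 * edgeCount a g +
        (a b - a (g.1 b)) ^ 2 := by
  have e : ∀ t, (a b - a t) * (a (g.1 b) - a (g.1 t)) =
      a b * a (g.1 b) - a b * a (g.1 t) - a (g.1 b) * a t + a t * a (g.1 t) := fun t => by ring
  rw [Finset.sum_congr rfl fun t _ => edgeCount_sub_switch' a g b t]
  simp only [Finset.sum_add_distrib, Finset.sum_ite_eq', Finset.mem_univ,
    if_true, e, Finset.sum_sub_distrib, ← Finset.mul_sum, sum_comp_partner, Finset.sum_const,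
    Finset.card_univ, Fintype.card_fin, nsmul_eq_mul, edgeCount]
  ring

/-- A discrete product rule: the mixed terms of the product at `x` cancel after exchanging `x` with
its twin. Only half-edges whose partner changes its leaf indicator contribute. -/
theorem HalfEdgeTypes.starCount_switch_sub (h : HalfEdgeTypes a c τ) (g g' : Matching N) :
    2 * (starCount a c τ g' - starCount a c τ g) =
      ∑ x, c x * (a (g'.1 x) - a (g.1 x)) * (a (g.1 (τ x)) + a (g'.1 (τ x))) := by
  have e := h.sum_comp_twin fun x => c x * a (g'.1 x) * a (g.1 (τ x))
  simp only [h.mid_twin, h.twin_twin] at e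
  have e1 : ∀ x, c x * (a (g'.1 x) - a (g.1 x)) * (a (g.1 (τ x)) + a (g'.1 (τ x))) =
      c x * a (g'.1 x) * a (g'.1 (τ x)) - c x * a (g.1 x) * a (g.1 (τ x)) +
      (c x * a (g'.1 x) * a (g.1 (τ x)) - c x * a (g'.1 (τ x)) * a (g.1 x)) := fun x => by ring
  simp only [e1, Finset.sum_add_distrib, Finset.sum_sub_distrib, e, sub_self, starCount]
  ring

theorem HalfEdgeTypes.starCount_switch_sub_touched (h : HalfEdgeTypes a c τ) (h1 : j ≠ i)
    (h2 : j ≠ g.1 i) :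
    2 * (starCount a c τ (switch g i j) - starCount a c τ g) =
      c i * (a (g.1 j) - a (g.1 i)) * (a (g.1 (τ i)) + a ((switch g i j).1 (τ i))) +
      c (g.1 i) * (a j - a i) * (a (g.1 (τ (g.1 i))) + a ((switch g i j).1 (τ (g.1 i)))) +
      (c j * (a (g.1 i) - a (g.1 j)) * (a (g.1 (τ j)) + a ((switch g i j).1 (τ j))) +
      c (g.1 j) * (a i - a j) * (a (g.1 (τ (g.1 j))) + a ((switch g i j).1 (τ (g.1 j))))) := by
  rw [h.starCount_switch_sub, sum_touched h1 h2]
  · obtain ⟨f1, f2, f3, f4⟩ := leaf_switch_self a h1 h2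
    rw [f1, f2, f3, f4, g.apply_apply, g.apply_apply]
  · intro x h3 h4 h5 h6
    rw [leaf_switch_eq a h1 h2 (by tauto), sub_self]
    ring

theorem HalfEdgeTypes.mid_of_leaf (h : HalfEdgeTypes a c τ) {x : Fin N} (hx : a x = 1) : c x = 0 :=
  (h.mid_zero_or_one x).resolve_right fun e => by
    have := h.leaf_of_mid x e
    rw [hx] at this
    norm_num at this

theorem HalfEdgeTypes.ne_of_mid_leaf (h : HalfEdgeTypes a c τ) {x y : Fin N} (hx : c x = 1)
    (hy : a y = 1) : x ≠ y := by
  rintro rfl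
  rw [h.mid_of_leaf hy] at hx
  norm_num at hx

/-- Breaking an isolated edge gives a leaf to each half-edge of the other pair. A half-star whose
free half-edge is `t` or `g t` becomes a 2-star, and so does a loop at a vertex of degree two;
nothing is lost. This is why loops enter `halfStarCount` with weight 1 here. -/
theorem HalfEdgeTypes.starCount_sub_switch_edge (h : HalfEdgeTypes a c τ) (h3 : a i = 1)
    (h4 : a (g.1 i) = 1) (t : Fin N) :
    starCount a c τ g - starCount a c τ (switch g i t) =
      -(halfStarAt a c τ g (τ t) + halfStarAt a c τ g (τ (g.1 t)) + loopAt c τ g t) := by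
  have c3 := h.mid_of_leaf h3
  have c4 := h.mid_of_leaf h4
  have term : ∀ y, y ≠ i → y ≠ g.1 i →
      c y * (1 - a (g.1 y)) * (a (g.1 (τ y)) + a ((switch g i y).1 (τ y))) =
      2 * halfStarAt a c τ g (τ y) + loopAt c τ g y := by
    intro y h1 h2
    unfold halfStarAt loopAt
    rw [h.mid_twin, h.twin_twin]
    rcases h.mid_zero_or_one y with e | e
    · rw [e]; ring
    · have ay := h.leaf_of_mid y e
      have e' : c (τ y) = 1 := by rw [h.mid_twin, e]
      rw [leaf_switch a h1 h2, if_neg (h.ne_of_mid_leaf e' h3), if_neg (h.twin_ne y e),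
        if_neg (h.ne_of_mid_leaf e' h4), e]
      by_cases hl : g.1 y = τ y
      · rw [if_pos hl.symm, if_pos hl, h3, ← hl, g.apply_apply, ay,
          hl, h.leaf_of_mid _ e']
        ring
      · rw [if_neg (Ne.symm hl), if_neg hl]
        ring
  by_cases hij : t ≠ i ∧ t ≠ g.1 i
  · have e := h.starCount_switch_sub_touched hij.1 hij.2
    have t1 := term t hij.1 hij.2
    have hg1 : g.1 t ≠ i := fun e => hij.2 (by rw [← e, g.apply_apply])
    have hg2 : g.1 t ≠ g.1 i := fun e => hij.1 (g.injective e)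
    have t2 := term (g.1 t) hg1 hg2
    rw [g.apply_apply, h.loopAt_partner] at t2
    have esw : switch g i (g.1 t) = switch g (g.1 i) t := by
      rw [← switch_partner_partner g i, g.apply_apply]
    have hsw : a ((switch g i (g.1 t)).1 (τ (g.1 t))) =
        a ((switch g i t).1 (τ (g.1 t))) ∨ c (g.1 t) = 0 := by
      rcases h.mid_zero_or_one (g.1 t) with e | e
      · exact Or.inr e
      · left
        have e' : c (τ (g.1 t)) = 1 := by rw [h.mid_twin, e]
        have at' := h.leaf_of_mid _ e
        rw [leaf_switch a hg1 hg2, leaf_switch a hij.1 hij.2, if_neg (h.ne_of_mid_leaf e' h3),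
          if_neg (h.ne_of_mid_leaf e' h3), if_neg (h.twin_ne _ e), if_neg (h.ne_of_mid_leaf e' h4),
          if_neg (h.ne_of_mid_leaf e' h4), g.apply_apply, if_neg (h.twin_ne _ e), h3, h4]
    rw [h3, h4, c3, c4] at e
    have t3 : c (g.1 t) * (1 - a t) *
        (a (g.1 (τ (g.1 t))) + a ((switch g i t).1 (τ (g.1 t)))) =
        2 * halfStarAt a c τ g (τ (g.1 t)) + loopAt c τ g t := by
      rw [← t2]
      rcases hsw with e | e
      · rw [e]
      · rw [e]; ring
    linarith
  · rw [switch_eq_self hij, sub_self]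
    have hz : ∀ x, c x = 0 → halfStarAt a c τ g (τ x) = 0 ∧ loopAt c τ g x = 0 := by
      intro x hx
      unfold halfStarAt loopAt
      rw [h.mid_twin, hx]
      norm_num
    by_cases e1 : t = i
    · rw [e1, (hz i c3).1, (hz i c3).2, (hz _ c4).1]; norm_num
    · have e2 : t = g.1 i := by tauto
      rw [e2, g.apply_apply, (hz i c3).1, (hz _ c4).2, (hz _ c4).1]; norm_num

theorem HalfEdgeTypes.sum_starCount_sub_switch_edge (h : HalfEdgeTypes a c τ) (h3 : a i = 1)
    (h4 : a (g.1 i) = 1) :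
    ∑ t, (starCount a c τ g - starCount a c τ (switch g i t)) = -2 * halfStarCount 1 a c τ g := by
  have e2 := h.sum_comp_twin fun x => halfStarAt a c τ g x
  have e3 := sum_comp_partner g fun x => halfStarAt a c τ g (τ x)
  simp only [h.starCount_sub_switch_edge h3 h4, Finset.sum_neg_distrib, Finset.sum_add_distrib,
    halfStarCount_eq, e3, e2]
  ring

/-- In the generic case `u` receives `g t` and `t` receives the leaf. If `g t` is not a leaf, a star
at `u` is lost, and one may be gained at `t`; if `t` is a leaf, a star centred at `g t` may be lost.
The last three terms correct for `t` in the pair of the twin of `u` and for `t = g u`. -/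
theorem HalfEdgeTypes.starCount_sub_switch_mid (h : HalfEdgeTypes a c τ) {u : Fin N} (hu : c u = 1)
    (hs : a (g.1 u) = 1) (t : Fin N) :
    starCount a c τ g - starCount a c τ (switch g u t) =
      (1 - a (g.1 t)) * (a (g.1 (τ u)) - c t * a (g.1 (τ t))) +
      a t * (c (g.1 t) * a (g.1 (τ (g.1 t)))) +
      (if t = τ u then 1 - a (g.1 (τ u)) else 0) - (if t = g.1 (τ u) then a (g.1 (τ u)) else 0) -
      (if t = g.1 u then 2 * a (g.1 (τ u)) else 0) := by
  have au := h.leaf_of_mid u hu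
  have hτu : c (τ u) = 1 := by rw [h.mid_twin, hu]
  have aτ := h.leaf_of_mid _ hτu
  have cs := h.mid_of_leaf hs
  have n1 : τ u ≠ u := h.twin_ne u hu
  have n2 : u ≠ g.1 u := h.ne_of_mid_leaf hu hs
  have n3 : τ u ≠ g.1 u := h.ne_of_mid_leaf hτu hs
  have n4 : u ≠ g.1 (τ u) := fun e => n3 (g.apply_eq_iff.1 e.symm)
  have n6 : g.1 u ≠ g.1 (τ u) := fun e => n1 (g.injective e).symm
  have tt := h.twin_twin
  by_cases hij : t ≠ u ∧ t ≠ g.1 u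
  · have e := h.starCount_switch_sub_touched hij.1 hij.2
    have hq := h.leaf_zero_or_one (g.1 (τ u))
    have nt : g.1 t ≠ g.1 u := fun e => hij.1 (g.injective e)
    have p1 : a ((switch g u t).1 (τ u)) = if t = τ u then 1 else
        if t = g.1 (τ u) then 0 else a (g.1 (τ u)) := by
      rw [leaf_switch a hij.1 hij.2, if_neg n1, if_neg n3, hs, au]
      have : (τ u = g.1 t) ↔ t = g.1 (τ u) := by rw [eq_comm, g.apply_eq_iff]
      simp only [eq_comm (a := τ u) (b := t), this]
    have p2 : c t = 1 → a ((switch g u t).1 (τ t)) =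
        if t = τ u then a (g.1 t) else a (g.1 (τ t)) := by
      intro ct
      have ct' : c (τ t) = 1 := by rw [h.mid_twin, ct]
      rw [leaf_switch a hij.1 hij.2, if_neg (h.twin_ne t ct), if_neg (h.ne_of_mid_leaf ct' hs), au]
      have : (τ t = u) ↔ t = τ u := ⟨fun e => by rw [← e, tt], fun e => by rw [e, tt]⟩
      simp only [this]
      refine if_congr Iff.rfl rfl ?_
      split_ifs with e
      · rw [e, g.apply_apply, h.leaf_of_mid t ct]
      · rfl
    have p3 : c (g.1 t) = 1 → a t = 1 → a ((switch g u t).1 (τ (g.1 t))) =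
        if t = g.1 (τ u) then a (g.1 t) else a (g.1 (τ (g.1 t))) := by
      intro ct at'
      have ct' : c (τ (g.1 t)) = 1 := by rw [h.mid_twin, ct]
      rw [leaf_switch a hij.1 hij.2, if_neg (h.ne_of_mid_leaf ct' at'),
        if_neg (h.ne_of_mid_leaf ct' hs), if_neg (h.twin_ne _ ct)]
      have : (τ (g.1 t) = u) ↔ t = g.1 (τ u) := by
        rw [← g.apply_eq_iff]
        exact ⟨fun e => by rw [← e, tt], fun e => by rw [e, tt]⟩
      simp only [this]
    rw [p1, hs, hu, cs, au] at e
    rw [if_neg hij.2]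
    by_cases e1 : t = τ u
    · subst e1
      have : ¬ (τ u = g.1 (τ u)) := (g.apply_ne _).symm
      rw [p2 hτu, aτ, if_pos rfl, if_pos rfl, hτu, tt, hs] at e
      rw [if_pos rfl, if_neg this, aτ, hτu, tt, hs]
      rcases hq with hq | hq <;> rw [hq] at e ⊢ <;> linarith
    · rw [if_neg e1] at e p2 ⊢
      by_cases e2 : t = g.1 (τ u)
      · rw [if_pos e2] at e p3 ⊢
        have gt : g.1 t = τ u := by rw [e2, g.apply_apply]
        rw [gt] at e p3 ⊢
        simp only [aτ, hτu, tt, hs, true_implies] at e p3 ⊢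
        subst e2
        rcases hq with hq | hq
        · rcases h.mid_zero_or_one (g.1 (τ u)) with ct | ct
          · rw [hq, ct] at e ⊢; linarith
          · rw [p2 ct, hq, ct] at e; rw [hq, ct]; linarith
        · rw [p3 hq, h.mid_of_leaf hq, hq] at e
          rw [h.mid_of_leaf hq, hq]; linarith
      · rw [if_neg e2] at e p3 ⊢
        have r2 : c t * a ((switch g u t).1 (τ t)) = c t * a (g.1 (τ t)) := by
          rcases h.mid_zero_or_one t with ct | ct
          · rw [ct, zero_mul, zero_mul]
          · rw [p2 ct]
        have r3 : c (g.1 t) * a t * a ((switch g u t).1 (τ (g.1 t))) =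
            c (g.1 t) * a t * a (g.1 (τ (g.1 t))) := by
          rcases h.mid_zero_or_one (g.1 t) with ct | ct
          · rw [ct]; ring
          · rcases h.leaf_zero_or_one t with at' | at'
            · rw [at']; ring
            · rw [p3 ct at']
        linear_combination (-1 / 2) * e - (1 - a (g.1 t)) / 2 * r2 + 1 / 2 * r3
  · rw [switch_eq_self hij, sub_self]
    by_cases e1 : t = u
    · subst e1
      rw [hs, au, if_neg n1.symm, if_neg n4, if_neg n2]
      ring
    · have e2 : t = g.1 u := by tauto
      rw [e2, g.apply_apply, au, hs, cs, hu, if_neg n3.symm, if_neg n6, if_pos rfl]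
      ring

theorem HalfEdgeTypes.sum_starCount_sub_switch_mid (h : HalfEdgeTypes a c τ) {u : Fin N}
    (hu : c u = 1) (hs : a (g.1 u) = 1) :
    ∑ t, (starCount a c τ g - starCount a c τ (switch g u t)) =
      a (g.1 (τ u)) * (N - ∑ x, a x - 4) + 2 * starCount a c τ g - halfStarCount 0 a c τ g + 1 := by
  have e1 : ∀ t, (1 - a (g.1 t)) * (a (g.1 (τ u)) - c t * a (g.1 (τ t))) =
      a (g.1 (τ u)) - a (g.1 (τ u)) * a (g.1 t) - halfStarAt a c τ g (τ t) := fun t => by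
    unfold halfStarAt
    rw [h.mid_twin, h.twin_twin]
    ring
  have e2 := h.sum_comp_twin fun x => halfStarAt a c τ g x
  have e3 : ∑ t, a t * (c (g.1 t) * a (g.1 (τ (g.1 t)))) = 2 * starCount a c τ g := by
    rw [← sum_comp_partner g]
    simp only [g.apply_apply, starCount]
    rw [mul_div_cancel₀ _ (by norm_num)]
    exact Finset.sum_congr rfl fun x _ => by ring
  simp only [h.starCount_sub_switch_mid hu hs, Finset.sum_sub_distrib, Finset.sum_add_distrib, e1,
    e2, e3, Finset.sum_ite_eq', Finset.mem_univ, if_true, ← Finset.mul_sum, sum_comp_partner,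
    Finset.sum_const, Finset.card_univ, Fintype.card_fin, nsmul_eq_mul, halfStarCount_eq]
  ring

/-- The number of half-edges of degree two that are matched to half-edges of degree one. -/
def mixedCount (a c : Fin N → ℝ) (g : Matching N) : ℝ := ∑ x, c x * a (g.1 x)

/-- It lets 2S − Z be rewritten as 4S minus `mixedCount`, whose change under a switching involves no
twins. -/
theorem mixedCount_eq (a c : Fin N → ℝ) (τ : Fin N → Fin N) (g : Matching N) :
    mixedCount a c g = halfStarCount 0 a c τ g + 2 * starCount a c τ g := by
  have : ∀ x, c x * a (g.1 x) = halfStarAt a c τ g x + c x * a (g.1 x) * a (g.1 (τ x)) :=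
    fun x => by unfold halfStarAt; ring
  simp only [mixedCount, starCount, halfStarCount_eq]
  rw [Finset.sum_congr rfl fun x _ => this x, Finset.sum_add_distrib]
  ring

theorem HalfEdgeTypes.mixedCount_sub_switch_mid (h : HalfEdgeTypes a c τ) {u : Fin N} (hu : c u = 1)
    (hs : a (g.1 u) = 1) (t : Fin N) :
    mixedCount a c g - mixedCount a c (switch g u t) =
      (1 - a (g.1 t)) * (1 - c t) + a t * c (g.1 t) - if t = g.1 u then 2 else 0 := by
  have au := h.leaf_of_mid u hu
  have cs := h.mid_of_leaf hs
  by_cases hij : t ≠ u ∧ t ≠ g.1 u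
  · rw [if_neg hij.2, mixedCount, mixedCount, ← Finset.sum_sub_distrib, sum_touched hij.1 hij.2]
    · obtain ⟨f1, f2, f3, f4⟩ := leaf_switch_self a hij.1 hij.2
      rw [f1, f2, f3, f4, g.apply_apply, g.apply_apply, hu, cs, au, hs]
      ring
    · intro x h3 h4 h5 h6
      rw [leaf_switch_eq a hij.1 hij.2 (by tauto), sub_self]
  · rw [switch_eq_self hij, sub_self]
    have n2 : u ≠ g.1 u := h.ne_of_mid_leaf hu hs
    by_cases e1 : t = u
    · subst e1
      rw [hs, au, if_neg n2]
      ring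
    · have e2 : t = g.1 u := by tauto
      rw [e2, g.apply_apply, au, hs, cs, hu, if_pos rfl]
      ring

section StarResampling

variable {u : Fin N}

/-- The half-edges other than three of the four half-edges of a 2-star. -/
def starChoice (τ : Fin N → Fin N) (g : Matching N) (u : Fin N) : Finset (Fin N) :=
  Finset.univ \ {g.1 u, g.1 (τ u), τ u}

theorem HalfEdgeTypes.sum_starChoice (h : HalfEdgeTypes a c τ) (hu : c u = 1) (hs : a (g.1 u) = 1)
    (hw : a (g.1 (τ u)) = 1) (φ : Fin N → ℝ) :
    ∑ t ∈ starChoice τ g u, φ t = ∑ t, φ t - (φ (g.1 u) + φ (g.1 (τ u)) + φ (τ u)) := by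
  have hτu : c (τ u) = 1 := by rw [h.mid_twin, hu]
  have n1 : g.1 u ≠ g.1 (τ u) := fun e => h.twin_ne u hu (g.injective e).symm
  have n2 : g.1 u ≠ τ u := (h.ne_of_mid_leaf hτu hs).symm
  have n3 : g.1 (τ u) ≠ τ u := (h.ne_of_mid_leaf hτu hw).symm
  have := Finset.sum_sdiff (Finset.subset_univ {g.1 u, g.1 (τ u), τ u}) (f := φ)
  rw [Finset.sum_insert (by simp [n1, n2]), Finset.sum_insert (by simp [n3]),
    Finset.sum_singleton] at this
  rw [starChoice]
  linarith

theorem HalfEdgeTypes.switch_starChoice (h : HalfEdgeTypes a c τ) (hu : c u = 1)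
    (hs : a (g.1 u) = 1) {t : Fin N} (ht : t ∈ starChoice τ g u) :
    (switch g u t).1 (τ u) = g.1 (τ u) ∧ a ((switch g u t).1 u) = a (g.1 t) := by
  have hτu : c (τ u) = 1 := by rw [h.mid_twin, hu]
  simp only [starChoice, Finset.mem_sdiff, Finset.mem_univ, true_and, Finset.mem_insert,
    Finset.mem_singleton, not_or] at ht
  by_cases e : t = u
  · rw [e, switch_self]; exact ⟨rfl, rfl⟩
  · refine ⟨?_, (leaf_switch_self a e ht.1).1⟩
    rw [switch_apply_eq g e ht.1, if_neg (h.twin_ne u hu), if_neg (Ne.symm ht.2.2),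
      if_neg (h.ne_of_mid_leaf hτu hs), if_neg]
    intro e'
    exact ht.2.1 (by rw [e', g.apply_apply])

/-- The first switching has N − 3 choices and the second N − 1, hence the weight N − 1 on the first
change. The inner sum may run over all `t'`, since the excluded partner of τ u gives no change. -/
theorem HalfEdgeTypes.sum_edgeCount_resample_star (h : HalfEdgeTypes a c τ) (hu : c u = 1)
    (hs : a (g.1 u) = 1) (hw : a (g.1 (τ u)) = 1) :
    ∑ t ∈ starChoice τ g u, (((N : ℝ) - 1) * (edgeCount a g - edgeCount a (switch g u t)) +
      ∑ t', (edgeCount a (switch g u t) - edgeCount a (switch (switch g u t) (τ u) t'))) =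
      ((N : ℝ) - 3) * (4 * edgeCount a g - 2 * ∑ x, a x + 3) := by
  have hτu : c (τ u) = 1 := by rw [h.mid_twin, hu]
  have au := h.leaf_of_mid u hu
  have aτ := h.leaf_of_mid _ hτu
  have e1 : ∀ t ∈ starChoice τ g u,
      ((N : ℝ) - 1) * (edgeCount a g - edgeCount a (switch g u t)) +
      ∑ t', (edgeCount a (switch g u t) - edgeCount a (switch (switch g u t) (τ u) t')) =
      ((N : ℝ) - 3) * (edgeCount a g - edgeCount a (switch g u t)) +
        (2 * edgeCount a g - ∑ x, a x + 1) := by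
    intro t ht
    rw [sum_edgeCount_sub_switch, (h.switch_starChoice hu hs ht).1, aτ, hw]
    ring
  have hcard := h.sum_starChoice hu hs hw fun _ => (1 : ℝ)
  simp only [Finset.sum_const, Finset.card_univ, Fintype.card_fin, nsmul_eq_mul, mul_one] at hcard
  rw [Finset.sum_congr rfl e1, Finset.sum_add_distrib, ← Finset.mul_sum, Finset.sum_const,
    nsmul_eq_mul, hcard, h.sum_starChoice hu hs hw, sum_edgeCount_sub_switch,
    edgeCount_sub_switch', edgeCount_sub_switch', edgeCount_sub_switch', g.apply_apply,
    g.apply_apply, if_pos rfl, if_neg, if_neg (h.ne_of_mid_leaf hτu hs), au, aτ, hs, hw]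
  · ring
  · exact fun e => h.twin_ne u hu (g.injective e)

theorem HalfEdgeTypes.sum_starCount_resample_star (h : HalfEdgeTypes a c τ) (hu : c u = 1)
    (hs : a (g.1 u) = 1) (hw : a (g.1 (τ u)) = 1) :
    ∑ t ∈ starChoice τ g u, (((N : ℝ) - 1) * (starCount a c τ g - starCount a c τ (switch g u t)) +
      ∑ t', (starCount a c τ (switch g u t) -
        starCount a c τ (switch (switch g u t) (τ u) t'))) =
      ((N : ℝ) - 1) * ((N : ℝ) - 3) + (2 - (∑ x, a x) * (∑ x, a x - 1) - ∑ x, c x) +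
        4 * ((N : ℝ) - 3) * (starCount a c τ g - 1) -
        (2 * (N : ℝ) - 10) * halfStarCount 0 a c τ g := by
  have hτu : c (τ u) = 1 := by rw [h.mid_twin, hu]
  have au := h.leaf_of_mid u hu
  have aτ := h.leaf_of_mid _ hτu
  have cs := h.mid_of_leaf hs
  have cw := h.mid_of_leaf hw
  have n1 : τ u ≠ u := h.twin_ne u hu
  have n3 : τ u ≠ g.1 u := h.ne_of_mid_leaf hτu hs
  have n6 : g.1 u ≠ g.1 (τ u) := fun e => n1 (g.injective e).symm
  have n7 : τ u ≠ g.1 (τ u) := (g.apply_ne _).symm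
  -- The mean change in the second switching is affine in the star count and the mixed count after
  -- the first. Expressing these through their changes in the first switching leaves only
  -- single-switching sums.
  have e1 : ∀ t ∈ starChoice τ g u,
      ((N : ℝ) - 1) * (starCount a c τ g - starCount a c τ (switch g u t)) +
      ∑ t', (starCount a c τ (switch g u t) - starCount a c τ (switch (switch g u t) (τ u) t')) =
      ((N : ℝ) - 5) * (starCount a c τ g - starCount a c τ (switch g u t)) +
        (mixedCount a c g - mixedCount a c (switch g u t)) +
        ((N - ∑ x, a x - 4) * a (g.1 t) + (4 * starCount a c τ g - mixedCount a c g + 1)) := by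
    intro t ht
    obtain ⟨f1, f2⟩ := h.switch_starChoice hu hs ht
    rw [h.sum_starCount_sub_switch_mid hτu (by rw [f1, hw]), h.twin_twin, f2,
      mixedCount_eq a c τ, mixedCount_eq a c τ]
    ring
  have hcard := h.sum_starChoice hu hs hw fun _ => (1 : ℝ)
  simp only [Finset.sum_const, Finset.card_univ, Fintype.card_fin, nsmul_eq_mul, mul_one] at hcard
  have hS := h.sum_starChoice hu hs hw fun t => starCount a c τ g - starCount a c τ (switch g u t)
  rw [h.sum_starCount_sub_switch_mid hu hs, h.starCount_sub_switch_mid hu hs,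
    h.starCount_sub_switch_mid hu hs, h.starCount_sub_switch_mid hu hs] at hS
  simp only [g.apply_apply, hs, hw, au, aτ, hu, hτu, cs, cw, h.twin_twin, if_neg n3.symm, if_neg n6,
    if_neg n3, if_neg n7, if_neg n6.symm, if_neg n7.symm, if_true] at hS
  have hKs : ∑ t, (mixedCount a c g - mixedCount a c (switch g u t)) =
      N - ∑ x, a x - ∑ x, c x + 2 * mixedCount a c g - 2 := by
    have e2 : ∀ t, (1 - a (g.1 t)) * (1 - c t) = 1 - a (g.1 t) - c t + c t * a (g.1 t) :=
      fun t => by ring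
    have e3 : ∑ t, a t * c (g.1 t) = mixedCount a c g := by
      rw [← sum_comp_partner g]
      simp only [g.apply_apply, mixedCount]
      exact Finset.sum_congr rfl fun x _ => mul_comm _ _
    rw [Finset.sum_congr rfl fun t _ => h.mixedCount_sub_switch_mid hu hs t]
    simp only [Finset.sum_sub_distrib, Finset.sum_add_distrib, e2, e3, Finset.sum_ite_eq',
      Finset.mem_univ, if_true, sum_comp_partner, Finset.sum_const, Finset.card_univ,
      Fintype.card_fin, nsmul_eq_mul]
    simp only [mixedCount]
    ring
  have hK := h.sum_starChoice hu hs hw fun t => mixedCount a c g - mixedCount a c (switch g u t)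
  rw [hKs, h.mixedCount_sub_switch_mid hu hs, h.mixedCount_sub_switch_mid hu hs,
    h.mixedCount_sub_switch_mid hu hs] at hK
  simp only [g.apply_apply, hs, hw, au, aτ, hu, hτu, cs, cw,
    if_neg n3, if_neg n6.symm, if_true] at hK
  have hA := h.sum_starChoice hu hs hw fun t => a (g.1 t)
  rw [sum_comp_partner, g.apply_apply, g.apply_apply, au, aτ, hw] at hA
  rw [Finset.sum_congr rfl e1, Finset.sum_add_distrib, Finset.sum_add_distrib,
    Finset.sum_add_distrib, ← Finset.mul_sum, ← Finset.mul_sum, Finset.sum_const, nsmul_eq_mul,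
    hcard, hS, hK, hA, mixedCount_eq a c τ]
  ring

end StarResampling

end ExactIncrements

/-! ### Means of products of counts -/

section Moments

variable {N : ℕ} {a c : Fin N → ℝ} {τ : Fin N → Fin N}

/-- The product `(N - 1) (N - 3) ⋯ (N - 2 k + 1)`. -/
def oddFall (N k : ℕ) : ℝ := ∏ i ∈ Finset.range k, ((N : ℝ) - 1 - 2 * i)

theorem oddFall_pos {N k : ℕ} (h : 2 * k ≤ N) : 0 < oddFall N k := by
  refine Finset.prod_pos fun i hi => ?_
  have : i + 1 ≤ k := Finset.mem_range.1 hi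
  have : (2 * (i + 1) : ℝ) ≤ N := by exact_mod_cast (by omega)
  linarith

theorem avg_ind_le_inv (α : Finset (Sym2 (Fin N))) (h : 2 * α.card ≤ N) :
    avg (fun g => ind g α) ≤ 1 / oddFall N α.card := by
  rw [le_div_iff₀ (oddFall_pos h)]
  exact avg_ind_le α h

theorem HalfEdgeTypes.leaf_nonneg (h : HalfEdgeTypes a c τ) (x : Fin N) : 0 ≤ a x := by
  rcases h.leaf_zero_or_one x with e | e <;> rw [e]; norm_num

theorem HalfEdgeTypes.leaf_le_one (h : HalfEdgeTypes a c τ) (x : Fin N) : a x ≤ 1 := by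
  rcases h.leaf_zero_or_one x with e | e <;> rw [e]; norm_num

theorem HalfEdgeTypes.mid_nonneg (h : HalfEdgeTypes a c τ) (x : Fin N) : 0 ≤ c x := by
  rcases h.mid_zero_or_one x with e | e <;> rw [e]; norm_num

theorem HalfEdgeTypes.sum_leaf_nonneg (h : HalfEdgeTypes a c τ) : 0 ≤ ∑ x, a x :=
  Finset.sum_nonneg fun x _ => h.leaf_nonneg x

theorem HalfEdgeTypes.sum_mid_nonneg (h : HalfEdgeTypes a c τ) : 0 ≤ ∑ x, c x :=
  Finset.sum_nonneg fun x _ => h.mid_nonneg x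

theorem ind_union {α β : Finset (Sym2 (Fin N))} (g : Matching N) [DecidableEq (Sym2 (Fin N))] :
    ind g (α ∪ β) = ind g α * ind g β := by
  unfold ind
  simp only [Finset.union_subset_iff]
  by_cases h1 : α ⊆ g.pairs <;> by_cases h2 : β ⊆ g.pairs <;> simp [h1, h2]

theorem ind_singleton (g : Matching N) (x y : Fin N) :
    ind g {s(x, y)} = if g.1 x = y then 1 else 0 := by
  unfold ind
  simp only [Finset.singleton_subset_iff, Matching.mem_pairs]

theorem ind_image {k : ℕ} [DecidableEq (Sym2 (Fin N))] (g : Matching N) (u f : Fin k → Fin N) :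
    ind g (Finset.univ.image fun i => s(u i, f i)) = ∏ i, if g.1 (u i) = f i then (1 : ℝ) else 0 := by
  rw [Finset.prod_ite_zero, Finset.prod_const_one]
  have h : (Finset.univ.image fun i => s(u i, f i)) ⊆ g.pairs ↔
      ∀ i ∈ Finset.univ, g.1 (u i) = f i := by
    simp [Finset.subset_iff, Matching.mem_pairs]
  unfold ind
  by_cases hp : ∀ i ∈ Finset.univ, g.1 (u i) = f i
  · rw [if_pos hp, if_pos (h.2 hp)]
  · rw [if_neg hp, if_neg (fun h' => hp (h.1 h'))]

/-- The probability that the pairs of `β` are matched and `k` given half-edges of degree two are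
matched to half-edges of degree one. -/
theorem HalfEdgeTypes.avg_ind_mul_prod_le (h : HalfEdgeTypes a c τ) {k : ℕ} (u : Fin k → Fin N)
    (hu : Function.Injective u) (hc : ∀ i, c (u i) = 1) (β : Finset (Sym2 (Fin N)))
    (hβ : ∀ i, u i ∉ support β) (hN : 2 * (β.card + k) ≤ N) :
    avg (fun g => ind g β * ∏ i, a (g.1 (u i))) ≤ (∑ x, a x) ^ k / oddFall N (β.card + k) := by
  classical
  have hW := oddFall_pos hN
  -- Expand over the half-edges to which the given ones are matched. Each of the A^k choices of
  -- leaves prescribes k distinct further pairs; if a leaf is repeated, the event is impossible and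
  -- the bound still holds.
  have e1 : ∀ g : Matching N, ind g β * ∏ i, a (g.1 (u i)) = ∑ f : Fin k → Fin N,
      (∏ i, a (f i)) * ind g (β ∪ Finset.univ.image fun i => s(u i, f i)) := by
    intro g
    have : ∀ i, a (g.1 (u i)) = ∑ y, a y * if g.1 (u i) = y then 1 else 0 := fun i => by simp
    simp only [this]
    rw [Finset.prod_univ_sum, Fintype.piFinset_univ, Finset.mul_sum]
    refine Finset.sum_congr rfl fun f _ => ?_
    rw [Finset.prod_mul_distrib, ind_union, ind_image]
    ring
  have e2 : (∑ x, a x) ^ k = ∑ f : Fin k → Fin N, ∏ i, a (f i) := by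
    rw [← Fintype.piFinset_univ, ← Finset.prod_univ_sum]
    simp
  simp only [e1]
  rw [avg_sum, e2, Finset.sum_div]
  refine Finset.sum_le_sum fun f _ => ?_
  rw [avg_const_mul]
  by_cases hf : ∀ i, a (f i) = 1
  · rw [div_eq_mul_one_div]
    refine mul_le_mul_of_nonneg_left ?_ (Finset.prod_nonneg fun i _ => h.leaf_nonneg _)
    have hcard : (β ∪ Finset.univ.image fun i => s(u i, f i)).card = β.card + k := by
      rw [Finset.card_union_of_disjoint, Finset.card_image_of_injective, Finset.card_univ,
        Fintype.card_fin]
      · intro i j hij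
        rcases Sym2.eq_iff.1 hij with h1 | h1
        · exact hu h1.1
        · exact absurd h1.1 (h.ne_of_mid_leaf (hc i) (hf j))
      · rw [Finset.disjoint_right]
        intro p hp hp'
        obtain ⟨i, -, rfl⟩ := Finset.mem_image.1 hp
        exact hβ i (mem_support.2 ⟨_, hp', Sym2.mem_mk_left _ _⟩)
    rw [← hcard]
    exact avg_ind_le_inv _ (by rw [hcard]; exact hN)
  · push Not at hf
    obtain ⟨i, hi⟩ := hf
    rw [Finset.prod_eq_zero (Finset.mem_univ i) ((h.leaf_zero_or_one _).resolve_right hi)]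
    simp

theorem ind_empty (g : Matching N) : ind g ∅ = 1 := by simp [ind]

theorem support_empty : support (∅ : Finset (Sym2 (Fin N))) = ∅ := by
  ext; simp [mem_support]

theorem HalfEdgeTypes.avg_prod_le (h : HalfEdgeTypes a c τ) {k : ℕ} (u : Fin k → Fin N)
    (hu : Function.Injective u) (hc : ∀ i, c (u i) = 1) (hN : 2 * k ≤ N) :
    avg (fun g => ∏ i, a (g.1 (u i))) ≤ (∑ x, a x) ^ k / oddFall N k := by
  have := h.avg_ind_mul_prod_le u hu hc ∅ (by simp [support_empty]) (by simpa using hN)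
  simpa [ind_empty] using this

theorem edgeCount_eq_sum (g : Matching N) :
    edgeCount a g = (∑ x, ∑ y ∈ Finset.univ.erase x, a x * a y * ind g {s(x, y)}) / 2 := by
  unfold edgeCount
  congr 1
  refine Finset.sum_congr rfl fun x _ => ?_
  simp only [ind_singleton, mul_ite, mul_one, mul_zero]
  rw [Finset.sum_ite_eq, if_pos (Finset.mem_erase.2 ⟨g.apply_ne x, Finset.mem_univ _⟩)]

theorem HalfEdgeTypes.sum_leaf_pairs (h : HalfEdgeTypes a c τ) :
    ∑ x, ∑ y ∈ Finset.univ.erase x, a x * a y = (∑ x, a x) * (∑ x, a x - 1) := by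
  have e : ∀ x, ∑ y ∈ Finset.univ.erase x, a x * a y = a x * ∑ y, a y - a x := by
    intro x
    have := Finset.add_sum_erase Finset.univ a (Finset.mem_univ x)
    rw [← Finset.mul_sum, ← this]
    rcases h.leaf_zero_or_one x with e | e <;> rw [e] <;> ring
  rw [Finset.sum_congr rfl fun x _ => e x, Finset.sum_sub_distrib, ← Finset.sum_mul]
  ring

theorem HalfEdgeTypes.avg_edgeCount_mul_le (h : HalfEdgeTypes a c τ) (f : Matching N → ℝ) {w : ℝ}
    (hf : ∀ x y, y ≠ x → a x = 1 → a y = 1 → avg (fun g => ind g {s(x, y)} * f g) ≤ w) :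
    avg (fun g => edgeCount a g * f g) ≤ (∑ x, a x) * (∑ x, a x - 1) / 2 * w := by
  have e : ∀ g, edgeCount a g * f g = 1 / 2 * ∑ x, ∑ y ∈ Finset.univ.erase x,
      a x * a y * (ind g {s(x, y)} * f g) := by
    intro g
    rw [edgeCount_eq_sum, div_mul_eq_mul_div, Finset.sum_mul, div_eq_mul_one_div, mul_comm]
    congr 1
    refine Finset.sum_congr rfl fun x _ => ?_
    rw [Finset.sum_mul]
    exact Finset.sum_congr rfl fun y _ => by ring
  simp only [e]
  rw [avg_const_mul, avg_sum, ← h.sum_leaf_pairs]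
  suffices H : ∑ x, avg (fun g => ∑ y ∈ Finset.univ.erase x, a x * a y * (ind g {s(x, y)} * f g)) ≤
      (∑ x, ∑ y ∈ Finset.univ.erase x, a x * a y) * w by
    rw [div_mul_eq_mul_div]
    linarith
  rw [Finset.sum_mul]
  refine Finset.sum_le_sum fun x _ => ?_
  rw [avg_sum, Finset.sum_mul]
  refine Finset.sum_le_sum fun y hy => ?_
  rw [avg_const_mul]
  rcases h.leaf_zero_or_one x with e1 | e1
  · rw [e1]; simp
  · rcases h.leaf_zero_or_one y with e2 | e2
    · rw [e2]; simp
    · rw [e1, e2]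
      simpa using hf x y (Finset.ne_of_mem_erase hy) e1 e2

theorem HalfEdgeTypes.avg_edgeCount_le (h : HalfEdgeTypes a c τ) (hN : 2 ≤ N) :
    avg (edgeCount a) ≤ (∑ x, a x) * (∑ x, a x - 1) / 2 / oddFall N 1 := by
  have := h.avg_edgeCount_mul_le (fun _ => 1) (w := 1 / oddFall N 1) (fun x y _ _ _ => by
    simpa using avg_ind_le_inv {s(x, y)} (by simpa using hN))
  simp only [mul_one] at this
  rw [div_eq_mul_one_div _ (oddFall N 1)]
  exact this

theorem sum_mid_mul_le {φ : Fin N → ℝ} {w : ℝ} (hc : ∀ x, c x = 0 ∨ c x = 1)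
    (hφ : ∀ x, c x = 1 → φ x ≤ w) : ∑ x, c x * φ x ≤ (∑ x, c x) * w := by
  rw [Finset.sum_mul]
  refine Finset.sum_le_sum fun x _ => ?_
  rcases hc x with e | e
  · rw [e]; simp
  · rw [e]; simpa using hφ x e

theorem HalfEdgeTypes.avg_starCount_le (h : HalfEdgeTypes a c τ) (hN : 4 ≤ N) :
    avg (starCount a c τ) ≤ (∑ x, c x) * (∑ x, a x) ^ 2 / 2 / oddFall N 2 := by
  have e : ∀ g, starCount a c τ g = 1 / 2 * ∑ x, c x * (a (g.1 x) * a (g.1 (τ x))) := by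
    intro g
    rw [starCount, div_eq_mul_one_div, mul_comm]
    congr 1
    exact Finset.sum_congr rfl fun x _ => by ring
  have e' : avg (starCount a c τ) = avg fun g => starCount a c τ g := rfl
  rw [e']
  simp only [e]
  rw [avg_const_mul, avg_sum]
  simp only [avg_const_mul]
  have := sum_mid_mul_le (φ := fun x => avg fun g => a (g.1 x) * a (g.1 (τ x)))
    (w := (∑ x, a x) ^ 2 / oddFall N 2) h.mid_zero_or_one (fun x hx => ?_)
  · calc _ ≤ 1 / 2 * ((∑ x, c x) * ((∑ x, a x) ^ 2 / oddFall N 2)) := by linarith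
      _ = _ := by ring
  · have := h.avg_prod_le ![x, τ x] ?_ ?_ (by omega)
    · simpa [Fin.prod_univ_two] using this
    · have := h.twin_ne x hx
      intro i j
      fin_cases i <;> fin_cases j <;> simp [this, this.symm]
    · intro i
      fin_cases i <;> simp [hx, h.mid_twin]

/-- Given an isolated edge, the half-stars contribute at most C·A and the loops C/2, both divided by
(N − 1)(N − 3). The term A/2 from the loops is absorbed because A − 1, not A, counts the second leaf
of the edge. -/
theorem HalfEdgeTypes.avg_edgeCount_mul_halfStarCount_le (h : HalfEdgeTypes a c τ) (hN : 4 ≤ N)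
    (hA : 1 ≤ ∑ x, a x) :
    avg (fun g => edgeCount a g * halfStarCount 1 a c τ g) ≤
      (∑ x, a x) ^ 3 * (∑ x, c x) / 2 / oddFall N 2 := by
  have hW : 0 < oddFall N 2 := oddFall_pos (by omega)
  have hC := h.sum_mid_nonneg
  have key := h.avg_edgeCount_mul_le (halfStarCount 1 a c τ)
    (w := (∑ x, c x) * (∑ x, a x + 1 / 2) / oddFall N 2) (fun x y hxy hx hy => ?_)
  · refine key.trans ?_
    rw [← mul_div_assoc]
    refine div_le_div_of_nonneg_right ?_ hW.le
    nlinarith [mul_nonneg hC (by linarith : 0 ≤ ∑ x, a x)]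
  · have hle : ∀ g, ind g {s(x, y)} * halfStarCount 1 a c τ g ≤
        ∑ v, c v * (ind g {s(x, y)} * a (g.1 v)) +
          1 / 2 * ∑ v, c v * (ind g {s(x, y)} * ind g {s(v, τ v)}) := by
      intro g
      have hi := ind_nonneg g {s(x, y)}
      have : halfStarCount 1 a c τ g ≤ ∑ v, c v * a (g.1 v) +
          1 / 2 * ∑ v, c v * ind g {s(v, τ v)} := by
        simp only [halfStarCount, ind_singleton]
        refine add_le_add (Finset.sum_le_sum fun v _ => ?_) le_rfl
        have := mul_nonneg (h.mid_nonneg v) (h.leaf_nonneg (g.1 v))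
        have := h.leaf_nonneg (g.1 (τ v))
        nlinarith
      refine (mul_le_mul_of_nonneg_left this hi).trans (le_of_eq ?_)
      rw [mul_add, mul_left_comm, Finset.mul_sum, Finset.mul_sum]
      congr 1
      · exact Finset.sum_congr rfl fun v _ => by ring
      · congr 1
        exact Finset.sum_congr rfl fun v _ => by ring
    refine (avg_mono hle).trans ?_
    rw [avg_add, avg_const_mul, avg_sum, avg_sum]
    simp only [avg_const_mul]
    have hsupp : ∀ v, c v = 1 → v ∉ support {s(x, y)} := by
      intro v hv hm
      obtain ⟨p, hp, hvp⟩ := mem_support.1 hm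
      rw [Finset.mem_singleton.1 hp, Sym2.mem_iff] at hvp
      rcases hvp with e | e
      · exact h.ne_of_mid_leaf hv hx e
      · exact h.ne_of_mid_leaf hv hy e
    have b1 := sum_mid_mul_le (φ := fun v => avg fun g => ind g {s(x, y)} * a (g.1 v))
      (w := (∑ x, a x) / oddFall N 2) h.mid_zero_or_one (fun v hv => by
        have := h.avg_ind_mul_prod_le ![v] (Function.injective_of_subsingleton _) (by simp [hv])
          {s(x, y)} (by simpa using hsupp v hv) (by simpa using hN)
        simpa using this)
    have b2 := sum_mid_mul_le (φ := fun v => avg fun g => ind g {s(x, y)} * ind g {s(v, τ v)})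
      (w := 1 / oddFall N 2) h.mid_zero_or_one (fun v hv => by
        classical
        have hcard : ({s(x, y)} ∪ {s(v, τ v)} : Finset (Sym2 (Fin N))).card = 2 := by
          rw [Finset.card_union_of_disjoint]
          · simp
          · rw [Finset.disjoint_singleton]
            intro e
            exact hsupp v hv (mem_support.2 ⟨_, Finset.mem_singleton_self _, by
              rw [e]; exact Sym2.mem_mk_left _ _⟩)
        have := avg_ind_le_inv ({s(x, y)} ∪ {s(v, τ v)}) (by rw [hcard]; exact hN)
        rw [hcard] at this
        simpa only [ind_union] using this)
    calc _ ≤ (∑ x, c x) * ((∑ x, a x) / oddFall N 2) +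
          1 / 2 * ((∑ x, c x) * (1 / oddFall N 2)) := by linarith
      _ = _ := by ring

/-- One vertex cannot carry both a star and a half-star, so the terms with coinciding centres vanish
and the others prescribe leaves at three distinct half-edges. -/
theorem HalfEdgeTypes.avg_starCount_mul_halfStarCount_le (h : HalfEdgeTypes a c τ) (hN : 6 ≤ N) :
    avg (fun g => starCount a c τ g * halfStarCount 0 a c τ g) ≤
      (∑ x, c x) ^ 2 * (∑ x, a x) ^ 3 / 2 / oddFall N 3 := by
  have hW : 0 < oddFall N 3 := oddFall_pos (by omega)
  have e : ∀ g, starCount a c τ g * halfStarCount 0 a c τ g = 1 / 2 * ∑ u, c u * ∑ v, c v *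
      (a (g.1 u) * a (g.1 (τ u)) * (a (g.1 v) * (1 - a (g.1 (τ v))))) := by
    intro g
    simp only [starCount, halfStarCount, zero_div, zero_mul, add_zero]
    rw [div_mul_eq_mul_div, Finset.sum_mul, div_eq_mul_one_div, mul_comm]
    congr 1
    refine Finset.sum_congr rfl fun u _ => ?_
    rw [Finset.mul_sum, Finset.mul_sum]
    exact Finset.sum_congr rfl fun v _ => by ring
  simp only [e]
  rw [avg_const_mul, avg_sum]
  simp only [avg_const_mul]
  have := sum_mid_mul_le (φ := fun u => avg fun g => ∑ v, c v *
      (a (g.1 u) * a (g.1 (τ u)) * (a (g.1 v) * (1 - a (g.1 (τ v))))))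
    (w := (∑ x, c x) * ((∑ x, a x) ^ 3 / oddFall N 3)) h.mid_zero_or_one (fun u hu => ?_)
  · calc _ ≤ 1 / 2 * ((∑ x, c x) * ((∑ x, c x) * ((∑ x, a x) ^ 3 / oddFall N 3))) := by linarith
      _ = _ := by ring
  · rw [avg_sum]
    simp only [avg_const_mul]
    refine sum_mid_mul_le h.mid_zero_or_one fun v hv => ?_
    have hnn : 0 ≤ (∑ x, a x) ^ 3 / oddFall N 3 :=
      div_nonneg (pow_nonneg h.sum_leaf_nonneg 3) hW.le
    have htu := h.twin_ne u hu
    have hz : (∀ g : Matching N, a (g.1 u) * a (g.1 (τ u)) * (a (g.1 v) * (1 - a (g.1 (τ v)))) = 0) →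
        avg (fun g => a (g.1 u) * a (g.1 (τ u)) * (a (g.1 v) * (1 - a (g.1 (τ v))))) ≤
          (∑ x, a x) ^ 3 / oddFall N 3 := by
      intro h0
      simp only [h0]
      simpa [avg] using hnn
    by_cases h1 : v = u
    · subst h1
      refine hz fun g => ?_
      rcases h.leaf_zero_or_one (g.1 (τ v)) with e | e <;> rw [e] <;> ring
    by_cases h2 : v = τ u
    · subst h2
      refine hz fun g => ?_
      rw [h.twin_twin]
      rcases h.leaf_zero_or_one (g.1 u) with e | e <;> rw [e] <;> ring
    have hp := h.avg_prod_le ![u, τ u, v] ?_ ?_ (by omega)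
    · refine (avg_mono fun g => ?_).trans hp
      rw [Fin.prod_univ_three]
      simp only [Matrix.cons_val_zero, Matrix.cons_val_one, Matrix.cons_val]
      have p1 := mul_nonneg (mul_nonneg (h.leaf_nonneg (g.1 u)) (h.leaf_nonneg (g.1 (τ u))))
        (h.leaf_nonneg (g.1 v))
      have p2 := h.leaf_nonneg (g.1 (τ v))
      nlinarith
    · intro i j
      fin_cases i <;> fin_cases j <;> simp [htu, htu.symm, h1, h2, Ne.symm h1, Ne.symm h2]
    · intro i
      fin_cases i <;> simp [hu, hv, h.mid_twin]

/-- Subtracting 1 removes the coinciding centres, given by v = u and v = τ u, and the remaining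
terms prescribe leaves at four distinct half-edges. -/
theorem HalfEdgeTypes.avg_starCount_mul_sub_one_le (h : HalfEdgeTypes a c τ) (hN : 8 ≤ N) :
    avg (fun g => starCount a c τ g * (starCount a c τ g - 1)) ≤
      (∑ x, c x) ^ 2 * (∑ x, a x) ^ 4 / 4 / oddFall N 4 := by
  have hW : 0 < oddFall N 4 := oddFall_pos (by omega)
  have e : ∀ g, starCount a c τ g * (starCount a c τ g - 1) = 1 / 4 * ∑ u, c u * ∑ v, c v *
      (if v = u ∨ v = τ u then 0 else
        a (g.1 u) * a (g.1 (τ u)) * (a (g.1 v) * a (g.1 (τ v)))) := by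
    intro g
    have e1 : ∀ u, c u * ∑ v, c v * (if v = u ∨ v = τ u then 0 else
        a (g.1 u) * a (g.1 (τ u)) * (a (g.1 v) * a (g.1 (τ v)))) =
        starAt a c τ g u * ∑ v, starAt a c τ g v - 2 * starAt a c τ g u := by
      intro u
      rcases h.mid_zero_or_one u with hu | hu
      · unfold starAt; rw [hu]; ring
      · have htu := h.twin_ne u hu
        have e2 : ∀ v, c v * (if v = u ∨ v = τ u then 0 else
            a (g.1 u) * a (g.1 (τ u)) * (a (g.1 v) * a (g.1 (τ v)))) =
            starAt a c τ g u * starAt a c τ g v - (if v = u then starAt a c τ g u else 0) -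
              (if v = τ u then starAt a c τ g u else 0) := by
          intro v
          have hsq : starAt a c τ g u * starAt a c τ g u = starAt a c τ g u := by
            rcases h.starAt_zero_or_one g u with e | e <;> rw [e] <;> norm_num
          by_cases h1 : v = u
          · subst h1
            rw [if_pos (Or.inl rfl), if_pos rfl, if_neg htu.symm, hsq]
            ring
          · by_cases h2 : v = τ u
            · rw [h2, if_pos (Or.inr rfl), if_pos rfl, if_neg htu, h.starAt_twin, hsq]
              ring
            · rw [if_neg h1, if_neg h2, if_neg (by tauto)]
              unfold starAt
              rw [hu]
              ring
        rw [Finset.sum_congr rfl fun v _ => e2 v, Finset.sum_sub_distrib, Finset.sum_sub_distrib,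
          Finset.sum_ite_eq', Finset.sum_ite_eq', if_pos (Finset.mem_univ _),
          if_pos (Finset.mem_univ _), ← Finset.mul_sum, hu]
        ring
    rw [Finset.sum_congr rfl fun u _ => e1 u, Finset.sum_sub_distrib, ← Finset.sum_mul,
      ← Finset.mul_sum]
    have e3 : starCount a c τ g = (∑ x, starAt a c τ g x) / 2 := rfl
    rw [e3]
    ring
  simp only [e]
  rw [avg_const_mul, avg_sum]
  simp only [avg_const_mul]
  have := sum_mid_mul_le (φ := fun u => avg fun g => ∑ v, c v * (if v = u ∨ v = τ u then 0 else
      a (g.1 u) * a (g.1 (τ u)) * (a (g.1 v) * a (g.1 (τ v)))))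
    (w := (∑ x, c x) * ((∑ x, a x) ^ 4 / oddFall N 4)) h.mid_zero_or_one (fun u hu => ?_)
  · calc _ ≤ 1 / 4 * ((∑ x, c x) * ((∑ x, c x) * ((∑ x, a x) ^ 4 / oddFall N 4))) := by linarith
      _ = _ := by ring
  · rw [avg_sum]
    simp only [avg_const_mul]
    refine sum_mid_mul_le h.mid_zero_or_one fun v hv => ?_
    have hnn : 0 ≤ (∑ x, a x) ^ 4 / oddFall N 4 :=
      div_nonneg (pow_nonneg h.sum_leaf_nonneg 4) hW.le
    by_cases h0 : v = u ∨ v = τ u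
    · simp only [if_pos h0]
      simpa [avg] using hnn
    · simp only [if_neg h0]
      push Not at h0
      obtain ⟨h1, h2⟩ := h0
      have h3 : τ v ≠ u := fun e => h2 (by rw [← e, h.twin_twin])
      have h4 : τ v ≠ τ u := fun e => h1 (by rw [← h.twin_twin v, e, h.twin_twin])
      have htu := h.twin_ne u hu
      have htv := h.twin_ne v hv
      have hp := h.avg_prod_le ![u, τ u, v, τ v] ?_ ?_ (by omega)
      · refine (avg_mono fun g => ?_).trans hp
        rw [Fin.prod_univ_four]
        simp only [Matrix.cons_val_zero, Matrix.cons_val_one, Matrix.cons_val]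
        exact le_of_eq (by ring)
      · intro i j
        fin_cases i <;> fin_cases j <;> simp [htu, htu.symm, htv, htv.symm, h1, h2, h3, h4, Ne.symm h1,
          Ne.symm h2, Ne.symm h3, Ne.symm h4]
      · intro i
        fin_cases i <;> simp [hu, hv, h.mid_twin]

end Moments

/-! ### Variance bounds for the four conditional expectations -/

section Variances

variable {N : ℕ} {a c : Fin N → ℝ} {τ : Fin N → Fin N}

theorem mvar_le_of_abs_switch_sub_le (hN : 1 < N) {f f' : Matching N → ℝ} {K : ℝ}
    (h : ∀ g i j, |f (switch g i j) - f g| ≤ K * |f' (switch g i j) - f' g|) :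
    mvar f ≤ K ^ 2 * avg (down f') / (4 * ((N : ℝ) - 1)) := by
  have hN' : (1 : ℝ) < N := by exact_mod_cast hN
  have h0 : (0 : ℝ) < N - 1 := by linarith
  have hle : avg (fun g => ∑ i, ∑ j, (f (switch g i j) - f g) ^ 2) ≤
      K ^ 2 * avg (fun g => ∑ i, ∑ j, (f' (switch g i j) - f' g) ^ 2) := by
    rw [← avg_const_mul]
    refine avg_mono fun g => ?_
    simp only [Finset.mul_sum]
    refine Finset.sum_le_sum fun i _ => Finset.sum_le_sum fun j _ => ?_
    rw [← sq_abs (f _ - _), ← sq_abs (f' _ - _), ← mul_pow]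
    exact pow_le_pow_left₀ (abs_nonneg _) (h g i j) 2
  rw [avg_sum_sq_eq f'] at hle
  refine (poincare hN f).trans ?_
  rw [div_le_div_iff₀ (by positivity) (by positivity)]
  nlinarith [mul_le_mul_of_nonneg_right hle h0.le]

theorem mvar_le_of_eq_mul {f f' : Matching N → ℝ} {ρ : ℝ} (h : ∀ g, f g = ρ * f' g)
    (hρ : |ρ| ≤ 1) : mvar f ≤ mvar f' := by
  have : f = fun g => ρ * f' g := funext h
  rw [this, mvar_const_mul, ← sq_abs]
  exact mul_le_of_le_one_left (mvar_nonneg _) (pow_le_one₀ (abs_nonneg _) hρ)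

theorem HalfEdgeTypes.sum_leaf_add_sum_mid_le (h : HalfEdgeTypes a c τ) :
    ∑ x, a x + ∑ x, c x ≤ N := by
  rw [← Finset.sum_add_distrib]
  calc ∑ x, (a x + c x) ≤ ∑ _x : Fin N, (1 : ℝ) := Finset.sum_le_sum fun x _ => by
        rcases h.mid_zero_or_one x with e | e
        · rw [e, add_zero]; exact h.leaf_le_one x
        · rw [e, h.leaf_of_mid x e, zero_add]
    _ = N := by simp

theorem HalfEdgeTypes.two_mul_starCount_le (h : HalfEdgeTypes a c τ) (g : Matching N) :
    2 * starCount a c τ g ≤ ∑ x, a x := by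
  rw [← sum_comp_partner g a, starCount, mul_div_cancel₀ _ (two_ne_zero)]
  refine Finset.sum_le_sum fun x _ => ?_
  rcases h.mid_zero_or_one x with e1 | e1 <;> rcases h.leaf_zero_or_one (g.1 x) with e2 | e2 <;>
    rcases h.leaf_zero_or_one (g.1 (τ x)) with e3 | e3 <;> simp [e1, e2, e3]

/-- At a vertex of degree two at most one of the following occurs: a half-star at one half-edge, a
half-star at the other, a loop. -/
theorem HalfEdgeTypes.halfStarCount_le (h : HalfEdgeTypes a c τ) {κ : ℝ} (hκ1 : κ ≤ 1)
    (g : Matching N) : 2 * halfStarCount κ a c τ g ≤ ∑ x, c x := by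
  have e := h.sum_comp_twin fun x => halfStarAt a c τ g x
  have e1 : 2 * halfStarCount κ a c τ g =
      ∑ x, (halfStarAt a c τ g x + halfStarAt a c τ g (τ x) + κ * loopAt c τ g x) := by
    rw [halfStarCount_eq, Finset.sum_add_distrib, Finset.sum_add_distrib, e, ← Finset.mul_sum]
    ring
  rw [e1]
  refine Finset.sum_le_sum fun x _ => ?_
  simp only [halfStarAt, loopAt, h.mid_twin, h.twin_twin]
  rcases h.mid_zero_or_one x with hc | hc
  · rw [hc]; simp
  · by_cases hl : g.1 x = τ x
    · have hl' : g.1 (τ x) = x := by rw [← hl, g.apply_apply]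
      have := h.leaf_of_mid (τ x) (by rw [h.mid_twin, hc])
      rw [hl', hl, this, h.leaf_of_mid x hc, hc]
      simpa using hκ1
    · rw [hc, if_neg hl]
      rcases h.leaf_zero_or_one (g.1 x) with e2 | e2 <;>
        rcases h.leaf_zero_or_one (g.1 (τ x)) with e3 | e3 <;> rw [e2, e3] <;> norm_num

theorem HalfEdgeTypes.outerCount_le (h : HalfEdgeTypes a c τ) (g : Matching N) :
    outerCount a g ≤ 2 * ∑ x, a x := by
  have := h.edgeCount_nonneg (g := g)
  have := h.sum_leaf_nonneg
  exact max_le (by linarith) (by linarith)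

/-- The leaves of an isolated 2-star do not belong to isolated edges. -/
theorem HalfEdgeTypes.two_le_of_starAt (h : HalfEdgeTypes a c τ) {g : Matching N} {u : Fin N}
    (hu : starAt a c τ g u = 1) : 2 ≤ ∑ x, a x - 2 * edgeCount a g := by
  obtain ⟨hc, ha, hs, -⟩ := h.starAt_eq_one hu
  obtain ⟨hc', ha', hs', -⟩ := h.starAt_eq_one ((h.starAt_twin u).trans hu)
  have hne : g.1 u ≠ g.1 (τ u) := fun e => h.twin_ne u hc (g.injective e).symm
  have hsub : ∑ x ∈ ({g.1 u, g.1 (τ u)} : Finset (Fin N)), a x * (1 - a (g.1 x)) ≤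
      ∑ x, a x * (1 - a (g.1 x)) := by
    refine Finset.sum_le_sum_of_subset_of_nonneg (Finset.subset_univ _) fun x _ _ => ?_
    exact mul_nonneg (h.leaf_nonneg _) (by linarith [h.leaf_le_one (g.1 x)])
  rw [Finset.sum_pair hne, g.apply_apply, g.apply_apply, ha, ha', hs, hs'] at hsub
  have e : ∑ x, a x * (1 - a (g.1 x)) = ∑ x, a x - 2 * edgeCount a g := by
    rw [edgeCount, ← mul_div_assoc, mul_div_cancel_left₀ _ (two_ne_zero (α := ℝ)),
      ← Finset.sum_sub_distrib]
    exact Finset.sum_congr rfl fun x _ => by ring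
  linarith

theorem HalfEdgeTypes.starCount_eq_zero_or (h : HalfEdgeTypes a c τ) (g : Matching N) :
    starCount a c τ g = 0 ∨ 2 ≤ ∑ x, a x - 2 * edgeCount a g := by
  by_cases hx : ∃ u, starAt a c τ g u = 1
  · obtain ⟨u, hu⟩ := hx
    exact Or.inr (h.two_le_of_starAt hu)
  · left
    push Not at hx
    have : ∀ x, starAt a c τ g x = 0 := fun x => (h.starAt_zero_or_one g x).resolve_right (hx x)
    have e : starCount a c τ g = (∑ x, starAt a c τ g x) / 2 := rfl
    rw [e, Finset.sum_eq_zero fun x _ => this x, zero_div]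

/-- If there is a star, its two leaves give A − 2E ≥ 2, so the truncation is inactive; otherwise
both sides vanish. The truncated factor is nonnegative, as `down_mul_le` requires. -/
theorem HalfEdgeTypes.starCount_mul_outerCount (h : HalfEdgeTypes a c τ) (g : Matching N) :
    starCount a c τ g * outerCount a g =
      starCount a c τ g * (2 * ∑ x, a x - 4 * edgeCount a g - 3) := by
  rcases h.starCount_eq_zero_or g with e | e
  · rw [e, zero_mul, zero_mul]
  · rw [outerCount, max_eq_left (by linarith)]

theorem oddFall_one (N : ℕ) : oddFall N 1 = N - 1 := by simp [oddFall]

theorem oddFall_two (N : ℕ) : oddFall N 2 = (N - 1) * (N - 3) := by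
  simp only [oddFall, Finset.prod_range_succ, Finset.prod_range_zero]
  push_cast
  ring

theorem oddFall_three (N : ℕ) : oddFall N 3 = (N - 1) * (N - 3) * (N - 5) := by
  simp only [oddFall, Finset.prod_range_succ, Finset.prod_range_zero]
  push_cast
  ring

theorem oddFall_four (N : ℕ) : oddFall N 4 = (N - 1) * (N - 3) * (N - 5) * (N - 7) := by
  simp only [oddFall, Finset.prod_range_succ, Finset.prod_range_zero]
  push_cast
  ring

theorem pow_mul_le_of_le_mul {m b L X D : ℝ} {k : ℕ} (hm : 0 ≤ m) (hL : 0 < L) (hmL : m ≤ b * L)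
    (hX : 0 ≤ X) (h : L ^ k * X ≤ D) : m ^ k * X ≤ b ^ k * D := by
  have hb : 0 ≤ b := by
    by_contra hb
    have := mul_neg_of_neg_of_pos (not_le.1 hb) hL
    linarith
  calc m ^ k * X ≤ (b * L) ^ k * X := by gcongr
    _ = b ^ k * (L ^ k * X) := by ring
    _ ≤ _ := by gcongr

/-- The conditional expectation of the sum over isolated edges of the changes of the number of
isolated edges. -/
def edgeEdge (a : Fin N → ℝ) (g : Matching N) : ℝ :=
  edgeCount a g * (N - 2 * ∑ x, a x + 2 * edgeCount a g) / (N - 1)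

/-- The conditional expectation of the sum over isolated edges of the changes of the number of
isolated 2-stars. -/
def edgeStar (a c : Fin N → ℝ) (τ : Fin N → Fin N) (g : Matching N) : ℝ :=
  edgeCount a g * (-2 * halfStarCount 1 a c τ g) / (N - 1)

/-- The conditional expectation of the sum over isolated 2-stars of the changes of the number of
isolated edges. -/
def starEdge (a c : Fin N → ℝ) (τ : Fin N → Fin N) (g : Matching N) : ℝ :=
  starCount a c τ g * ((N - 3) * (4 * edgeCount a g - 2 * ∑ x, a x + 3)) / ((N - 1) * (N - 3))

/-- The conditional expectation of the sum over isolated 2-stars of the changes of the number of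
isolated 2-stars. -/
def starStar (a c : Fin N → ℝ) (τ : Fin N → Fin N) (g : Matching N) : ℝ :=
  starCount a c τ g * (((N : ℝ) - 1) * (N - 3) + (2 - (∑ x, a x) * (∑ x, a x - 1) - ∑ x, c x) +
    4 * (N - 3) * (starCount a c τ g - 1) - (2 * N - 10) * halfStarCount 0 a c τ g) /
      ((N - 1) * (N - 3))

variable {m b : ℝ}

theorem HalfEdgeTypes.mvar_edgeEdge_le (h : HalfEdgeTypes a c τ) (hN : 16 ≤ N) (hA : ∑ x, a x ≤ m) :
    mvar (edgeEdge a) ≤ 0.607 * (m ^ 2 / (N - 1)) := by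
  have hN' : (16 : ℝ) ≤ N := by exact_mod_cast hN
  have hA0 := h.sum_leaf_nonneg
  have hC0 := h.sum_mid_nonneg
  have hAC := h.sum_leaf_add_sum_mid_le
  have hp : (0 : ℝ) < N - 1 := by linarith
  -- As a function of E the numerator has difference quotient N − 2A + 2E + 2E', of absolute value
  -- at most N because 0 ≤ 2E, 2E' ≤ A ≤ N. Here the variance is compared with the Dirichlet form of
  -- E itself.
  have hlip := mvar_le_of_abs_switch_sub_le (by omega : 1 < N) (f := edgeEdge a) (f' := edgeCount a)
    (K := N / (N - 1)) fun g i j => by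
      have e1 := h.two_mul_edgeCount_le g
      have e2 := h.two_mul_edgeCount_le (switch g i j)
      have e3 := h.edgeCount_nonneg (g := g)
      have e4 := h.edgeCount_nonneg (g := switch g i j)
      unfold edgeEdge
      rw [← sub_div, abs_div, abs_of_pos hp, div_mul_eq_mul_div]
      refine div_le_div_of_nonneg_right ?_ hp.le
      generalize edgeCount a (switch g i j) = E' at *
      generalize edgeCount a g = E at *
      have : E' * (N - 2 * ∑ x, a x + 2 * E') - E * (N - 2 * ∑ x, a x + 2 * E) =
          (N - 2 * ∑ x, a x + 2 * E + 2 * E') * (E' - E) := by ring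
      rw [this, abs_mul]
      refine mul_le_mul_of_nonneg_right (abs_le.2 ⟨?_, ?_⟩) (abs_nonneg _) <;> linarith
  refine hlip.trans ?_
  have hd : avg (down (edgeCount a)) ≤ 4 * N * ((∑ x, a x) * (∑ x, a x - 1) / 2 / (N - 1)) := by
    refine (avg_mono h.down_edgeCount_le).trans ?_
    rw [avg_const_mul, ← oddFall_one]
    exact mul_le_mul_of_nonneg_left (h.avg_edgeCount_le (by omega)) (by positivity)
  have hd2 : avg (down (edgeCount a)) ≤ 4 * N * (m ^ 2 / 2 / (N - 1)) := by
    refine hd.trans ?_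
    have : (∑ x, a x) * (∑ x, a x - 1) ≤ m ^ 2 := by nlinarith
    gcongr
  calc _ ≤ (N / (N - 1)) ^ 2 * (4 * N * (m ^ 2 / 2 / (N - 1))) / (4 * ((N : ℝ) - 1)) := by gcongr
    _ = (N ^ 3 / (2 * (N - 1) ^ 3)) * (m ^ 2 / (N - 1)) := by field_simp
    _ ≤ _ := by
      refine mul_le_mul_of_nonneg_right ?_ (by positivity)
      -- The ratio N³/(2(N − 1)³) is largest at N = 16, where it is about 0.6068.
      rw [div_le_iff₀ (by positivity)]
      obtain ⟨x, hx, hx0⟩ : ∃ x : ℝ, (N : ℝ) = x + 16 ∧ 0 ≤ x := ⟨N - 16, by ring, by linarith⟩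
      rw [hx]
      ring_nf
      nlinarith [pow_nonneg hx0 2, pow_nonneg hx0 3]

/-- The variance of a product of two counts whose decrements are controlled by the counts. -/
theorem mvar_mul_le (hN : 1 < N) {X Y : Matching N → ℝ} (hX : ∀ g, 0 ≤ X g) (hY : ∀ g, 0 ≤ Y g)
    {D M : ℝ} (hd : ∀ g, 2 * Y g ^ 2 * down X g + 2 * X g ^ 2 * down Y g ≤ D * (X g * Y g))
    (hD : 0 ≤ D) (hM : avg (fun g => X g * Y g) ≤ M) :
    mvar (fun g => X g * Y g) ≤ D * M / (4 * ((N : ℝ) - 1)) := by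
  have hN' : (1 : ℝ) < N := by exact_mod_cast hN
  refine (mvar_le_down hN _).trans (div_le_div_of_nonneg_right ?_ (by linarith))
  calc _ ≤ avg (fun g => D * (X g * Y g)) :=
        avg_mono fun g => (down_mul_le hX hY g).trans (hd g)
    _ ≤ _ := by rw [avg_const_mul]; gcongr

theorem HalfEdgeTypes.mvar_edgeStar_le (h : HalfEdgeTypes a c τ) (hN : 16 ≤ N)
    (hA1 : 1 ≤ ∑ x, a x) (hA : ∑ x, a x ≤ m) (hC : ∑ x, c x ≤ 2 * m) (hm : m ≤ b * (N - 15)) :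
    mvar (edgeStar a c τ) ≤ (16 * b ^ 3 + 16 * b ^ 4) * (m ^ 2 / (N - 1)) := by
  have hN' : (16 : ℝ) ≤ N := by exact_mod_cast hN
  have hm0 : 0 ≤ m := by linarith
  have hp : (0 : ℝ) < N - 1 := by linarith
  have hp3 : (0 : ℝ) < N - 3 := by linarith
  have hC0 := h.sum_mid_nonneg
  have key : mvar (fun g => edgeCount a g * halfStarCount 1 a c τ g) ≤
      ((16 * N + 8 * m) * m) * (m ^ 4 / ((N - 1) * (N - 3))) / (4 * ((N : ℝ) - 1)) := by
    refine mvar_mul_le (by omega) (fun g => h.edgeCount_nonneg)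
      (fun g => h.halfStarCount_nonneg (by norm_num) g) (fun g => ?_) (by positivity) ?_
    · have e1 := h.two_mul_edgeCount_le g
      have e2 := h.edgeCount_nonneg (g := g)
      have e3 := h.halfStarCount_le (le_refl (1 : ℝ)) g
      have e4 := h.halfStarCount_nonneg (zero_le_one' ℝ) g
      have d1 := h.down_edgeCount_le g
      have d2 := h.down_halfStarCount_le (zero_le_one' ℝ) le_rfl g
      generalize halfStarCount 1 a c τ g = Z at *
      generalize edgeCount a g = E at *
      calc _ ≤ 2 * Z ^ 2 * (4 * N * E) + 2 * E ^ 2 * (8 * (N + ∑ x, a x) * Z) := by gcongr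
        _ = (8 * N * Z + 8 * (N + ∑ x, a x) * (2 * E)) * (E * Z) := by ring
        _ ≤ (8 * N * m + 8 * (N + m) * m) * (E * Z) := by
          have : Z ≤ m := by linarith
          have : 2 * E ≤ m := by linarith
          gcongr
        _ = _ := by ring
    · refine (h.avg_edgeCount_mul_halfStarCount_le (by omega) hA1).trans ?_
      rw [oddFall_two]
      gcongr
      calc (∑ x, a x) ^ 3 * (∑ x, c x) / 2 ≤ m ^ 3 * (2 * m) / 2 := by gcongr
        _ = m ^ 4 := by ring
  have e : edgeStar a c τ = fun g => (-2 / (N - 1) : ℝ) * (edgeCount a g * halfStarCount 1 a c τ g) := by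
    funext g; unfold edgeStar; ring
  rw [e, mvar_const_mul]
  -- Two of the powers of m are kept for the factor m²/(N − 1); the others become powers of b
  -- through m ≤ b(N − 15). What remains is a polynomial inequality in N − 16 with nonnegative
  -- coefficients.
  have n1 := pow_mul_le_of_le_mul (k := 3) (X := 16 * N) (D := 16 * (N - 1) ^ 3 * (N - 3)) hm0
    (by linarith : (0 : ℝ) < N - 15) hm (by positivity) (by
      obtain ⟨x, hx, hx0⟩ : ∃ x : ℝ, (N : ℝ) = x + 16 ∧ 0 ≤ x := ⟨N - 16, by ring, by linarith⟩
      rw [hx, ← sub_nonneg]; ring_nf; positivity)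
  have n2 := pow_mul_le_of_le_mul (k := 4) (X := 8) (D := 16 * (N - 1) ^ 3 * (N - 3)) hm0
    (by linarith : (0 : ℝ) < N - 15) hm (by positivity) (by
      obtain ⟨x, hx, hx0⟩ : ∃ x : ℝ, (N : ℝ) = x + 16 ∧ 0 ≤ x := ⟨N - 16, by ring, by linarith⟩
      rw [hx, ← sub_nonneg]; ring_nf; positivity)
  calc _ ≤ (-2 / (N - 1) : ℝ) ^ 2 * (((16 * N + 8 * m) * m) * (m ^ 4 / ((N - 1) * (N - 3))) /
        (4 * ((N : ℝ) - 1))) := by gcongr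
    _ = (m ^ 3 * (16 * N) + m ^ 4 * 8) / ((N - 1) ^ 3 * (N - 3)) * (m ^ 2 / (N - 1)) := by
      field_simp; ring
    _ ≤ _ := by
      refine mul_le_mul_of_nonneg_right ?_ (by positivity)
      rw [div_le_iff₀ (by positivity)]
      linarith

theorem HalfEdgeTypes.mvar_starEdge_le (h : HalfEdgeTypes a c τ) (hN : 16 ≤ N)
    (hA : ∑ x, a x ≤ m) (hC : ∑ x, c x ≤ 2 * m) (hm : m ≤ b * (N - 15)) :
    mvar (starEdge a c τ) ≤ (16 * b ^ 3 + 8 * b ^ 4) * (m ^ 2 / (N - 1)) := by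
  have hN' : (16 : ℝ) ≤ N := by exact_mod_cast hN
  have hA0 := h.sum_leaf_nonneg
  have hm0 : 0 ≤ m := by linarith
  have hp : (0 : ℝ) < N - 1 := by linarith
  have hp3 : (0 : ℝ) < N - 3 := by linarith
  have hC0 := h.sum_mid_nonneg
  have key : mvar (fun g => starCount a c τ g * outerCount a g) ≤
      avg (fun g => (64 * N * m ^ 2 + 32 * m ^ 3) * starCount a c τ g) / (4 * ((N : ℝ) - 1)) := by
    refine (mvar_le_down (by omega) _).trans (div_le_div_of_nonneg_right (avg_mono fun g => ?_)
      (by linarith))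
    have e0 : ∀ g, 0 ≤ outerCount a g := fun g => le_max_right _ _
    refine (down_mul_le h.starCount_nonneg e0 g).trans ?_
    have e1 := h.two_mul_starCount_le g
    have e2 := h.starCount_nonneg g
    have e3 := h.outerCount_le g
    have e4 := e0 g
    have d1 := h.down_starCount_le g
    have d2 := h.down_outerCount_le g
    have d3 := down_nonneg (starCount a c τ) g
    generalize starCount a c τ g = S at *
    generalize outerCount a g = Q at *
    calc _ ≤ 2 * (2 * ∑ x, a x) ^ 2 * (8 * N * S) + 2 * S ^ 2 * (32 * (∑ x, a x) ^ 2) := by gcongr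
      _ = (64 * N * (∑ x, a x) ^ 2 + 32 * (2 * S) * (∑ x, a x) ^ 2) * S := by ring
      _ ≤ (64 * N * m ^ 2 + 32 * m * m ^ 2) * S := by
        have : 2 * S ≤ m := by linarith
        gcongr
      _ = _ := by ring
  rw [avg_const_mul] at key
  have hS : avg (starCount a c τ) ≤ m ^ 3 / ((N - 1) * (N - 3)) := by
    refine (h.avg_starCount_le (by omega)).trans ?_
    rw [oddFall_two]
    gcongr
    calc (∑ x, c x) * (∑ x, a x) ^ 2 / 2 ≤ (2 * m) * m ^ 2 / 2 := by gcongr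
      _ = m ^ 3 := by ring
  have e : starEdge a c τ = fun g => (-1 / (N - 1) : ℝ) * (starCount a c τ g * outerCount a g) := by
    funext g
    rw [h.starCount_mul_outerCount]
    unfold starEdge
    field_simp
    ring
  rw [e, mvar_const_mul]
  have n1 := pow_mul_le_of_le_mul (k := 3) (X := 16 * N) (D := 16 * (N - 1) ^ 3 * (N - 3)) hm0
    (by linarith : (0 : ℝ) < N - 15) hm (by positivity) (by
      obtain ⟨x, hx, hx0⟩ : ∃ x : ℝ, (N : ℝ) = x + 16 ∧ 0 ≤ x := ⟨N - 16, by ring, by linarith⟩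
      rw [hx, ← sub_nonneg]; ring_nf; positivity)
  have n2 := pow_mul_le_of_le_mul (k := 4) (X := 8) (D := 8 * (N - 1) ^ 3 * (N - 3)) hm0
    (by linarith : (0 : ℝ) < N - 15) hm (by positivity) (by
      obtain ⟨x, hx, hx0⟩ : ∃ x : ℝ, (N : ℝ) = x + 16 ∧ 0 ≤ x := ⟨N - 16, by ring, by linarith⟩
      rw [hx, ← sub_nonneg]; ring_nf; positivity)
  calc _ ≤ (-1 / (N - 1) : ℝ) ^ 2 * ((64 * N * m ^ 2 + 32 * m ^ 3) * (m ^ 3 / ((N - 1) * (N - 3))) /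
        (4 * ((N : ℝ) - 1))) := by
        refine mul_le_mul_of_nonneg_left (key.trans ?_) (sq_nonneg _)
        refine div_le_div_of_nonneg_right (mul_le_mul_of_nonneg_left hS (by positivity)) (by linarith)
    _ = (m ^ 3 * (16 * N) + m ^ 4 * 8) / ((N - 1) ^ 3 * (N - 3)) * (m ^ 2 / (N - 1)) := by
      field_simp; ring
    _ ≤ _ := by
      refine mul_le_mul_of_nonneg_right ?_ (by positivity)
      rw [div_le_iff₀ (by positivity)]
      linarith

theorem HalfEdgeTypes.mvar_starCount_le (h : HalfEdgeTypes a c τ) (hN : 16 ≤ N)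
    (hA : ∑ x, a x ≤ m) (hC : ∑ x, c x ≤ 2 * m) (hm : m ≤ b * (N - 15)) :
    mvar (starCount a c τ) ≤ 2 * b * (m ^ 2 / (N - 1)) := by
  have hN' : (16 : ℝ) ≤ N := by exact_mod_cast hN
  have hA0 := h.sum_leaf_nonneg
  have hm0 : 0 ≤ m := by linarith
  have hp : (0 : ℝ) < N - 1 := by linarith
  have hp3 : (0 : ℝ) < N - 3 := by linarith
  have hC0 := h.sum_mid_nonneg
  have hS : avg (starCount a c τ) ≤ m ^ 3 / ((N - 1) * (N - 3)) := by
    refine (h.avg_starCount_le (by omega)).trans ?_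
    rw [oddFall_two]
    gcongr
    calc (∑ x, c x) * (∑ x, a x) ^ 2 / 2 ≤ (2 * m) * m ^ 2 / 2 := by gcongr
      _ = m ^ 3 := by ring
  have hd : avg (down (starCount a c τ)) ≤ 8 * N * (m ^ 3 / ((N - 1) * (N - 3))) := by
    refine (avg_mono h.down_starCount_le).trans ?_
    rw [avg_const_mul]
    exact mul_le_mul_of_nonneg_left hS (by positivity)
  have n1 := pow_mul_le_of_le_mul (k := 1) (X := 2 * N) (D := 2 * ((N - 1) * (N - 3))) hm0
    (by linarith : (0 : ℝ) < N - 15) hm (by positivity) (by nlinarith)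
  calc _ ≤ _ := mvar_le_down (by omega) _
    _ ≤ 8 * N * (m ^ 3 / ((N - 1) * (N - 3))) / (4 * ((N : ℝ) - 1)) := by gcongr
    _ = (m ^ 1 * (2 * N)) / ((N - 1) * (N - 3)) * (m ^ 2 / (N - 1)) := by field_simp; ring
    _ ≤ _ := by
      refine mul_le_mul_of_nonneg_right ?_ (by positivity)
      rw [div_le_iff₀ (by positivity)]
      linarith

theorem HalfEdgeTypes.mvar_starCount_mul_halfStarCount_le (h : HalfEdgeTypes a c τ) (hN : 16 ≤ N)
    (hA : ∑ x, a x ≤ m) (hC : ∑ x, c x ≤ 2 * m) (hm : m ≤ b * (N - 15)) :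
    mvar (fun g => (2 * N - 10) / ((N - 1) * (N - 3)) * (starCount a c τ g * halfStarCount 0 a c τ g)) ≤
      (48 * b ^ 4 + 32 * b ^ 5) * (m ^ 2 / (N - 1)) := by
  have hN' : (16 : ℝ) ≤ N := by exact_mod_cast hN
  have hA0 := h.sum_leaf_nonneg
  have hm0 : 0 ≤ m := by linarith
  have hp : (0 : ℝ) < N - 1 := by linarith
  have hp3 : (0 : ℝ) < N - 3 := by linarith
  have hp5 : (0 : ℝ) < N - 5 := by linarith
  have hC0 := h.sum_mid_nonneg
  have key : mvar (fun g => starCount a c τ g * halfStarCount 0 a c τ g) ≤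
      ((24 * N + 8 * m) * m) * (2 * m ^ 5 / ((N - 1) * (N - 3) * (N - 5))) / (4 * ((N : ℝ) - 1)) := by
    refine mvar_mul_le (by omega) h.starCount_nonneg
      (fun g => h.halfStarCount_nonneg le_rfl g) (fun g => ?_) (by positivity) ?_
    · have e1 := h.two_mul_starCount_le g
      have e2 := h.starCount_nonneg g
      have e3 := h.halfStarCount_le (zero_le_one' ℝ) g
      have e4 := h.halfStarCount_nonneg (le_refl (0 : ℝ)) g
      have d1 := h.down_starCount_le g
      have d2 := h.down_halfStarCount_le (le_refl (0 : ℝ)) (zero_le_one' ℝ) g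
      generalize halfStarCount 0 a c τ g = Z at *
      generalize starCount a c τ g = S at *
      calc _ ≤ 2 * Z ^ 2 * (8 * N * S) + 2 * S ^ 2 * (8 * (N + ∑ x, a x) * Z) := by gcongr
        _ = (16 * N * Z + 8 * (N + ∑ x, a x) * (2 * S)) * (S * Z) := by ring
        _ ≤ (16 * N * m + 8 * (N + m) * m) * (S * Z) := by
          have : Z ≤ m := by linarith
          have : 2 * S ≤ m := by linarith
          gcongr
        _ = _ := by ring
    · refine (h.avg_starCount_mul_halfStarCount_le (by omega)).trans ?_
      rw [oddFall_three]
      gcongr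
      calc (∑ x, c x) ^ 2 * (∑ x, a x) ^ 3 / 2 ≤ (2 * m) ^ 2 * m ^ 3 / 2 := by gcongr
        _ = 2 * m ^ 5 := by ring
  rw [mvar_const_mul]
  have hθ : (2 * N - 10) / ((N - 1) * (N - 3)) ≤ 2 / ((N : ℝ) - 1) := by
    rw [div_le_div_iff₀ (by positivity) (by positivity)]
    nlinarith
  have hθ0 : 0 ≤ (2 * N - 10) / (((N : ℝ) - 1) * (N - 3)) :=
    div_nonneg (by linarith) (by positivity)
  have n1 := pow_mul_le_of_le_mul (k := 4) (X := 48 * N) (D := 48 * (N - 1) ^ 3 * (N - 3) * (N - 5))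
    hm0 (by linarith : (0 : ℝ) < N - 15) hm (by positivity) (by
      obtain ⟨x, hx, hx0⟩ : ∃ x : ℝ, (N : ℝ) = x + 16 ∧ 0 ≤ x := ⟨N - 16, by ring, by linarith⟩
      rw [hx, ← sub_nonneg]; ring_nf; positivity)
  have n2 := pow_mul_le_of_le_mul (k := 5) (X := 16) (D := 32 * (N - 1) ^ 3 * (N - 3) * (N - 5))
    hm0 (by linarith : (0 : ℝ) < N - 15) hm (by positivity) (by
      obtain ⟨x, hx, hx0⟩ : ∃ x : ℝ, (N : ℝ) = x + 16 ∧ 0 ≤ x := ⟨N - 16, by ring, by linarith⟩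
      rw [hx, ← sub_nonneg]; ring_nf; positivity)
  calc _ ≤ (2 / ((N : ℝ) - 1)) ^ 2 * (((24 * N + 8 * m) * m) *
        (2 * m ^ 5 / ((N - 1) * (N - 3) * (N - 5))) / (4 * ((N : ℝ) - 1))) := by
        have := mvar_nonneg fun g => starCount a c τ g * halfStarCount 0 a c τ g
        gcongr
    _ = (m ^ 4 * (48 * N) + m ^ 5 * 16) / ((N - 1) ^ 3 * (N - 3) * (N - 5)) * (m ^ 2 / (N - 1)) := by
      field_simp; ring
    _ ≤ _ := by
      refine mul_le_mul_of_nonneg_right ?_ (by positivity)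
      rw [div_le_iff₀ (by positivity)]
      linarith

/-- If an integer drops from k to l ≤ k − 1, then k(k − 1) − l(l − 1) = (k + l − 1)(k − l) ≤ 2(k −
1)(k − l). Integrality provides the factor k − 1, which keeps the bound proportional to S(S − 1). -/
theorem down_mul_sub_one_le {X : Matching N → ℝ} (hX : ∀ g, ∃ k : ℕ, X g = k) (g : Matching N) :
    down (fun g => X g * (X g - 1)) g ≤ 4 * (X g - 1) ^ 2 * down X g := by
  simp only [down, Finset.mul_sum]
  refine Finset.sum_le_sum fun i _ => Finset.sum_le_sum fun j _ => ?_
  obtain ⟨k, hk⟩ := hX g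
  obtain ⟨l, hl⟩ := hX (switch g i j)
  rw [hk, hl]
  rcases Nat.lt_or_ge l k with hlt | hge
  · have h1 : (l : ℝ) + 1 ≤ k := by exact_mod_cast hlt
    have h0 : (0 : ℝ) ≤ l := Nat.cast_nonneg l
    rw [max_eq_left (by linarith : (0 : ℝ) ≤ k - l),
      max_eq_left (by nlinarith : (0 : ℝ) ≤ k * (k - 1) - l * (l - 1)),
      show (k : ℝ) * (k - 1) - l * (l - 1) = (k + l - 1) * (k - l) by ring, mul_pow]
    refine mul_le_mul_of_nonneg_right ?_ (sq_nonneg _)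
    nlinarith
  · have h1 : (k : ℝ) ≤ l := by exact_mod_cast hge
    have : (k : ℝ) * (k - 1) - l * (l - 1) ≤ 0 := by
      have h2 : ((k : ℝ) - l) * (k + l - 1) ≤ 0 := by
        rcases Nat.eq_or_lt_of_le hge with e | e
        · rw [e, sub_self, zero_mul]
        · have : (1 : ℝ) ≤ l := by exact_mod_cast (by omega : 1 ≤ l)
          exact mul_nonpos_of_nonpos_of_nonneg (by linarith)
            (by linarith [(Nat.cast_nonneg k : (0 : ℝ) ≤ k)])
      linarith
    rw [max_eq_right this, zero_pow two_ne_zero]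
    exact mul_nonneg (mul_nonneg (by norm_num) (sq_nonneg _)) (sq_nonneg _)

theorem HalfEdgeTypes.mvar_starCount_mul_sub_one_le (h : HalfEdgeTypes a c τ) (hN : 16 ≤ N)
    (hA : ∑ x, a x ≤ m) (hC : ∑ x, c x ≤ 2 * m) (hm : m ≤ b * (N - 15))
    (hint : ∀ g, ∃ k : ℕ, starCount a c τ g = k) :
    mvar (fun g => 4 / ((N : ℝ) - 1) * (starCount a c τ g * (starCount a c τ g - 1))) ≤
      64 * b ^ 5 * (m ^ 2 / (N - 1)) := by
  have hN' : (16 : ℝ) ≤ N := by exact_mod_cast hN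
  have hA0 := h.sum_leaf_nonneg
  have hm0 : 0 ≤ m := by linarith
  have hp : (0 : ℝ) < N - 1 := by linarith
  have hp3 : (0 : ℝ) < N - 3 := by linarith
  have hp5 : (0 : ℝ) < N - 5 := by linarith
  have hp7 : (0 : ℝ) < N - 7 := by linarith
  have hC0 := h.sum_mid_nonneg
  have hM : avg (fun g => starCount a c τ g * (starCount a c τ g - 1)) ≤
      m ^ 6 / ((N - 1) * (N - 3) * (N - 5) * (N - 7)) := by
    refine (h.avg_starCount_mul_sub_one_le (by omega)).trans ?_
    rw [oddFall_four]
    gcongr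
    calc (∑ x, c x) ^ 2 * (∑ x, a x) ^ 4 / 4 ≤ (2 * m) ^ 2 * m ^ 4 / 4 := by gcongr
      _ = m ^ 6 := by ring
  have hd : avg (down fun g => starCount a c τ g * (starCount a c τ g - 1)) ≤
      16 * N * m * (m ^ 6 / ((N - 1) * (N - 3) * (N - 5) * (N - 7))) := by
    have : ∀ g, down (fun g => starCount a c τ g * (starCount a c τ g - 1)) g ≤
        16 * N * m * (starCount a c τ g * (starCount a c τ g - 1)) := by
      intro g
      refine (down_mul_sub_one_le hint g).trans ?_
      have e1 := h.two_mul_starCount_le g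
      have d1 := h.down_starCount_le g
      obtain ⟨k, hk⟩ := hint g
      rw [hk] at e1 d1 ⊢
      rcases Nat.eq_zero_or_pos k with rfl | hk0
      · simp only [Nat.cast_zero, mul_zero] at d1
        have := down_nonneg (starCount a c τ) g
        rw [le_antisymm d1 this]
        simp
      · have hk1 : (1 : ℝ) ≤ k := by exact_mod_cast hk0
        calc _ ≤ 4 * ((k : ℝ) - 1) ^ 2 * (8 * N * k) := by gcongr
          _ = 32 * N * (k - 1) * (k * (k - 1)) := by ring
          _ ≤ 32 * N * (m / 2) * (k * (k - 1)) := by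
            have : (0 : ℝ) ≤ k * (k - 1) := mul_nonneg (by linarith) (by linarith)
            gcongr
            linarith
          _ = _ := by ring
    refine (avg_mono this).trans ?_
    rw [avg_const_mul]
    exact mul_le_mul_of_nonneg_left hM (by positivity)
  rw [mvar_const_mul]
  have n1 := pow_mul_le_of_le_mul (k := 5) (X := 64 * N)
    (D := 64 * (N - 1) ^ 3 * (N - 3) * (N - 5) * (N - 7))
    hm0 (by linarith : (0 : ℝ) < N - 15) hm (by positivity) (by
      obtain ⟨x, hx, hx0⟩ : ∃ x : ℝ, (N : ℝ) = x + 16 ∧ 0 ≤ x := ⟨N - 16, by ring, by linarith⟩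
      rw [hx, ← sub_nonneg]; ring_nf; positivity)
  calc _ ≤ (4 / ((N : ℝ) - 1)) ^ 2 * (16 * N * m *
        (m ^ 6 / ((N - 1) * (N - 3) * (N - 5) * (N - 7))) / (4 * ((N : ℝ) - 1))) := by
        refine mul_le_mul_of_nonneg_left ((mvar_le_down (by omega) _).trans ?_) (sq_nonneg _)
        exact div_le_div_of_nonneg_right hd (by linarith)
    _ = (m ^ 5 * (64 * N)) / ((N - 1) ^ 3 * (N - 3) * (N - 5) * (N - 7)) * (m ^ 2 / (N - 1)) := by
      field_simp; ring
    _ ≤ _ := by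
      refine mul_le_mul_of_nonneg_right ?_ (by positivity)
      rw [div_le_iff₀ (by positivity)]
      linarith

theorem HalfEdgeTypes.sqrt_mvar_starStar_le (h : HalfEdgeTypes a c τ) (hN : 16 ≤ N)
    (hA : ∑ x, a x ≤ m) (hC : ∑ x, c x ≤ 2 * m) (hm : m ≤ b * (N - 15))
    (hint : ∀ g, ∃ k : ℕ, starCount a c τ g = k) :
    √(mvar (starStar a c τ)) ≤
      (√(2 * b) + √(64 * b ^ 5) + √(48 * b ^ 4 + 32 * b ^ 5)) * √(m ^ 2 / (N - 1)) := by
  have hN' : (16 : ℝ) ≤ N := by exact_mod_cast hN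
  have hA0 := h.sum_leaf_nonneg
  have hm0 : 0 ≤ m := by linarith
  have hp : (0 : ℝ) < N - 1 := by linarith
  have hp3 : (0 : ℝ) < N - 3 := by linarith
  have hC0 := h.sum_mid_nonneg
  have hAC := h.sum_leaf_add_sum_mid_le
  have hb : 0 ≤ b := by
    by_contra hb
    have := mul_neg_of_neg_of_pos (not_le.1 hb) (by linarith : (0 : ℝ) < N - 15)
    linarith
  set ρ : ℝ := 1 + (2 - (∑ x, a x) * (∑ x, a x - 1) - ∑ x, c x) / ((N - 1) * (N - 3)) with hρ
  -- For A ≥ 2 the coefficient ρ lies in [−1, 1]; for smaller A there are no 2-stars at all.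
  have hfirst : mvar (fun g => ρ * starCount a c τ g) ≤ mvar (starCount a c τ) := by
    by_cases hA2 : 2 ≤ ∑ x, a x
    · refine mvar_le_of_eq_mul (fun _ => rfl) ?_
      have hW : (0 : ℝ) < (N - 1) * (N - 3) := by positivity
      rw [hρ, abs_le]
      constructor
      · have : -2 ≤ (2 - (∑ x, a x) * (∑ x, a x - 1) - ∑ x, c x) / (((N : ℝ) - 1) * (N - 3)) := by
          rw [le_div_iff₀ hW]
          nlinarith
        linarith
      · have : (2 - (∑ x, a x) * (∑ x, a x - 1) - ∑ x, c x) / (((N : ℝ) - 1) * (N - 3)) ≤ 0 :=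
          div_nonpos_of_nonpos_of_nonneg (by nlinarith) hW.le
        linarith
    · have hz : ∀ g, starCount a c τ g = 0 := fun g =>
        (h.starCount_eq_zero_or g).resolve_right fun h2 => hA2 (by
          linarith [h.edgeCount_nonneg (g := g)])
      refine mvar_le_of_eq_mul (ρ := 1) (fun g => ?_) (by simp)
      rw [hz g, mul_zero, mul_zero]
  -- The three pieces are kept apart by the triangle inequality for standard deviations, since their
  -- sum has no definite sign.
  have e : starStar a c τ = fun g => (ρ * starCount a c τ g +
      4 / ((N : ℝ) - 1) * (starCount a c τ g * (starCount a c τ g - 1))) +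
      (-1) * ((2 * N - 10) / ((N - 1) * (N - 3)) *
        (starCount a c τ g * halfStarCount 0 a c τ g)) := by
    funext g
    unfold starStar
    rw [hρ]
    field_simp
    ring
  have b1 := Real.sqrt_le_sqrt (hfirst.trans (h.mvar_starCount_le hN hA hC hm))
  have b2 := Real.sqrt_le_sqrt (h.mvar_starCount_mul_sub_one_le hN hA hC hm hint)
  have b3 := Real.sqrt_le_sqrt (h.mvar_starCount_mul_halfStarCount_le hN hA hC hm)
  rw [Real.sqrt_mul (by positivity)] at b1 b2 b3
  rw [e]
  refine (sqrt_mvar_add_le _ _).trans ?_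
  rw [sqrt_mvar_const_mul]
  have := sqrt_mvar_add_le (fun g => ρ * starCount a c τ g)
    (fun g => 4 / ((N : ℝ) - 1) * (starCount a c τ g * (starCount a c τ g - 1)))
  simp only [abs_neg, abs_one, one_mul]
  linarith

end Variances

/-! ### Numerical comparison with C₁ -/

section Constants

/-- Cauchy–Schwarz, used to bound the square roots in C₁ from below by polynomials. The weights `r`
are free subject to one constraint. -/
theorem sum_le_sqrt_sum {k : ℕ} (r v y : Fin k → ℝ) (hv : ∀ i, 0 < v i)
    (h : ∑ i, r i ^ 2 / v i ≤ 1) : ∑ i, r i * y i ≤ √(∑ i, v i * y i ^ 2) := by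
  refine Real.le_sqrt_of_sq_le ?_
  have h1 : ∀ i ∈ Finset.univ, 0 ≤ r i ^ 2 / v i := fun i _ => div_nonneg (sq_nonneg _) (hv i).le
  have h2 : ∀ i ∈ Finset.univ, 0 ≤ v i * y i ^ 2 := fun i _ => mul_nonneg (hv i).le (sq_nonneg _)
  have := Finset.sum_sq_le_sum_mul_sum_of_sq_le_mul Finset.univ (r := fun i => r i * y i) h1 h2
    (fun i _ => le_of_eq (by have := (hv i).ne'; field_simp))
  exact this.trans (mul_le_of_le_one_left (Finset.sum_nonneg h2) h)

theorem variance_constants_le_C1 {b : ℝ} (hb : 0 ≤ b) :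
    √0.607 + √(16 * b ^ 3 + 16 * b ^ 4) + √(16 * b ^ 3 + 8 * b ^ 4) +
      (√(2 * b) + √(64 * b ^ 5) + √(48 * b ^ 4 + 32 * b ^ 5)) ≤ C1 b := by
  obtain ⟨x, hx, rfl⟩ : ∃ x : ℝ, 0 ≤ x ∧ b = x ^ 2 := ⟨√b, Real.sqrt_nonneg _, (Real.sq_sqrt hb).symm⟩
  -- With b = x², each square root on the left is at most a polynomial in x, essentially by
  -- completing the square.
  have u1 : √0.607 ≤ 0.78 := Real.sqrt_le_iff.2 (by norm_num)
  have u2 : √(16 * (x ^ 2) ^ 3 + 16 * (x ^ 2) ^ 4) ≤ 4 * x ^ 3 + 2 * x ^ 5 :=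
    Real.sqrt_le_iff.2 ⟨by positivity, by rw [← sub_nonneg]; ring_nf; positivity⟩
  have u3 : √(16 * (x ^ 2) ^ 3 + 8 * (x ^ 2) ^ 4) ≤ 4 * x ^ 3 + x ^ 5 :=
    Real.sqrt_le_iff.2 ⟨by positivity, by rw [← sub_nonneg]; ring_nf; positivity⟩
  have u4 : √(2 * x ^ 2) ≤ 1.415 * x :=
    Real.sqrt_le_iff.2 ⟨by positivity, by rw [← sub_nonneg]; ring_nf; positivity⟩
  have u5 : √(64 * (x ^ 2) ^ 5) ≤ 8 * x ^ 5 :=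
    Real.sqrt_le_iff.2 ⟨by positivity, by rw [← sub_nonneg]; ring_nf; positivity⟩
  have u6 : √(48 * (x ^ 2) ^ 4 + 32 * (x ^ 2) ^ 5) ≤ 6.93 * x ^ 4 + 2.31 * x ^ 6 :=
    Real.sqrt_le_iff.2 ⟨by positivity, by rw [← sub_nonneg]; ring_nf; positivity⟩
  -- The weights nearly exhaust the constraint and are tuned so that the lower bounds for the four
  -- square roots of C₁ cover the upper bounds in every power of x except x³.
  have l1 := sum_le_sqrt_sum ![1.12, 0.67, 0.8, 0.31, 0.03] ![3 / 2, 9 / 2, 12, 21 / 2, 6] ![1, x ^ 2, x ^ 3, x ^ 4, x ^ 6]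
    (by intro i; fin_cases i <;> norm_num) (by norm_num [Fin.sum_univ_succ])
  have l2 := sum_le_sqrt_sum ![1.12, 1.25, 7.65, 3.62, 0.72] ![4, 10, 136, 144, 144] ![x ^ 3, x ^ 4, x ^ 5, x ^ 6, x ^ 8]
    (by intro i; fin_cases i <;> norm_num) (by norm_num [Fin.sum_univ_succ])
  have l3 := sum_le_sqrt_sum ![1.37, 2.45, 0.55, 3.44, 0.88] ![4, 16, 8, 112, 144] ![x ^ 3, x ^ 4, x ^ 5, x ^ 6, x ^ 8]
    (by intro i; fin_cases i <;> norm_num) (by norm_num [Fin.sum_univ_succ])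
  have l4 := sum_le_sqrt_sum ![1.44, 3.11, 3.71, 8.5, 2.96, 4.52, 2.12] ![3, 72, 192, 984, 768, 2616, 6144]
    ![x, x ^ 4, x ^ 5, x ^ 6, x ^ 7, x ^ 8, x ^ 10]
    (by intro i; fin_cases i <;> norm_num) (by norm_num [Fin.sum_univ_succ])
  simp only [Fin.sum_univ_succ, Fin.sum_univ_zero, Matrix.cons_val_zero, Matrix.cons_val_succ,
    add_zero] at l1 l2 l3 l4
  have e1 : 3 * (1 / 2 + 3 / 2 * (x ^ 2) ^ 2 + 4 * (x ^ 2) ^ 3 + 7 / 2 * (x ^ 2) ^ 4 +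
      2 * (x ^ 2) ^ 6) = 3 / 2 * 1 ^ 2 + (9 / 2 * (x ^ 2) ^ 2 + (12 * (x ^ 3) ^ 2 +
        (21 / 2 * (x ^ 4) ^ 2 + 6 * (x ^ 6) ^ 2))) := by ring
  have e2 : 2 * (2 * (x ^ 2) ^ 3 + 5 * (x ^ 2) ^ 4 + 68 * (x ^ 2) ^ 5 + 72 * (x ^ 2) ^ 6 +
      72 * (x ^ 2) ^ 8) = 4 * (x ^ 3) ^ 2 + (10 * (x ^ 4) ^ 2 + (136 * (x ^ 5) ^ 2 +
        (144 * (x ^ 6) ^ 2 + 144 * (x ^ 8) ^ 2))) := by ring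
  have e3 : 2 * (2 * (x ^ 2) ^ 3 + 8 * (x ^ 2) ^ 4 + 4 * (x ^ 2) ^ 5 + 56 * (x ^ 2) ^ 6 +
      72 * (x ^ 2) ^ 8) = 4 * (x ^ 3) ^ 2 + (16 * (x ^ 4) ^ 2 + (8 * (x ^ 5) ^ 2 +
        (112 * (x ^ 6) ^ 2 + 144 * (x ^ 8) ^ 2))) := by ring
  have e4 : 3 * (x ^ 2 + 24 * (x ^ 2) ^ 4 + 64 * (x ^ 2) ^ 5 + 328 * (x ^ 2) ^ 6 +
      256 * (x ^ 2) ^ 7 + 872 * (x ^ 2) ^ 8 + 2048 * (x ^ 2) ^ 10) = 3 * x ^ 2 +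
        (72 * (x ^ 4) ^ 2 + (192 * (x ^ 5) ^ 2 + (984 * (x ^ 6) ^ 2 + (768 * (x ^ 7) ^ 2 +
          (2616 * (x ^ 8) ^ 2 + 6144 * (x ^ 10) ^ 2))))) := by ring
  unfold C1
  rw [e1, e2, e3, e4]
  have p5 : 0 ≤ x ^ 5 := by positivity
  have p7 : 0 ≤ x ^ 7 := by positivity
  have p8 : 0 ≤ x ^ 8 := by positivity
  have p10 : 0 ≤ x ^ 10 := by positivity
  have p6 : 0 ≤ x ^ 6 := by positivity
  -- The missing multiple of x³ is absorbed by two squares, one using the surplus in x² and x⁴, the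
  -- other the surplus in 1 and x⁶.
  have p2 : 0 ≤ x ^ 2 * (1 - 0.6 * x) ^ 2 := by positivity
  have s1 : 0 ≤ (1 - 6.5 * x ^ 3) ^ 2 := by positivity
  ring_nf at s1 p2
  linarith

end Constants

/-! ### From degree sequences to half-edge types -/

section Degrees

variable {n N : ℕ} (d : Fin n → ℕ) (own : Fin N → Fin n)

/-- The indicator of the half-edges at vertices of degree `k`. -/
def degInd (k : ℕ) (s : Fin N) : ℝ := if d (own s) = k then 1 else 0

open Classical in
/-- The other half-edge of a vertex of degree two. -/
def twin (s : Fin N) : Fin N :=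
  if h : d (own s) = 2 ∧ ∃ t, t ≠ s ∧ own t = own s then h.2.choose else s

variable {d own}

theorem degInd_eq_one {k : ℕ} {s : Fin N} : degInd d own k s = 1 ↔ d (own s) = k := by
  unfold degInd; split_ifs <;> simp_all

theorem own_twin (d : Fin n → ℕ) (own : Fin N → Fin n) (s : Fin N) : own (twin d own s) = own s := by
  unfold twin
  split_ifs with h
  · exact h.2.choose_spec.2
  · rfl

theorem eq_of_own_eq (hown : ∀ i, (Finset.univ.filter fun s => own s = i).card = d i) {s t : Fin N}
    (hs : d (own s) = 1) (h : own t = own s) : t = s := by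
  have := hown (own s)
  rw [hs] at this
  exact Finset.card_le_one.1 this.le t (by simpa using h) s (by simp)

theorem exists_ne_own_eq (hown : ∀ i, (Finset.univ.filter fun s => own s = i).card = d i)
    {s : Fin N} (hs : d (own s) = 2) : ∃ t, t ≠ s ∧ own t = own s := by
  have h1 : 1 < (Finset.univ.filter fun t => own t = own s).card := by rw [hown, hs]; norm_num
  obtain ⟨t, ht, hne⟩ := Finset.exists_mem_ne h1 s
  exact ⟨t, hne, by simpa using ht⟩

theorem twin_ne_self (hown : ∀ i, (Finset.univ.filter fun s => own s = i).card = d i)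
    {s : Fin N} (hs : d (own s) = 2) : twin d own s ≠ s := by
  have h : d (own s) = 2 ∧ ∃ t, t ≠ s ∧ own t = own s := ⟨hs, exists_ne_own_eq hown hs⟩
  unfold twin
  rw [dif_pos h]
  exact h.2.choose_spec.1

theorem eq_twin (hown : ∀ i, (Finset.univ.filter fun s => own s = i).card = d i) {s t : Fin N}
    (hs : d (own s) = 2) (hne : t ≠ s) (h : own t = own s) : t = twin d own s := by
  have h2 := hown (own s)
  rw [hs] at h2
  by_contra hc
  have hsub : ({s, t, twin d own s} : Finset (Fin N)) ⊆ Finset.univ.filter fun x => own x = own s := by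
    intro x hx
    simp only [Finset.mem_insert, Finset.mem_singleton] at hx
    rcases hx with rfl | rfl | rfl <;> simp [h, own_twin]
  have h3 := Finset.card_le_card hsub
  rw [Finset.card_eq_three.2 ⟨s, t, twin d own s, hne.symm, (twin_ne_self hown hs).symm, hc, rfl⟩,
    h2] at h3
  omega

theorem halfEdgeTypes (hown : ∀ i, (Finset.univ.filter fun s => own s = i).card = d i) :
    HalfEdgeTypes (degInd d own 1) (degInd d own 2) (twin d own) where
  leaf_zero_or_one x := by unfold degInd; split_ifs <;> simp
  mid_zero_or_one x := by unfold degInd; split_ifs <;> simp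
  leaf_of_mid x h := by
    rw [degInd_eq_one] at h
    unfold degInd
    rw [if_neg (by omega)]
  mid_twin x := by unfold degInd; rw [own_twin d own]
  twin_twin x := by
    by_cases h : d (own x) = 2
    · have h' : d (own (twin d own x)) = 2 := by rw [own_twin d own, h]
      exact (eq_twin hown h' (twin_ne_self hown h).symm (own_twin d own x).symm).symm
    · have e : ∀ y, ¬ d (own y) = 2 → twin d own y = y := fun y hy => by
        unfold twin
        rw [dif_neg fun h => hy h.1]
      rw [e x h, e x h]
  twin_ne x h := twin_ne_self hown (degInd_eq_one.1 h)

theorem sum_degInd (hown : ∀ i, (Finset.univ.filter fun s => own s = i).card = d i) (k : ℕ) :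
    ∑ s, degInd d own k s = k * numDeg d k := by
  rw [← Finset.sum_fiberwise Finset.univ own]
  have : ∀ i, ∑ s ∈ Finset.univ.filter (fun s => own s = i), degInd d own k s =
      if d i = k then (k : ℝ) else 0 := by
    intro i
    rw [Finset.sum_congr rfl (g := fun _ => if d i = k then (1 : ℝ) else 0), Finset.sum_const, hown]
    · split_ifs with h <;> simp [h]
    · intro s hs
      rw [← (Finset.mem_filter.1 hs).2, degInd]
  rw [Finset.sum_congr rfl fun i _ => this i, ← Finset.sum_filter, Finset.sum_const, numDeg]
  simp [mul_comm]

/-- Double counting: each isolated edge is seen from its two half-edges, and each 2-star from its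
two central half-edges. -/
theorem card_eq_two_mul_card {X Y : Type*} [DecidableEq Y] [DecidableEq X] {s : Finset X}
    {t : Finset Y} {f : X → Y} {σ : X → X} (hf : ∀ x ∈ s, f x ∈ t)
    (hsurj : ∀ y ∈ t, ∃ x ∈ s, f x = y) (hσ : ∀ x ∈ s, σ x ∈ s ∧ σ x ≠ x)
    (hfib : ∀ x ∈ s, ∀ z ∈ s, f z = f x ↔ z = x ∨ z = σ x) : s.card = 2 * t.card := by
  rw [Finset.card_eq_sum_card_fiberwise (t := t) (f := f) (fun x hx => hf x hx),
    Finset.sum_const_nat (m := 2), mul_comm]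
  intro y hy
  obtain ⟨x, hx, rfl⟩ := hsurj y hy
  have : (s.filter fun z => f z = f x) = {x, σ x} := by
    ext z
    simp only [Finset.mem_filter, Finset.mem_insert, Finset.mem_singleton]
    constructor
    · rintro ⟨hz, e⟩
      exact (hfib x hx z hz).1 e
    · intro h
      have hz : z ∈ s := by
        rcases h with rfl | rfl
        exacts [hx, (hσ x hx).1]
      exact ⟨hz, (hfib x hx z hz).2 h⟩
  rw [this, Finset.card_pair (hσ x hx).2.symm]

theorem sum_ind_eq_card (g : Matching N) (G : Finset (Finset (Sym2 (Fin N)))) :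
    ∑ β ∈ G, ind g β = (G.filter fun β => β ⊆ g.pairs).card := by
  classical
  simp [ind]

theorem sum_ind_possibleEdges (hown : ∀ i, (Finset.univ.filter fun s => own s = i).card = d i)
    (g : Matching N) : ∑ β ∈ possibleEdges d own, ind g β = edgeCount (degInd d own 1) g := by
  classical
  have h2 : (Finset.univ.filter fun x => d (own x) = 1 ∧ d (own (g.1 x)) = 1).card =
      2 * ((possibleEdges d own).filter fun β => β ⊆ g.pairs).card := by
    refine card_eq_two_mul_card (f := fun x => {s(x, g.1 x)}) (σ := g.1) ?_ ?_ ?_ ?_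
    · intro x hx
      simp only [Finset.mem_filter, Finset.mem_univ, true_and] at hx
      simp only [possibleEdges, Finset.mem_filter, Finset.mem_univ, true_and,
        Finset.singleton_subset_iff, Matching.mem_pairs, and_true]
      exact ⟨x, g.1 x, fun e => g.apply_ne x (eq_of_own_eq hown hx.1 e.symm), hx.1, hx.2, rfl⟩
    · intro β hβ
      simp only [possibleEdges, Finset.mem_filter, Finset.mem_univ, true_and] at hβ
      obtain ⟨⟨s, t, -, hs, ht, rfl⟩, hsub⟩ := hβ
      rw [Finset.singleton_subset_iff, Matching.mem_pairs] at hsub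
      exact ⟨s, by simp [hs, hsub, ht], by rw [hsub]⟩
    · intro x hx
      simp only [Finset.mem_filter, Finset.mem_univ, true_and] at hx ⊢
      rw [g.apply_apply]
      exact ⟨⟨hx.2, hx.1⟩, g.apply_ne x⟩
    · intro x _ z _
      rw [Finset.singleton_inj, Sym2.eq_iff]
      constructor
      · rintro (h | h)
        exacts [Or.inl h.1, Or.inr h.1]
      · rintro (rfl | rfl)
        · simp
        · simp [g.apply_apply]
  have h3 : ∑ x, degInd d own 1 x * degInd d own 1 (g.1 x) =
      (Finset.univ.filter fun x => d (own x) = 1 ∧ d (own (g.1 x)) = 1).card := by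
    rw [← Finset.sum_boole]
    refine Finset.sum_congr rfl fun x _ => ?_
    unfold degInd
    by_cases h1 : d (own x) = 1 <;> by_cases h2 : d (own (g.1 x)) = 1 <;> simp [h1, h2]
  rw [sum_ind_eq_card, edgeCount, h3, h2]
  push_cast
  ring

theorem pair_subset_pairs [DecidableEq (Sym2 (Fin N))] (g : Matching N) (s t u v : Fin N) :
    ({s(s, u), s(t, v)} : Finset (Sym2 (Fin N))) ⊆ g.pairs ↔ g.1 s = u ∧ g.1 t = v := by
  rw [Finset.insert_subset_iff, Finset.singleton_subset_iff, Matching.mem_pairs, Matching.mem_pairs]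

theorem sum_ind_possibleTwoStars (hown : ∀ i, (Finset.univ.filter fun s => own s = i).card = d i)
    (g : Matching N) : ∑ β ∈ possibleTwoStars d own, ind g β =
      starCount (degInd d own 1) (degInd d own 2) (twin d own) g := by
  classical
  set τ := twin d own with hτ
  have H := halfEdgeTypes hown
  have h2 : (Finset.univ.filter fun x => d (own x) = 2 ∧ d (own (g.1 x)) = 1 ∧
      d (own (g.1 (τ x))) = 1).card =
      2 * ((possibleTwoStars d own).filter fun β => β ⊆ g.pairs).card := by
    refine card_eq_two_mul_card (f := fun x => {s(g.1 x, x), s(g.1 (τ x), τ x)}) (σ := τ) ?_ ?_ ?_ ?_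
    · intro x hx
      simp only [Finset.mem_filter, Finset.mem_univ, true_and] at hx
      obtain ⟨h1, h2, h3⟩ := hx
      rw [Finset.mem_filter, pair_subset_pairs, g.apply_apply, g.apply_apply]
      refine ⟨?_, rfl, rfl⟩
      simp only [possibleTwoStars, Finset.mem_filter, Finset.mem_univ, true_and]
      refine ⟨g.1 x, g.1 (τ x), x, τ x, fun e => ?_, h2, h3, (twin_ne_self hown h1).symm,
        (own_twin d own x).symm, h1, by congr!⟩
      exact twin_ne_self hown h1 (g.injective (eq_of_own_eq hown h2 e.symm))
    · intro β hβ
      simp only [possibleTwoStars, Finset.mem_filter, Finset.mem_univ, true_and] at hβ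
      obtain ⟨⟨s, t, u, v, -, hs, ht, huv, ho, hu, rfl⟩, hsub⟩ := hβ
      have hsub' : g.1 s = u ∧ g.1 t = v := by
        rw [← pair_subset_pairs]
        convert hsub
      have hv : v = τ u := eq_twin hown hu huv.symm ho.symm
      have e1 : g.1 u = s := by rw [← hsub'.1, g.apply_apply]
      have e2 : g.1 v = t := by rw [← hsub'.2, g.apply_apply]
      refine ⟨u, ?_, ?_⟩
      · simp only [Finset.mem_filter, Finset.mem_univ, true_and]
        rw [← hv, e1, e2]
        exact ⟨hu, hs, ht⟩
      · rw [← hv, e1, e2]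
    · intro x hx
      simp only [Finset.mem_filter, Finset.mem_univ, true_and] at hx ⊢
      rw [hτ, own_twin d own, H.twin_twin]
      exact ⟨⟨hx.1, hx.2.2, hx.2.1⟩, twin_ne_self hown hx.1⟩
    · intro x hx z hz
      simp only [Finset.mem_filter, Finset.mem_univ, true_and] at hx hz
      constructor
      · intro e
        have hmem : s(g.1 z, z) ∈ ({s(g.1 x, x), s(g.1 (τ x), τ x)} : Finset (Sym2 (Fin N))) := by
          rw [← e]; exact Finset.mem_insert_self _ _
        have hd : ∀ y, d (own (g.1 y)) = 1 → z ≠ g.1 y := by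
          rintro y hy rfl
          omega
        rw [Finset.mem_insert, Finset.mem_singleton, Sym2.eq_iff, Sym2.eq_iff] at hmem
        rcases hmem with (h | h) | (h | h)
        · exact Or.inl h.2
        · exact absurd h.2 (hd x hx.2.1)
        · exact Or.inr h.2
        · exact absurd h.2 (hd _ hx.2.2)
      · rintro (rfl | rfl)
        · rfl
        · rw [hτ, H.twin_twin, Finset.pair_comm]
  have h3 : ∑ x, degInd d own 2 x * degInd d own 1 (g.1 x) * degInd d own 1 (g.1 (τ x)) =
      (Finset.univ.filter fun x => d (own x) = 2 ∧ d (own (g.1 x)) = 1 ∧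
        d (own (g.1 (τ x))) = 1).card := by
    rw [← Finset.sum_boole]
    refine Finset.sum_congr rfl fun x _ => ?_
    unfold degInd
    by_cases h1 : d (own x) = 2 <;> by_cases h2 : d (own (g.1 x)) = 1 <;>
      by_cases h3 : d (own (g.1 (τ x))) = 1 <;> simp [h1, h2, h3]
  rw [sum_ind_eq_card, starCount, h3, h2]
  push_cast
  ring

end Degrees

/-! ### Sums over the indices of a resampling -/

section Resampling

variable {N : ℕ}

theorem mk_inf_sup (e : Sym2 (Fin N)) : s(e.inf, e.sup) = e := by
  induction e using Sym2.ind with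
  | _ x y =>
    rw [Sym2.inf_mk, Sym2.sup_mk, Sym2.eq_iff]
    rcases le_total x y with h | h
    · simp [h]
    · simp [h]

theorem mk_lo_hi_mem (α : Finset (Sym2 (Fin N))) (l : Fin (numEdges α)) :
    s(lo α l, hi α l) ∈ α := by
  have h := (edgeSet α).orderEmbOfFin_mem rfl l
  obtain ⟨e, he, h'⟩ := Finset.mem_image.1 h
  unfold lo hi
  rw [← h']
  simpa [mk_inf_sup] using he

theorem numEdges_eq_card (α : Finset (Sym2 (Fin N))) : numEdges α = α.card := by
  refine Finset.card_image_of_injective _ fun e e' h => ?_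
  have h' := toLex.injective h
  rw [Prod.mk.injEq] at h'
  rw [← mk_inf_sup e, ← mk_inf_sup e', h'.1, h'.2]

theorem mk_lo_hi_injective (α : Finset (Sym2 (Fin N))) :
    Function.Injective fun l => s(lo α l, hi α l) := by
  intro l l' h
  refine ((edgeSet α).orderEmbOfFin rfl).injective (ofLex.injective ?_)
  have key : ∀ l, ofLex ((edgeSet α).orderEmbOfFin rfl l) =
      ((s(lo α l, hi α l)).inf, (s(lo α l, hi α l)).sup) := by
    intro l
    obtain ⟨e, he, h'⟩ := Finset.mem_image.1 ((edgeSet α).orderEmbOfFin_mem rfl l)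
    unfold lo hi
    rw [← h']
    simp [mk_inf_sup]
  refine (key l).trans (Eq.trans ?_ (key l').symm)
  simp only at h
  rw [h]

theorem sum_orderEmbOfFin (S : Finset (Fin N)) (φ : Fin N → ℝ) :
    ∑ i, φ (S.orderEmbOfFin rfl i) = ∑ t ∈ S, φ t := by
  rw [← Finset.sum_coe_sort S φ]
  exact Fintype.sum_equiv (S.orderIsoOfFin rfl).toEquiv _ _ fun i => rfl

/-- The number of steps is a variable equal to 1, so that the statement applies to `numEdges α`, on
which the types of the indices depend. -/
theorem sum_foldl_one {e : ℕ} (he : e = 1) (b : Fin e → Fin N) (S : Fin e → Finset (Fin N))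
    (T : Matching N → ℝ) (g : Matching N) :
    ∑ r : (∀ l, Fin (S l).card),
      T (Fin.foldl e (fun g' l => switch g' (b l) ((S l).orderEmbOfFin rfl (r l))) g) =
    ∑ t ∈ S ⟨0, by omega⟩, T (switch g (b ⟨0, by omega⟩) t) := by
  subst he
  rw [← sum_orderEmbOfFin]
  refine Fintype.sum_equiv (Equiv.piUnique _) _ _ fun r => ?_
  simp [Fin.foldl_succ]

theorem sum_foldl_two {e : ℕ} (he : e = 2) (b : Fin e → Fin N) (S : Fin e → Finset (Fin N))
    (T : Matching N → ℝ) (g : Matching N) :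
    ∑ r : (∀ l, Fin (S l).card),
      T (Fin.foldl e (fun g' l => switch g' (b l) ((S l).orderEmbOfFin rfl (r l))) g) =
    ∑ t ∈ S ⟨0, by omega⟩, ∑ t' ∈ S ⟨1, by omega⟩,
      T (switch (switch g (b ⟨0, by omega⟩) t) (b ⟨1, by omega⟩) t') := by
  subst he
  have h1 : ∀ t, ∑ t' ∈ S 1, T (switch (switch g (b 0) t) (b 1) t') =
      ∑ i, T (switch (switch g (b 0) t) (b 1) ((S 1).orderEmbOfFin rfl i)) :=
    fun t => (sum_orderEmbOfFin (S 1) fun t' => T (switch (switch g (b 0) t) (b 1) t')).symm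
  refine Eq.trans ?_ (Finset.sum_congr rfl fun t _ => (h1 t).symm)
  refine Eq.trans ?_ (sum_orderEmbOfFin (S 0) fun t =>
    ∑ i, T (switch (switch g (b 0) t) (b 1) ((S 1).orderEmbOfFin rfl i)))
  rw [← Fintype.sum_prod_type']
  refine Fintype.sum_equiv (piFinTwoEquiv fun l => Fin (S l).card) _ _ fun r => ?_
  simp [Fin.foldl_succ]

end Resampling

/-! ### Mean change of a statistic under resampling -/

section ResampleMean

variable {N : ℕ}

theorem prod_fin_one {e : ℕ} (he : e = 1) (f : Fin e → ℝ) : ∏ l, f l = f ⟨0, by omega⟩ := by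
  subst he; simp

theorem prod_fin_two {e : ℕ} (he : e = 2) (f : Fin e → ℝ) :
    ∏ l, f l = f ⟨0, by omega⟩ * f ⟨1, by omega⟩ := by
  subst he; simp [Fin.prod_univ_two]

theorem card_erase_cast (x : Fin N) : ((Finset.univ.erase x).card : ℝ) = N - 1 := by
  have := x.pos
  rw [Finset.card_erase_of_mem (Finset.mem_univ _), Finset.card_univ, Fintype.card_fin,
    Nat.cast_sub (by omega), Nat.cast_one]

/-- The mean change of `T` when the pair of an isolated edge is resampled. -/
theorem mean_resample_edge {x y : Fin N} {α : Finset (Sym2 (Fin N))} (hα : α = {s(x, y)})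
    (T : Matching N → ℝ) {g : Matching N} (hg : g.1 x = y) : ∃ i, (i = x ∨ i = y) ∧
      (∏ l, (numChoices α l : ℝ))⁻¹ * ∑ r, (T g - T (resample α g r)) =
        (∑ t, (T g - T (switch g i t))) / (N - 1) := by
  have he : numEdges α = 1 := by rw [numEdges_eq_card, hα, Finset.card_singleton]
  set o : Fin (numEdges α) := ⟨0, by omega⟩ with ho
  have hm := mk_lo_hi_mem α o
  have hmem : ∀ e ∈ α, e = s(x, y) := by
    intro e h
    rw [hα] at h
    simpa using h
  have hlo : g.1 (hi α o) = lo α o ∧ (hi α o = x ∨ hi α o = y) := by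
    rcases Sym2.eq_iff.1 (hmem _ hm) with h | h
    · exact ⟨by rw [h.1, h.2, ← hg, g.apply_apply], Or.inr h.2⟩
    · exact ⟨by rw [h.1, h.2, hg], Or.inl h.2⟩
  have hS : choiceSet α o = Finset.univ.erase (lo α o) := by
    ext t
    have : ∀ m : Fin (numEdges α), ¬ o < m := fun m h => by
      have := Fin.lt_def.1 h
      have := m.2
      omega
    simp [choiceSet, this]
  refine ⟨hi α o, hlo.2, ?_⟩
  have hsum : ∑ r, (T g - T (resample α g r)) =
      ∑ t ∈ choiceSet α o, (T g - T (switch g (hi α o) t)) :=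
    sum_foldl_one he (hi α) (choiceSet α) (fun g' => T g - T g') g
  -- The only excluded choice is the partner of the switched half-edge. It would change nothing, so
  -- the sum is extended to all N half-edges while the normalization stays N − 1.
  rw [hsum, prod_fin_one he, numChoices, ← ho, hS, card_erase_cast,
    ← Finset.add_sum_erase Finset.univ _ (Finset.mem_univ (lo α o)), ← hlo.1, switch_partner,
    sub_self, zero_add, div_eq_inv_mul]

theorem sum_sub_switch_partner (T : Matching N → ℝ) (g : Matching N) (x : Fin N) :
    ∑ t, (T g - T (switch g (g.1 x) t)) = ∑ t, (T g - T (switch g x t)) := by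
  rw [← sum_comp_partner g fun t => T g - T (switch g (g.1 x) t)]
  simp only [switch_partner_partner]

theorem sum_erase_sub_switch (T : Matching N → ℝ) {g : Matching N} {x y z : Fin N}
    (h : y = g.1 x ∧ z = x ∨ y = x ∧ z = g.1 x) :
    ∑ t ∈ Finset.univ.erase y, (T g - T (switch g z t)) = ∑ t, (T g - T (switch g x t)) := by
  have hyz : y = g.1 z := by
    rcases h with ⟨rfl, rfl⟩ | ⟨rfl, rfl⟩
    · rfl
    · rw [g.apply_apply]
  have e : ∑ t ∈ Finset.univ.erase y, (T g - T (switch g z t)) = ∑ t, (T g - T (switch g z t)) := by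
    rw [← Finset.add_sum_erase Finset.univ _ (Finset.mem_univ y), hyz, switch_partner, sub_self,
      zero_add]
  rw [e]
  rcases h with ⟨-, rfl⟩ | ⟨-, rfl⟩
  · rfl
  · exact sum_sub_switch_partner T g x

variable {a c : Fin N → ℝ} {τ : Fin N → Fin N}

/-- The mean change of `T` when the two pairs of an isolated 2-star are resampled. -/
theorem HalfEdgeTypes.mean_resample_star_aux (h : HalfEdgeTypes a c τ) {α : Finset (Sym2 (Fin N))}
    (he : numEdges α = 2) (T : Matching N → ℝ) {g : Matching N} {u : Fin N} (hu : c u = 1)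
    (hs : a (g.1 u) = 1) (hw : a (g.1 (τ u)) = 1)
    (h0 : s(lo α ⟨0, by omega⟩, hi α ⟨0, by omega⟩) = s(g.1 u, u))
    (h1 : s(lo α ⟨1, by omega⟩, hi α ⟨1, by omega⟩) = s(g.1 (τ u), τ u)) :
    (∏ l, (numChoices α l : ℝ))⁻¹ * ∑ r, (T g - T (resample α g r)) =
      (∑ t ∈ starChoice τ g u, (((N : ℝ) - 1) * (T g - T (switch g u t)) +
        ∑ t', (T (switch g u t) - T (switch (switch g u t) (τ u) t')))) / ((N - 1) * (N - 3)) := by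
  set o0 : Fin (numEdges α) := ⟨0, by omega⟩ with ho0
  set o1 : Fin (numEdges α) := ⟨1, by omega⟩ with ho1
  have hlt : o0 < o1 := by rw [Fin.lt_def]; simp [ho0, ho1]
  have hτu : c (τ u) = 1 := by rw [h.mid_twin, hu]
  have n1 : g.1 u ≠ g.1 (τ u) := fun e => h.twin_ne u hu (g.injective e).symm
  have n2 : g.1 u ≠ τ u := (h.ne_of_mid_leaf hτu hs).symm
  have n3 : g.1 (τ u) ≠ τ u := (h.ne_of_mid_leaf hτu hw).symm
  have n4 : u ≠ g.1 (τ u) := h.ne_of_mid_leaf hu hw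
  have n5 : u ≠ τ u := (h.twin_ne u hu).symm
  have hS1 : choiceSet α o1 = Finset.univ.erase (lo α o1) := by
    ext t
    have : ∀ m : Fin (numEdges α), ¬ o1 < m := fun m h => by
      have h3 : 1 < (m : ℕ) := Fin.lt_def.1 h
      have := m.2
      omega
    simp [choiceSet, this]
  have hS0 : choiceSet α o0 = Finset.univ \ {lo α o0, g.1 (τ u), τ u} := by
    ext t
    have hm : (∀ m, o0 < m → t ≠ lo α m ∧ t ≠ hi α m) ↔ t ≠ g.1 (τ u) ∧ t ≠ τ u := by
      have h2 : (∀ m, o0 < m → t ≠ lo α m ∧ t ≠ hi α m) ↔ t ≠ lo α o1 ∧ t ≠ hi α o1 := by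
        constructor
        · intro h; exact h o1 hlt
        · intro h m hm
          have : m = o1 := Fin.ext (by
            have h3 := Fin.lt_def.1 hm
            have := m.2
            simp only [ho0, ho1] at h3 ⊢
            omega)
          rw [this]; exact h
      rw [h2]
      rcases Sym2.eq_iff.1 h1 with h | h
      · rw [h.1, h.2]
      · rw [h.1, h.2, and_comm]
    simp only [choiceSet, Finset.mem_filter, Finset.mem_univ, true_and, Finset.mem_sdiff,
      Finset.mem_insert, Finset.mem_singleton, not_or]
    rw [hm]
  have hcard : ((choiceSet α o0).card : ℝ) = N - 3 := by
    have hne : lo α o0 ≠ g.1 (τ u) ∧ lo α o0 ≠ τ u := by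
      rcases Sym2.eq_iff.1 h0 with h | h
      · rw [h.1]; exact ⟨n1, n2⟩
      · rw [h.1]; exact ⟨n4, n5⟩
    have h3 := Finset.card_eq_three.2 ⟨_, _, _, hne.1, hne.2, n3, rfl⟩
    have h4 := Finset.card_le_univ ({lo α o0, g.1 (τ u), τ u} : Finset (Fin N))
    rw [h3, Fintype.card_fin] at h4
    rw [hS0, Finset.card_sdiff_of_subset (Finset.subset_univ _), h3, Finset.card_univ,
      Fintype.card_fin, Nat.cast_sub h4]
    norm_num
  have hsum : ∑ r, (T g - T (resample α g r)) = ∑ t ∈ choiceSet α o0, ∑ t' ∈ choiceSet α o1,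
      (T g - T (switch (switch g (hi α o0) t) (hi α o1) t')) :=
    sum_foldl_two he (hi α) (choiceSet α) (fun g' => T g - T g') g
  -- The larger half-edge of the first pair may be `u` or its partner. In the second case t ↦ g t
  -- carries the choices over, because switching at both partners gives the same matching.
  have hswap : ∀ φ : Matching N → ℝ, ∑ t ∈ choiceSet α o0, φ (switch g (hi α o0) t) =
      ∑ t ∈ starChoice τ g u, φ (switch g u t) := by
    intro φ
    rw [hS0]
    rcases Sym2.eq_iff.1 h0 with h | h
    · rw [h.1, h.2]; rfl
    · rw [h.1, h.2]
      refine Finset.sum_bij' (fun t _ => g.1 t) (fun t _ => g.1 t) ?_ ?_ ?_ ?_ ?_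
      · intro t ht
        simp only [starChoice, Finset.mem_sdiff, Finset.mem_univ, true_and, Finset.mem_insert,
          Finset.mem_singleton, not_or] at ht ⊢
        refine ⟨fun e => ht.1 (g.injective e), fun e => ht.2.2 (g.injective e), fun e => ?_⟩
        exact ht.2.1 ((g.apply_eq_iff).1 e)
      · intro t ht
        simp only [starChoice, Finset.mem_sdiff, Finset.mem_univ, true_and, Finset.mem_insert,
          Finset.mem_singleton, not_or] at ht ⊢
        refine ⟨fun e => ht.1 ((g.apply_eq_iff).1 e), fun e => ht.2.2 (g.injective e), fun e => ?_⟩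
        exact ht.2.1 ((g.apply_eq_iff).1 e)
      · intro t _; exact g.apply_apply t
      · intro t _; exact g.apply_apply t
      · intro t _
        rw [← switch_partner_partner g u (g.1 t), g.apply_apply]
  rw [hsum, hswap fun g1 => ∑ t' ∈ choiceSet α o1, (T g - T (switch g1 (hi α o1) t')),
    prod_fin_two he, ← ho0, ← ho1, numChoices, numChoices, hcard, hS1, card_erase_cast, mul_comm,
    ← div_eq_mul_inv, mul_comm ((N : ℝ) - 3)]
  congr 1
  refine Finset.sum_congr rfl fun t ht => ?_
  have hg1 := (h.switch_starChoice hu hs ht).1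
  have hor : lo α o1 = (switch g u t).1 (τ u) ∧ hi α o1 = τ u ∨
      lo α o1 = τ u ∧ hi α o1 = (switch g u t).1 (τ u) := by
    rw [hg1]
    exact Sym2.eq_iff.1 h1
  rw [← sum_erase_sub_switch T hor, ← card_erase_cast (lo α o1), ← nsmul_eq_mul,
    ← Finset.sum_const, ← Finset.sum_add_distrib]
  exact Finset.sum_congr rfl fun t' _ => by ring

theorem HalfEdgeTypes.mean_resample_star (h : HalfEdgeTypes a c τ) {α : Finset (Sym2 (Fin N))}
    [DecidableEq (Sym2 (Fin N))]
    (T : Matching N → ℝ) {g : Matching N} {u : Fin N} (hu : c u = 1) (hs : a (g.1 u) = 1)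
    (hw : a (g.1 (τ u)) = 1) (hα : α = {s(g.1 u, u), s(g.1 (τ u), τ u)}) :
    ∃ v, c v = 1 ∧ a (g.1 v) = 1 ∧ a (g.1 (τ v)) = 1 ∧
    (∏ l, (numChoices α l : ℝ))⁻¹ * ∑ r, (T g - T (resample α g r)) =
      (∑ t ∈ starChoice τ g v, (((N : ℝ) - 1) * (T g - T (switch g v t)) +
        ∑ t', (T (switch g v t) - T (switch (switch g v t) (τ v) t')))) / ((N - 1) * (N - 3)) := by
  have hτu : c (τ u) = 1 := by rw [h.mid_twin, hu]
  have hne : s(g.1 u, u) ≠ s(g.1 (τ u), τ u) := by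
    intro e
    rcases Sym2.eq_iff.1 e with e | e
    · exact h.twin_ne u hu e.2.symm
    · exact h.ne_of_mid_leaf hτu hs e.1.symm
  have he : numEdges α = 2 := by rw [numEdges_eq_card, hα, Finset.card_pair hne]
  set o0 : Fin (numEdges α) := ⟨0, by omega⟩ with ho0
  set o1 : Fin (numEdges α) := ⟨1, by omega⟩ with ho1
  have m0 := mk_lo_hi_mem α o0
  have m1 := mk_lo_hi_mem α o1
  have m01 : s(lo α o0, hi α o0) ≠ s(lo α o1, hi α o1) := fun e => by
    have := mk_lo_hi_injective α e
    simp [ho0, ho1] at this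
  have hmem : ∀ e ∈ α, e = s(g.1 u, u) ∨ e = s(g.1 (τ u), τ u) := by
    intro e h
    rw [hα] at h
    simpa using h
  have m0' := hmem _ m0
  have m1' := hmem _ m1
  rcases m0' with e0 | e0
  · have e1 := m1'.resolve_left fun e1 => m01 (e0.trans e1.symm)
    exact ⟨u, hu, hs, hw, h.mean_resample_star_aux he T hu hs hw e0 e1⟩
  · have e1 := m1'.resolve_right fun e1 => m01 (e0.trans e1.symm)
    have hs' : a (g.1 (τ (τ u))) = 1 := by rw [h.twin_twin, hs]
    refine ⟨τ u, hτu, hw, hs', h.mean_resample_star_aux he T hτu hw hs' e0 ?_⟩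
    rw [h.twin_twin]
    exact e1

end ResampleMean

/-! ### Conditional expectations given the matching -/

section Conditioning

theorem integral_uniformOn_univ {X : Type*} [Fintype X] [MeasurableSpace X]
    [MeasurableSingletonClass X] [Nonempty X] (φ : X → ℝ) :
    ∫ x, φ x ∂(uniformOn (Set.univ : Set X)) = (∑ x, φ x) / Fintype.card X := by
  rw [integral_fintype Integrable.of_finite, Finset.sum_div]
  refine Finset.sum_congr rfl fun x _ => ?_
  rw [Measure.real, uniformOn_univ, Measure.count_singleton]
  simp [div_eq_inv_mul]

variable {Ω : Type*} {m : MeasurableSpace Ω} [mΩ : MeasurableSpace Ω] {P : Measure Ω} [IsProbabilityMeasure P]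

theorem integral_comp_uniform {X : Type*} [Fintype X] [MeasurableSpace X]
    [MeasurableSingletonClass X] {Y : Ω → X} (hY : Measurable Y)
    (hu : P.map Y = uniformOn Set.univ) (φ : X → ℝ) :
    ∫ ω, φ (Y ω) ∂P = (∑ x, φ x) / Fintype.card X := by
  obtain ⟨ω⟩ : Nonempty Ω := nonempty_of_isProbabilityMeasure P
  have : Nonempty X := ⟨Y ω⟩
  rw [← integral_uniformOn_univ, ← hu, integral_map hY.aemeasurable]
  exact (measurable_of_finite φ).aestronglyMeasurable

theorem integral_comp_iIndepFun_uniform {e : ℕ} {k : Fin e → ℕ} {X : ∀ l, Ω → Fin (k l)}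
    (hX : ∀ l, Measurable (X l)) (hu : ∀ l, P.map (X l) = uniformOn Set.univ)
    (hi : iIndepFun X P) (f : (∀ l, Fin (k l)) → ℝ) :
    ∫ ω, f (fun l => X l ω) ∂P = (∏ l, (k l : ℝ))⁻¹ * ∑ r, f r := by
  obtain ⟨ω⟩ : Nonempty Ω := nonempty_of_isProbabilityMeasure P
  have hne : ∀ l, Nonempty (Fin (k l)) := fun l => ⟨X l ω⟩
  have hm : Measurable fun ω l => X l ω := measurable_pi_lambda _ hX
  have hpi := (iIndepFun_iff_map_fun_eq_pi_map fun l => (hX l).aemeasurable).1 hi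
  simp only [hu] at hpi
  have e1 : ∫ ω, f (fun l => X l ω) ∂P = ∫ r, f r ∂(Measure.pi fun l => uniformOn Set.univ) := by
    rw [← hpi, integral_map hm.aemeasurable]
    exact (measurable_of_finite f).aestronglyMeasurable
  rw [e1, integral_fintype Integrable.of_finite, Finset.mul_sum]
  refine Finset.sum_congr rfl fun r _ => ?_
  rw [Measure.real, Measure.pi_singleton, ENNReal.toReal_prod, smul_eq_mul, ← Finset.prod_inv_distrib]
  congr 1
  refine Finset.prod_congr rfl fun l _ => ?_
  rw [uniformOn_univ, Measure.count_singleton]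
  simp

variable {X Y : Type*} [Finite X] [MeasurableSpace X] [MeasurableSingletonClass X]
  [Finite Y] [MeasurableSpace Y] [MeasurableSingletonClass Y] {U : Ω → X} {V : Ω → Y}

theorem memLp_comp_of_finite {Z : Type*} [Finite Z] [MeasurableSpace Z]
    [MeasurableSingletonClass Z] {W : Ω → Z} (hW : Measurable W) (φ : Z → ℝ) :
    MemLp (fun ω => φ (W ω)) 2 P := by
  obtain ⟨b, hb⟩ := (Set.finite_range fun z => ‖φ z‖).bddAbove
  refine MemLp.of_bound ((measurable_of_finite φ).comp hW).aestronglyMeasurable b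
    (Filter.Eventually.of_forall fun ω => hb ⟨W ω, rfl⟩)

/-- The conditional expectation of a function of `U` and an independent `V`, given `U`. -/
theorem condExp_comp_of_indepFun (hU : Measurable U) (hV : Measurable V) (hUV : IndepFun U V P)
    (hm : m = MeasurableSpace.comap U inferInstance) (Φ : X → Y → ℝ) :
    P[fun ω => Φ (U ω) (V ω) | m] =ᵐ[P] fun ω => ∫ ω', Φ (U ω) (V ω') ∂P := by
  have := Fintype.ofFinite X
  have hle : m ≤ mΩ := hm ▸ hU.comap_le
  have hint : ∀ x, Integrable (fun ω => Φ x (V ω)) P := fun x =>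
    (memLp_comp_of_finite hV (Φ x)).integrable (by norm_num)
  have hset : ∀ x, MeasurableSet[m] (U ⁻¹' {x}) := fun x => by
    rw [hm]
    exact ⟨{x}, measurableSet_singleton x, rfl⟩
  -- Split by the finitely many values of `U`; on each of these events the second argument is
  -- independent of the conditioning.
  have e1 : (fun ω => Φ (U ω) (V ω)) =
      ∑ x, (U ⁻¹' {x}).indicator fun ω => Φ x (V ω) := by
    funext ω
    rw [Finset.sum_apply, Finset.sum_eq_single (U ω)]
    · simp
    · intro x _ hx
      exact Set.indicator_of_notMem (fun h => hx h.symm) _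
    · simp
  have e2 : ∀ x, P[fun ω => Φ x (V ω) | m] =ᵐ[P] fun _ => ∫ ω', Φ x (V ω') ∂P := fun x =>
    condExp_indep_eq hV.comap_le hle
      (((measurable_of_finite (Φ x)).comp (comap_measurable V)).stronglyMeasurable)
      (hm ▸ (IndepFun_iff_Indep _ _ _).1 hUV.symm)
  rw [e1]
  refine (condExp_finsetSum (fun x _ => (hint x).indicator (hle _ (hset x))) m).trans ?_
  have e3 : ∀ᵐ ω ∂P, ∀ x, (P[(U ⁻¹' {x}).indicator (fun ω => Φ x (V ω)) | m]) ω =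
      (U ⁻¹' {x}).indicator (fun _ => ∫ ω', Φ x (V ω') ∂P) ω := by
    rw [ae_all_iff]
    intro x
    filter_upwards [condExp_indicator (hint x) (hset x), e2 x] with ω h1 h2
    rw [h1]
    by_cases hω : ω ∈ U ⁻¹' {x}
    · rw [Set.indicator_of_mem hω, Set.indicator_of_mem hω, h2]
    · rw [Set.indicator_of_notMem hω, Set.indicator_of_notMem hω]
  filter_upwards [e3] with ω hω
  rw [Finset.sum_apply, Finset.sum_eq_single (U ω)]
  · rw [hω]; simp
  · intro x _ hx
    rw [hω]
    exact Set.indicator_of_notMem (fun h => hx h.symm) _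
  · simp

/-- Conditioning on less than `U` gives a variance at most that of the conditional expectation
given `U`. -/
theorem variance_condExp_le_of_indepFun (hU : Measurable U) (hV : Measurable V)
    (hUV : IndepFun U V P) (Φ : X → Y → ℝ)
    (hm : m ≤ MeasurableSpace.comap U inferInstance) :
    variance (P[fun ω => Φ (U ω) (V ω) | m]) P ≤
      variance (fun ω => ∫ ω', Φ (U ω) (V ω') ∂P) P := by
  have hle := hU.comap_le
  -- By the tower property the conditional expectation given `m` is that of the conditional
  -- expectation given `U`; the law of total variance finishes the proof.
  have h1 : P[fun ω => Φ (U ω) (V ω) | m] =ᵐ[P] P[fun ω => ∫ ω', Φ (U ω) (V ω') ∂P | m] :=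
    (condExp_condExp_of_le hm hle).symm.trans
      (condExp_congr_ae (condExp_comp_of_indepFun hU hV hUV rfl Φ))
  rw [variance_congr h1]
  have h2 := integral_condVar_add_variance_condExp (hm.trans hle)
    (memLp_comp_of_finite (P := P) hU fun x => ∫ ω', Φ x (V ω') ∂P)
  have h3 : 0 ≤ ∫ ω, (condVar m (fun ω => ∫ ω', Φ (U ω) (V ω') ∂P) P) ω ∂P :=
    integral_nonneg_of_ae (condExp_nonneg (Filter.Eventually.of_forall fun ω => sq_nonneg _))
  linarith

theorem variance_comp_uniform {N : ℕ} {𝔤 : Ω → Matching N} (hg : Measurable 𝔤)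
    (hu : P.map 𝔤 = uniformOn Set.univ) (φ : Matching N → ℝ) :
    variance (fun ω => φ (𝔤 ω)) P = mvar φ := by
  rw [variance_eq_integral (X := fun ω => φ (𝔤 ω)) ((measurable_of_finite φ).comp hg).aemeasurable,
    integral_comp_uniform hg hu φ]
  exact integral_comp_uniform hg hu fun g => (φ g - avg φ) ^ 2

end Conditioning

/-! ### The four conditional expectations and the final sum -/

section SteinSums

variable {n N : ℕ} {d : Fin n → ℕ} {own : Fin N → Fin n} {Ω : Type*} {𝔤 : Ω → Matching N}
  {B : ∀ p : StepIndex d own, Ω → Fin (numChoices p.1.1 p.2)}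

/-- The sum `∑_{α ∈ Γ₁ⱼ} I_α ∑_{β ∈ Γ₁ₖ} (I_β - J_{βα})`, as a function of the matching and of the
random indices. -/
def steinKernel (d : Fin n → ℕ) (own : Fin N → Fin n) (j k : Fin 2) (g : Matching N)
    (b : ∀ p : StepIndex d own, Fin (numChoices p.1.1 p.2)) : ℝ :=
  ∑ α : {α // α ∈ Gam1 d own j}, ind g α.1 * ∑ β ∈ Gam1 d own k,
    (ind g β - ind (coupled α.1 g fun l => b ⟨⟨α.1, mem_Gam_of_mem_Gam1 d own α.2⟩, l⟩) β)

theorem steinSum_eq (j k : Fin 2) : steinSum d own 𝔤 B j k =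
    fun ω => steinKernel d own j k (𝔤 ω) fun p => B p ω := rfl

variable {m : MeasurableSpace Ω} [mΩ : MeasurableSpace Ω] {P : Measure Ω} [IsProbabilityMeasure P]

/-- For a matching `g` only the α realized in `g` contribute, and for these the sum over β of the
indicator differences is the change of a single statistic `T`. When its mean is the same number `v`
for all such α, the whole sum is their number times `v`. -/
theorem integral_steinKernel (hB_meas : ∀ p, Measurable (B p))
    (hB_unif : ∀ p, P.map (B p) = uniformOn Set.univ) (hB_indep : iIndepFun B P) {j k : Fin 2}
    {T : Matching N → ℝ} (hT : ∀ g, ∑ β ∈ Gam1 d own k, ind g β = T g) {g : Matching N} {v : ℝ}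
    (hv : ∀ α ∈ Gam1 d own j, α ⊆ g.pairs →
      (∏ l, (numChoices α l : ℝ))⁻¹ * ∑ r, (T g - T (resample α g r)) = v) :
    ∫ ω, steinKernel d own j k g (fun p => B p ω) ∂P = (∑ α ∈ Gam1 d own j, ind g α) * v := by
  have hB : Measurable fun ω p => B p ω := measurable_pi_lambda _ hB_meas
  unfold steinKernel
  rw [integral_finsetSum, ← Finset.sum_coe_sort (Gam1 d own j) fun α => ind g α, Finset.sum_mul]
  · refine Finset.sum_congr rfl fun α _ => ?_
    rw [integral_const_mul]
    by_cases h : α.1 ⊆ g.pairs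
    · congr 1
      have e : ∀ ω, ∑ β ∈ Gam1 d own k, (ind g β - ind (coupled α.1 g fun l =>
          B ⟨⟨α.1, mem_Gam_of_mem_Gam1 d own α.2⟩, l⟩ ω) β) =
          T g - T (resample α.1 g fun l => B ⟨⟨α.1, mem_Gam_of_mem_Gam1 d own α.2⟩, l⟩ ω) := by
        intro ω
        rw [Finset.sum_sub_distrib, hT, hT, coupled, if_pos h]
      simp only [e]
      rw [← hv α.1 α.2 h]
      refine integral_comp_iIndepFun_uniform (k := fun l => numChoices α.1 l)
        (X := fun l => B ⟨⟨α.1, mem_Gam_of_mem_Gam1 d own α.2⟩, l⟩) (fun l => hB_meas _)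
        (fun l => hB_unif _) ?_ fun r => T g - T (resample α.1 g r)
      exact hB_indep.precomp (g := fun l => (⟨⟨α.1, mem_Gam_of_mem_Gam1 d own α.2⟩, l⟩ :
        StepIndex d own)) fun l l' hl => by simpa using hl
    · rw [ind, if_neg h, zero_mul, zero_mul]
  · intro α _
    exact (memLp_comp_of_finite hB fun b => ind g α.1 * ∑ β ∈ Gam1 d own k,
      (ind g β - ind (coupled α.1 g fun l => b ⟨⟨α.1, mem_Gam_of_mem_Gam1 d own α.2⟩, l⟩) β)).integrable
        (by norm_num)

theorem variance_condExp_steinSum_le (h𝔤_meas : Measurable 𝔤) (hB_meas : ∀ p, Measurable (B p))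
    (h𝔤_unif : P.map 𝔤 = uniformOn Set.univ) (h𝔤B_indep : IndepFun 𝔤 (fun ω p => B p ω) P)
    (hm : m ≤ MeasurableSpace.comap 𝔤 inferInstance) {j k : Fin 2} {f : Matching N → ℝ}
    (hf : ∀ g, ∫ ω, steinKernel d own j k g (fun p => B p ω) ∂P = f g) :
    variance (P[steinSum d own 𝔤 B j k | m]) P ≤ mvar f := by
  rw [steinSum_eq]
  refine (variance_condExp_le_of_indepFun h𝔤_meas (measurable_pi_lambda _ hB_meas) h𝔤B_indep
    (steinKernel d own j k) hm).trans (le_of_eq ?_)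
  simp only [hf]
  exact variance_comp_uniform h𝔤_meas h𝔤_unif f

theorem mean_resample_possibleEdges {g : Matching N}
    {α : Finset (Sym2 (Fin N))} (hα : α ∈ possibleEdges d own) (hg : α ⊆ g.pairs)
    (T : Matching N → ℝ) {v : ℝ}
    (hv : ∀ i, degInd d own 1 i = 1 → degInd d own 1 (g.1 i) = 1 →
      ∑ t, (T g - T (switch g i t)) = v) :
    (∏ l, (numChoices α l : ℝ))⁻¹ * ∑ r, (T g - T (resample α g r)) = v / (N - 1) := by
  simp only [possibleEdges, Finset.mem_filter, Finset.mem_univ, true_and] at hα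
  obtain ⟨s, t, -, hs, ht, rfl⟩ := hα
  rw [Finset.singleton_subset_iff, Matching.mem_pairs] at hg
  obtain ⟨i, hi, e⟩ := mean_resample_edge rfl T hg
  rw [e, hv]
  · rw [degInd_eq_one]
    rcases hi with rfl | rfl <;> assumption
  · rw [degInd_eq_one]
    rcases hi with rfl | rfl
    · rwa [hg]
    · rwa [← hg, g.apply_apply]

theorem mean_resample_possibleTwoStars
    (hown : ∀ i, (Finset.univ.filter fun s => own s = i).card = d i) {g : Matching N}
    {α : Finset (Sym2 (Fin N))} (hα : α ∈ possibleTwoStars d own) (hg : α ⊆ g.pairs)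
    (T : Matching N → ℝ) {v : ℝ}
    (hv : ∀ u, degInd d own 2 u = 1 → degInd d own 1 (g.1 u) = 1 →
      degInd d own 1 (g.1 (twin d own u)) = 1 →
      ∑ t ∈ starChoice (twin d own) g u, (((N : ℝ) - 1) * (T g - T (switch g u t)) +
        ∑ t', (T (switch g u t) - T (switch (switch g u t) (twin d own u) t'))) = v) :
    (∏ l, (numChoices α l : ℝ))⁻¹ * ∑ r, (T g - T (resample α g r)) = v / ((N - 1) * (N - 3)) := by
  simp only [possibleTwoStars, Finset.mem_filter, Finset.mem_univ, true_and] at hα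
  obtain ⟨s, t, u, w, -, hs, ht, huw, ho, hu, hα⟩ := hα
  rw [hα, pair_subset_pairs] at hg
  obtain rfl : w = twin d own u := eq_twin hown hu huw.symm ho.symm
  have e1 : g.1 u = s := by rw [← hg.1, g.apply_apply]
  have e2 : g.1 (twin d own u) = t := by rw [← hg.2, g.apply_apply]
  rw [← e1, ← e2] at hα
  obtain ⟨x, h1, h2, h3, e⟩ := (halfEdgeTypes hown).mean_resample_star T (degInd_eq_one.2 hu)
    (degInd_eq_one.2 (e1 ▸ hs)) (degInd_eq_one.2 (e2 ▸ ht)) hα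
  rw [e, hv x h1 h2 h3]

theorem sum_ind_Gam1_zero (hown : ∀ i, (Finset.univ.filter fun s => own s = i).card = d i)
    (g : Matching N) : ∑ β ∈ Gam1 d own 0, ind g β = edgeCount (degInd d own 1) g :=
  sum_ind_possibleEdges hown g

theorem sum_ind_Gam1_one (hown : ∀ i, (Finset.univ.filter fun s => own s = i).card = d i)
    (g : Matching N) : ∑ β ∈ Gam1 d own 1, ind g β =
      starCount (degInd d own 1) (degInd d own 2) (twin d own) g :=
  sum_ind_possibleTwoStars hown g

theorem sum_sqrt_variance_condExp_steinSum_le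
    (hown : ∀ i, (Finset.univ.filter fun s => own s = i).card = d i) (hN : 15 < N)
    (hn1 : 1 ≤ numDeg d 1) {b : ℝ}
    (hb : max (numDeg d 1 : ℝ) (numDeg d 2 : ℝ) / ((N : ℝ) - 15) ≤ b)
    (h𝔤_meas : Measurable 𝔤) (hB_meas : ∀ p, Measurable (B p))
    (h𝔤_unif : P.map 𝔤 = uniformOn Set.univ)
    (hB_unif : ∀ p, P.map (B p) = uniformOn Set.univ) (hB_indep : iIndepFun B P)
    (h𝔤B_indep : IndepFun 𝔤 (fun ω p => B p ω) P)
    (hm : m ≤ MeasurableSpace.comap 𝔤 inferInstance) :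
    ∑ j : Fin 2, ∑ k : Fin 2, √(variance (P[steinSum d own 𝔤 B j k | m]) P) ≤
      C1 b * (max (numDeg d 1 : ℝ) (numDeg d 2 : ℝ) / √((N : ℝ) - 1)) := by
  set M : ℝ := max (numDeg d 1 : ℝ) (numDeg d 2 : ℝ) with hM
  have hN' : (16 : ℝ) ≤ N := by exact_mod_cast hN
  have H := halfEdgeTypes hown
  have hn1' : (1 : ℝ) ≤ numDeg d 1 := by exact_mod_cast hn1
  have hA : ∑ x, degInd d own 1 x = numDeg d 1 := by rw [sum_degInd hown]; simp
  have hC : ∑ x, degInd d own 2 x = 2 * numDeg d 2 := by rw [sum_degInd hown]; simp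
  have hA1 : 1 ≤ ∑ x, degInd d own 1 x := by rw [hA]; exact hn1'
  have hAM : ∑ x, degInd d own 1 x ≤ M := by rw [hA]; exact le_max_left _ _
  have hCM : ∑ x, degInd d own 2 x ≤ 2 * M := by
    rw [hC]
    exact mul_le_mul_of_nonneg_left (le_max_right _ _) (by norm_num)
  have hMb : M ≤ b * (N - 15) := by rwa [div_le_iff₀ (by linarith)] at hb
  have hM0 : 0 ≤ M := by linarith
  have hb0 : 0 ≤ b := le_trans (div_nonneg hM0 (by linarith)) hb
  -- `starCount` is defined as half of a real sum; integrality comes from its identification with a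
  -- number of realized 2-stars.
  have hint : ∀ g, ∃ k : ℕ, starCount (degInd d own 1) (degInd d own 2) (twin d own) g = k :=
    fun g => ⟨_, (sum_ind_Gam1_one hown g).symm.trans (sum_ind_eq_card g _)⟩
  have hU : √(M ^ 2 / ((N : ℝ) - 1)) = M / √((N : ℝ) - 1) := by
    rw [Real.sqrt_div (sq_nonneg M), Real.sqrt_sq hM0]
  have v00 : √(variance (P[steinSum d own 𝔤 B 0 0 | m]) P) ≤
      √0.607 * √(M ^ 2 / ((N : ℝ) - 1)) := by
    rw [← Real.sqrt_mul (by norm_num)]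
    refine Real.sqrt_le_sqrt ((variance_condExp_steinSum_le h𝔤_meas hB_meas h𝔤_unif h𝔤B_indep hm
      fun g => ?_).trans (H.mvar_edgeEdge_le (by omega) hAM))
    rw [integral_steinKernel hB_meas hB_unif hB_indep (sum_ind_Gam1_zero hown) fun α hα hg =>
      mean_resample_possibleEdges hα hg _ fun i h1 h2 => by
        rw [sum_edgeCount_sub_switch, h1, h2], sum_ind_Gam1_zero hown]
    unfold edgeEdge
    ring
  have v01 : √(variance (P[steinSum d own 𝔤 B 0 1 | m]) P) ≤
      √(16 * b ^ 3 + 16 * b ^ 4) * √(M ^ 2 / ((N : ℝ) - 1)) := by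
    rw [← Real.sqrt_mul (by positivity)]
    refine Real.sqrt_le_sqrt ((variance_condExp_steinSum_le h𝔤_meas hB_meas h𝔤_unif h𝔤B_indep hm
      fun g => ?_).trans (H.mvar_edgeStar_le (by omega) hA1 hAM hCM hMb))
    rw [integral_steinKernel hB_meas hB_unif hB_indep (sum_ind_Gam1_one hown) fun α hα hg =>
      mean_resample_possibleEdges hα hg _ fun i h1 h2 =>
        H.sum_starCount_sub_switch_edge h1 h2, sum_ind_Gam1_zero hown]
    unfold edgeStar
    ring
  have v10 : √(variance (P[steinSum d own 𝔤 B 1 0 | m]) P) ≤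
      √(16 * b ^ 3 + 8 * b ^ 4) * √(M ^ 2 / ((N : ℝ) - 1)) := by
    rw [← Real.sqrt_mul (by positivity)]
    refine Real.sqrt_le_sqrt ((variance_condExp_steinSum_le h𝔤_meas hB_meas h𝔤_unif h𝔤B_indep hm
      fun g => ?_).trans (H.mvar_starEdge_le (by omega) hAM hCM hMb))
    rw [integral_steinKernel hB_meas hB_unif hB_indep (sum_ind_Gam1_zero hown) fun α hα hg =>
      mean_resample_possibleTwoStars hown hα hg _ fun u h1 h2 h3 =>
        H.sum_edgeCount_resample_star h1 h2 h3, sum_ind_Gam1_one hown]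
    unfold starEdge
    ring
  have v11 : √(variance (P[steinSum d own 𝔤 B 1 1 | m]) P) ≤
      (√(2 * b) + √(64 * b ^ 5) + √(48 * b ^ 4 + 32 * b ^ 5)) * √(M ^ 2 / ((N : ℝ) - 1)) := by
    refine (Real.sqrt_le_sqrt (variance_condExp_steinSum_le h𝔤_meas hB_meas h𝔤_unif h𝔤B_indep hm
      fun g => ?_)).trans (H.sqrt_mvar_starStar_le (by omega) hAM hCM hMb hint)
    rw [integral_steinKernel hB_meas hB_unif hB_indep (sum_ind_Gam1_one hown) fun α hα hg =>
      mean_resample_possibleTwoStars hown hα hg _ fun u h1 h2 h3 =>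
        H.sum_starCount_resample_star h1 h2 h3, sum_ind_Gam1_one hown]
    unfold starStar
    ring
  have hfin := mul_le_mul_of_nonneg_right (variance_constants_le_C1 hb0)
    (Real.sqrt_nonneg (M ^ 2 / ((N : ℝ) - 1)))
  rw [← hU, Fin.sum_univ_two, Fin.sum_univ_two, Fin.sum_univ_two]
  linarith

end SteinSums

/-- Every map on a finite space with measurable points is measurable, so anything computed from the
matching generates a smaller σ-algebra. This covers both choices of W₂ at once. -/
theorem comap_le_comap_of_factors {Ω X Z : Type*} [MeasurableSpace X] [Finite X]
    [MeasurableSingletonClass X] [MeasurableSpace Z] {U : Ω → X} {f : Ω → Z} (ψ : X → Z)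
    (h : ∀ ω, f ω = ψ (U ω)) :
    MeasurableSpace.comap f inferInstance ≤ MeasurableSpace.comap U inferInstance := by
  have : f = ψ ∘ U := funext h
  rw [this, ← MeasurableSpace.comap_comp]
  exact MeasurableSpace.comap_mono (measurable_of_finite ψ).comap_le

end ConfigModel

end

theorem proposition4p2 {n N : ℕ} (d : Fin n → ℕ) (own : Fin N → Fin n)
    (hown : ∀ i, (Finset.univ.filter fun s => own s = i).card = d i)
    (hEven : Even N) (hN : 15 < N) (hn1 : 1 ≤ ConfigModel.numDeg d 1)
    (c : ℝ)
    (hc : max (ConfigModel.numDeg d 1 : ℝ) (ConfigModel.numDeg d 2 : ℝ) / ((N : ℝ) - 15) ≤ c)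
    {Ω : Type*} [MeasurableSpace Ω] (P : MeasureTheory.Measure Ω)
    [MeasureTheory.IsProbabilityMeasure P]
    (𝔤 : Ω → ConfigModel.Matching N)
    (B : ∀ p : ConfigModel.StepIndex d own, Ω → Fin (ConfigModel.numChoices p.1.1 p.2))
    (h𝔤_meas : Measurable 𝔤) (hB_meas : ∀ p, Measurable (B p))
    (h𝔤_unif : P.map 𝔤 = ProbabilityTheory.uniformOn Set.univ)
    (hB_unif : ∀ p, P.map (B p) = ProbabilityTheory.uniformOn Set.univ)
    (hB_indep : ProbabilityTheory.iIndepFun B P)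
    (h𝔤B_indep : ProbabilityTheory.IndepFun 𝔤 (fun ω p => B p ω) P) :
    (∑ j : Fin 2, ∑ k : Fin 2,
        √(ProbabilityTheory.variance
          (P[ConfigModel.steinSum d own 𝔤 B j k | MeasurableSpace.comap
            (fun ω => (ConfigModel.W1 d own 𝔤 P ω, ConfigModel.W2 own 𝔤 ω)) inferInstance]) P) ≤
      ConfigModel.C1 c *
        (max (ConfigModel.numDeg d 1 : ℝ) (ConfigModel.numDeg d 2 : ℝ) / √((N : ℝ) - 1))) ∧
    (∑ j : Fin 2, ∑ k : Fin 2,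
        √(ProbabilityTheory.variance
          (P[ConfigModel.steinSum d own 𝔤 B j k | MeasurableSpace.comap
            (fun ω => (ConfigModel.W1 d own 𝔤 P ω,
              ConfigModel.W2 own 𝔤 ω 0 + ConfigModel.W2 own 𝔤 ω 1)) inferInstance]) P) ≤
      ConfigModel.C1 c *
        (max (ConfigModel.numDeg d 1 : ℝ) (ConfigModel.numDeg d 2 : ℝ) / √((N : ℝ) - 1))) := by

  refine ⟨ConfigModel.sum_sqrt_variance_condExp_steinSum_le hown hN hn1 hc h𝔤_meas hB_meas h𝔤_unif
      hB_unif hB_indep h𝔤B_indep (ConfigModel.comap_le_comap_of_factors (fun g =>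
        (fun j => (∑ α ∈ ConfigModel.Gam1 d own j, (ConfigModel.ind g α -
            ∫ ω', ConfigModel.I 𝔤 α ω' ∂P)) / √(n : ℝ),
          fun j => ∑ α ∈ ConfigModel.Gam2 own j, ConfigModel.ind g α)) fun ω => rfl),
    ConfigModel.sum_sqrt_variance_condExp_steinSum_le hown hN hn1 hc h𝔤_meas hB_meas h𝔤_unif
      hB_unif hB_indep h𝔤B_indep (ConfigModel.comap_le_comap_of_factors (fun g =>
        (fun j => (∑ α ∈ ConfigModel.Gam1 d own j, (ConfigModel.ind g α -
            ∫ ω', ConfigModel.I 𝔤 α ω' ∂P)) / √(n : ℝ),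
          ∑ α ∈ ConfigModel.Gam2 own 0, ConfigModel.ind g α +
            ∑ α ∈ ConfigModel.Gam2 own 1, ConfigModel.ind g α)) fun ω => rfl)⟩
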